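/- For each sample size $n$ let $(X,Y)$ be a centered random vector in $\mathbb R^{p}\times\mathbb R^{q}$ ($p=p_n$, $q=q_n$ and the law may depend on $n$) with covariance matrices $\Sigma_x=\mathrm{cov}(X)$, $\Sigma_y=\mathrm{cov}(Y)$, $\Sigma_{xy}=\mathrm{cov}(X,Y)=\Sigma_{yx}^T$, and let $(X_j,Y_j)_{j=1}^n$ be i.i.d. copies of $(X,Y)$. $X$ and $Y$ are sub-Gaussian, with sub-Gaussian norms bounded in $n$. For a fixed $r\ge 1$ write $\Sigma_{xy}=\Sigma_xU\Lambda V^T\Sigma_y$ with $U^T\Sigma_xU=V^T\Sigma_yV=I_r$ and $\Lambda=\mathrm{diag}(\Lambda_1,\dots,\Lambda_r)$, $\Lambda_1\ge\dots\ge\Lambda_r>0$ (put $\Lambda_2=0$ if $r=1$). Let $(\alpha_0,\beta_0)$ maximize $\alpha^T\Sigma_{xy}\beta$ subject to $\alpha^T\Sigma_x\alpha=\beta^T\Sigma_y\beta=1$, let $\rho_0=\alpha_0^T\Sigma_{xy}\beta_0$ be the maximum, and $x^0=\rho_0^{1/2}\alpha_0$, $y^0=\rho_0^{1/2}\beta_0$.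 Let $s_U$, $s_V$ be the numbers of nonzero rows of $U$, $V$, $s=s_U+s_V$, and $\lambda=(\log(p\vee q)/n)^{1/2}$. Let $$H^0=2\rho_0\begin{bmatrix}\Sigma_x+2\Sigma_x\alpha_0\alpha_0^T\Sigma_x&-\Sigma_{xy}/\rho_0\\-\Sigma_{yx}/\rho_0&\Sigma_y+2\Sigma_y\beta_0\beta_0^T\Sigma_y\end{bmatrix},\qquad \Phi^0=(H^0)^{-1}.$$ Assume that for some $\epsilon_0\in(0,1)$, $M>0$, $\kappa\in[1/2,1]$ that do not depend on $n$: 1. $\rho_0-\Lambda_2>\epsilon_0$ for all $n$, and all eigenvalues of $\Sigma_x$ and $\Sigma_y$ lie in $[M^{-1},M]$ for all $n$; 2. $s_U=o(p)$, $s_V=o(q)$ and $s^{2\kappa}\lambda^2=o(n^{-1/2})$; 3. the random vectors $\hat\alpha_n\in\mathbb R^p$, $\hat\beta_n\in\mathbb R^q$ satisfy $\min_{w=\pm1}\|w\hat\alpha_n-\alpha_0\|_2+\min_{w=\pm1}\|w\hat\beta_n-\beta_0\|_2=O_p(s^{\kappa}\lambda)$ and $\min_{w=\pm1}\|w\hat\alpha_n-\alpha_0\|_1+\min_{w=\pm1}\|w\hat\beta_n-\beta_0\|_1=O_p(s^{\kappa+1/2}\lambda)$;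 4. the random matrix $\hat\Phi_n\in\mathbb R^{(p+q)\times(p+q)}$ satisfies $\max_{j}\|(\hat\Phi_n)_j-\Phi^0_j\|_1=O_p(s^{\kappa+1/2}\lambda)$ and $\max_j\|(\hat\Phi_n)_j-\Phi^0_j\|_2=O_p(s^{\kappa}\lambda)$, where a subscript $j$ denotes the $j$th column. With $\hat\Sigma_{x}=n^{-1}\sum_jX_jX_j^T$, $\hat\Sigma_{y}=n^{-1}\sum_jY_jY_j^T$, $\hat\Sigma_{xy}=n^{-1}\sum_jX_jY_j^T=\hat\Sigma_{yx}^T$ put $$\hat\rho_n=\frac{\hat\alpha_n^T\hat\Sigma_{xy}\hat\beta_n}{(\hat\alpha_n^T\hat\Sigma_x\hat\alpha_n)^{1/2}(\hat\beta_n^T\hat\Sigma_y\hat\beta_n)^{1/2}},\quad \hat x=|\hat\rho_n|^{1/2}\hat\alpha_n,\quad \hat y=|\hat\rho_n|^{1/2}\hat\beta_n,$$ $$\begin{bmatrix}\hat x^{db}\\ \hat y^{db}\end{bmatrix}=\begin{bmatrix}\hat x\\ \hat y\end{bmatrix}-\hat\Phi_n^T\begin{bmatrix}2(\hat x^T\hat\Sigma_x\hat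 x)\hat\Sigma_x\hat x-2\hat\Sigma_{xy}\hat y\\2(\hat y^T\hat\Sigma_y\hat y)\hat\Sigma_y\hat y-2\hat\Sigma_{yx}\hat x\end{bmatrix},$$ and assume that the signs of the preliminary estimators are chosen so that $\hat x^T\hat\Sigma_{xy}\hat y\ge0$ with probability tending to one. For $1\le i\le p$ let $\Phi^0_i=(\phi_1,\phi_2)$, $\phi_1\in\mathbb R^p$, $\phi_2\in\mathbb R^q$, be the $i$th column of $\Phi^0$, and $\sigma_i^2=\mathrm{var}(\mathcal Z(i))$ with $$\mathcal Z(i)=[\rho_0\phi_1^T+(\phi_1^T\Sigma_xx^0)(x^0)^T]XX^Tx^0+[\rho_0\phi_2^T+(\phi_2^T\Sigma_yy^0)(y^0)^T]YY^Ty^0-\phi_1^TXY^Ty^0-(x^0)^TXY^T\phi_2 .$$ Since the population may change with $n$, say that random variables $T_n$ have asymptotic law $\nu_n$ if $E f(T_n)-\int f\,d\nu_n\to0$ for each bounded continuous $f:\mathbb R\to\mathbb R$; if $\nu_n$ does not depend on $n$, or converges weakly to some $\nu$, this is convergence in distribution of $T_n$ to that law. Then for each sequence of coordinates $i=i_n\in\{1,\dots,p_n\}$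 (in particular for a fixed $i$): - If $\alpha_{0,i}\neq0$ for all large $n$, then $n^{1/2}\{(\hat x^{db}_i)^2-(x^0_i)^2\}$ has asymptotic law $N(0,16\sigma_i^2(x^0_i)^2)$; in particular, if $16\sigma_i^2(x_i^0)^2\to v$, it converges in distribution to $N(0,v)$. - If $\alpha_{0,i}=0$ for all large $n$, then $n(\hat x^{db}_i)^2$ has asymptotically the law of $4\sigma_i^2\chi^2_1$; in particular, if $\sigma_i^2\to\tau$, it converges in distribution to $4\tau$ times a $\chi^2_1$ variable. -/

import Mathlib

open MeasureTheory ProbabilityTheory Filter Topology Matrix Asymptotics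
open scoped NNReal ENNReal BoundedContinuousFunction

noncomputable section

namespace SCCA

/-! ### Population quantities -/

/-- The population objects of canonical correlation analysis for a pair `(X, Y)` of random vectors
in `ℝ^p` and `ℝ^q`: the joint law of `(X, Y)`, the matrices `U`, `V` and the canonical correlations
`corr` of the decomposition `Σ_xy = Σ_x U diag(corr) Vᵀ Σ_y`, and a pair `(α, β)` of first canonical
directions. The relations between them are stated in `Population.IsCCA`. -/
structure Population (r p q : ℕ) where
  law : Measure ((Fin p → ℝ) × (Fin q → ℝ))
  U : Matrix (Fin p) (Fin r) ℝ
  V : Matrix (Fin q) (Fin r) ℝ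
  corr : Fin r → ℝ
  α : Fin p → ℝ
  β : Fin q → ℝ

/-- All (real) eigenvalues of the square matrix `S` lie in `[M⁻¹, M]`. -/
def EigenvaluesBounded {m : ℕ} (S : Matrix (Fin m) (Fin m) ℝ) (M : ℝ) : Prop :=
  ∀ t : ℝ, Module.End.HasEigenvalue (Matrix.toLin' S) t → M⁻¹ ≤ t ∧ t ≤ M

namespace Population

variable {r p q : ℕ} (θ : Population r p q)

/-- The covariance matrix of `X`. -/
def covX : Matrix (Fin p) (Fin p) ℝ :=
  Matrix.of fun k l => covariance (fun z => z.1 k) (fun z => z.1 l) θ.law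

/-- The covariance matrix of `Y`. -/
def covY : Matrix (Fin q) (Fin q) ℝ :=
  Matrix.of fun k l => covariance (fun z => z.2 k) (fun z => z.2 l) θ.law

/-- The cross-covariance matrix of `X` and `Y`. -/
def covXY : Matrix (Fin p) (Fin q) ℝ :=
  Matrix.of fun k l => covariance (fun z => z.1 k) (fun z => z.2 l) θ.law

/-- The feasible set of the problem that defines the first canonical directions. -/
def feasible : Set ((Fin p → ℝ) × (Fin q → ℝ)) :=
  {ab | ab.1 ⬝ᵥ θ.covX *ᵥ ab.1 = 1 ∧ ab.2 ⬝ᵥ θ.covY *ᵥ ab.2 = 1}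

/-- The first canonical correlation: the value of `αᵀ Σ_xy β` at the maximiser `(α, β)`. -/
def rho : ℝ := θ.α ⬝ᵥ θ.covXY *ᵥ θ.β

/-- `(X, Y)` is centered with law `θ.law`, `Σ_xy = Σ_x U Λ Vᵀ Σ_y` with
`Uᵀ Σ_x U = I`, `Vᵀ Σ_y V = I` and `Λ₁ ≥ … ≥ Λ_r > 0`, and `(α, β)` maximises `αᵀ Σ_xy β` subject
to `αᵀ Σ_x α = βᵀ Σ_y β = 1`. -/
structure IsCCA : Prop where
  isProb : IsProbabilityMeasure θ.law
  meanX : ∀ k, ∫ z, z.1 k ∂θ.law = 0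
  meanY : ∀ k, ∫ z, z.2 k ∂θ.law = 0
  decomp : θ.covXY = θ.covX * θ.U * Matrix.diagonal θ.corr * θ.Vᵀ * θ.covY
  orthU : θ.Uᵀ * θ.covX * θ.U = 1
  orthV : θ.Vᵀ * θ.covY * θ.V = 1
  corr_anti : Antitone θ.corr
  corr_pos : ∀ j, 0 < θ.corr j
  feasible_mem : (θ.α, θ.β) ∈ θ.feasible
  isMax : IsMaxOn (fun ab : (Fin p → ℝ) × (Fin q → ℝ) => ab.1 ⬝ᵥ θ.covXY *ᵥ ab.2)
    θ.feasible (θ.α, θ.β)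

/-- The random vectors `X` and `Y` are sub-Gaussian with variance proxy `K`: so is each of their
one-dimensional marginals in the direction of a unit vector. -/
def SubGaussian (K : ℝ≥0) : Prop :=
  (∀ a : Fin p → ℝ, a ⬝ᵥ a = 1 → HasSubgaussianMGF (fun z => a ⬝ᵥ z.1) K θ.law) ∧
  (∀ b : Fin q → ℝ, b ⬝ᵥ b = 1 → HasSubgaussianMGF (fun z => b ⬝ᵥ z.2) K θ.law)

/-- The second canonical correlation `Λ₂`, which is `0` if the rank is one. -/
def corr₂ : ℝ := if h : 1 < r then θ.corr ⟨1, h⟩ else 0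

/-- The number of nonzero rows of `U`. -/
def sU : ℕ := {k | ∃ j, θ.U k j ≠ 0}.ncard

/-- The number of nonzero rows of `V`. -/
def sV : ℕ := {k | ∃ j, θ.V k j ≠ 0}.ncard

/-- The total sparsity `s = s_U + s_V`. -/
def s : ℕ := θ.sU + θ.sV

/-- `x⁰ = ρ^{1/2} α`. -/
def x0 : Fin p → ℝ := √θ.rho • θ.α

/-- `y⁰ = ρ^{1/2} β`. -/
def y0 : Fin q → ℝ := √θ.rho • θ.β

/-- The Hessian `H⁰` at `(x⁰, y⁰)` of
`h(x, y) = (xᵀ Σ_x x)² / 2 + (yᵀ Σ_y y)² / 2 - 2 xᵀ Σ_xy y`. -/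
def H0 : Matrix (Fin p ⊕ Fin q) (Fin p ⊕ Fin q) ℝ :=
  (2 * θ.rho) • Matrix.fromBlocks
    (θ.covX + (2 : ℝ) • (θ.covX * vecMulVec θ.α θ.α * θ.covX)) (-(θ.rho⁻¹ • θ.covXY))
    (-(θ.rho⁻¹ • θ.covXYᵀ)) (θ.covY + (2 : ℝ) • (θ.covY * vecMulVec θ.β θ.β * θ.covY))

/-- `Φ⁰`, the inverse of `H⁰`. -/
def Phi0 : Matrix (Fin p ⊕ Fin q) (Fin p ⊕ Fin q) ℝ := θ.H0⁻¹

/-- The random variable `𝒵(i)`, as a function of `z = (X, Y)`. -/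
def calZ (i : Fin p) (z : (Fin p → ℝ) × (Fin q → ℝ)) : ℝ :=
  let φ₁ : Fin p → ℝ := fun k => θ.Phi0 (Sum.inl k) (Sum.inl i)
  let φ₂ : Fin q → ℝ := fun k => θ.Phi0 (Sum.inr k) (Sum.inl i)
  ((θ.rho • φ₁ + (φ₁ ⬝ᵥ θ.covX *ᵥ θ.x0) • θ.x0) ⬝ᵥ z.1) * (z.1 ⬝ᵥ θ.x0)
    + ((θ.rho • φ₂ + (φ₂ ⬝ᵥ θ.covY *ᵥ θ.y0) • θ.y0) ⬝ᵥ z.2) * (z.2 ⬝ᵥ θ.y0)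
    - (φ₁ ⬝ᵥ z.1) * (z.2 ⬝ᵥ θ.y0) - (θ.x0 ⬝ᵥ z.1) * (z.2 ⬝ᵥ φ₂)

/-- `σ_i² = var(𝒵(i))`. -/
def sigmaSq (i : Fin p) : ℝ := variance (θ.calZ i) θ.law

end Population

/-! ### Estimators -/

section Estimators

variable {n p q : ℕ} (z : Fin n → (Fin p → ℝ) × (Fin q → ℝ))

/-- The empirical estimate of `Σ_x` from a sample of the centered pair `(X, Y)`. -/
def hatCovX : Matrix (Fin p) (Fin p) ℝ := (n : ℝ)⁻¹ • ∑ j, vecMulVec (z j).1 (z j).1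

/-- The empirical estimate of `Σ_y`. -/
def hatCovY : Matrix (Fin q) (Fin q) ℝ := (n : ℝ)⁻¹ • ∑ j, vecMulVec (z j).2 (z j).2

/-- The empirical estimate of `Σ_xy`. -/
def hatCovXY : Matrix (Fin p) (Fin q) ℝ := (n : ℝ)⁻¹ • ∑ j, vecMulVec (z j).1 (z j).2

variable (a : Fin p → ℝ) (b : Fin q → ℝ)

/-- The estimate of the first canonical correlation from preliminary estimates `a`, `b`. -/
def hatRho : ℝ :=
  (a ⬝ᵥ hatCovXY z *ᵥ b) / (√(a ⬝ᵥ hatCovX z *ᵥ a) * √(b ⬝ᵥ hatCovY z *ᵥ b))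

/-- `x̂ = |ρ̂|^{1/2} α̂`. -/
def hatX : Fin p → ℝ := √|hatRho z a b| • a

/-- `ŷ = |ρ̂|^{1/2} β̂`. -/
def hatY : Fin q → ℝ := √|hatRho z a b| • b

/-- The estimated partial gradient of `h` in `x`, at `(x, y)`. -/
def gradX (x : Fin p → ℝ) (y : Fin q → ℝ) : Fin p → ℝ :=
  (2 * (x ⬝ᵥ hatCovX z *ᵥ x)) • (hatCovX z *ᵥ x) - (2 : ℝ) • (hatCovXY z *ᵥ y)

/-- The estimated partial gradient of `h` in `y`, at `(x, y)`. -/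
def gradY (x : Fin p → ℝ) (y : Fin q → ℝ) : Fin q → ℝ :=
  (2 * (y ⬝ᵥ hatCovY z *ᵥ y)) • (hatCovY z *ᵥ y) - (2 : ℝ) • ((hatCovXY z)ᵀ *ᵥ x)

/-- The stacked de-biased estimator `(x̂^db, ŷ^db)`, where `Φ` estimates `Φ⁰`. -/
def debiased (Φ : Matrix (Fin p ⊕ Fin q) (Fin p ⊕ Fin q) ℝ) : Fin p ⊕ Fin q → ℝ :=
  Sum.elim (hatX z a b) (hatY z a b) -
    Φᵀ *ᵥ Sum.elim (gradX z (hatX z a b) (hatY z a b)) (gradY z (hatX z a b) (hatY z a b))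

/-- The `i`-th coordinate of `x̂^db`. -/
def debiasedX (Φ : Matrix (Fin p ⊕ Fin q) (Fin p ⊕ Fin q) ℝ) (i : Fin p) : ℝ :=
  debiased z a b Φ (Sum.inl i)

end Estimators

/-! ### Rates and convergence -/

/-- `λ = (log (p ∨ q) / n)^{1/2}`. -/
def lam (n p q : ℕ) : ℝ := √(Real.log (max p q : ℕ) / n)

def l1norm {ι : Type*} [Fintype ι] (v : ι → ℝ) : ℝ := ∑ k, |v k|

def l2norm {ι : Type*} [Fintype ι] (v : ι → ℝ) : ℝ := √(∑ k, v k ^ 2)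

/-- `inf_{w ∈ {1, -1}} ‖w a - α‖₁`. -/
def signErr1 {m : ℕ} (a α : Fin m → ℝ) : ℝ := min (l1norm (a - α)) (l1norm (-a - α))

/-- `inf_{w ∈ {1, -1}} ‖w a - α‖₂`. -/
def signErr2 {m : ℕ} (a α : Fin m → ℝ) : ℝ := min (l2norm (a - α)) (l2norm (-a - α))

/-- The largest `ℓ¹` norm of a column of `A - B`. -/
def maxColErr1 {ι : Type*} [Fintype ι] (A B : Matrix ι ι ℝ) : ℝ :=
  ⨆ j, l1norm fun k => A k j - B k j

/-- The largest `ℓ²` norm of a column of `A - B`. -/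
def maxColErr2 {ι : Type*} [Fintype ι] (A B : Matrix ι ι ℝ) : ℝ :=
  ⨆ j, l2norm fun k => A k j - B k j

section Convergence

variable {Ω : ℕ → Type*} [∀ n, MeasurableSpace (Ω n)]

/-- `T n = O_p(rate n)`. -/
def IsBigOp (P : ∀ n, Measure (Ω n)) (T : ∀ n, Ω n → ℝ) (rate : ℕ → ℝ) : Prop :=
  ∀ ε : ℝ, 0 < ε → ∃ C : ℝ, ∀ᶠ n in atTop,
    P n {ω | C * rate n < |T n ω|} ≤ ENNReal.ofReal ε

/-- The law of `T n` is asymptotically `ν n`: for each bounded continuous test function `f`,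
`E f(T n) - ∫ f dν n` tends to `0`. If `ν n` does not depend on `n` this is convergence
in distribution to it. -/
def AsympLaw (P : ∀ n, Measure (Ω n)) (T : ∀ n, Ω n → ℝ) (ν : ℕ → Measure ℝ) : Prop :=
  (∀ n, AEMeasurable (T n) (P n)) ∧
    ∀ f : ℝ →ᵇ ℝ, Tendsto (fun n => ∫ ω, f (T n ω) ∂P n - ∫ x, f x ∂ν n) atTop (𝓝 0)

end Convergence

/-- The chi-squared law with one degree of freedom: the law of the square of a standard
normal variable. -/
def chiSqOne : Measure ℝ := (gaussianReal 0 1).map fun x => x ^ 2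

instance : IsProbabilityMeasure chiSqOne :=
  Measure.isProbabilityMeasure_map (by fun_prop)

end SCCA

end

noncomputable section

namespace SCCA

/-! ### Exponential moments -/

/-! The de-biased estimator is one Newton step, started at the preliminary estimator, for the
empirical version of `h(x, y) = (xᵀ Σ_x x)² / 2 + (yᵀ Σ_y y)² / 2 - 2 xᵀ Σ_xy y`. The Lagrange
conditions `Σ_xy β = ρ Σ_x α`, `Σ_yx α = ρ Σ_y β` say that the population gradient vanishes at `(x⁰,
y⁰)`. Since `Φ⁰` inverts the Hessian there, the step cancels the error of the preliminary estimator
to first order. Up to a common sign `w`, the `i`-th coordinate of the result is `x⁰ i - L + R`,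
where `L` (`leading`) is the `i`-th column of `Φ⁰` paired with the part of the empirical gradient at
`(x⁰, y⁰)` that is linear in the deviation of the sample covariances (`gradient_expansion`,
`exists_sign_debiasedX`).

Every term of `R` has two small factors. A deviation paired with an estimation error is at most the
entrywise deviation, of order `λ`, times an `ℓ¹` error of order `s^(κ+1/2) λ`; two estimation errors
are paired by Cauchy-Schwarz for the sample form, which has size `(s^κ λ)²` on such errors. As `κ ≥
1/2`, all of this is `O(s^(2κ) λ²) = o(n^(-1/2))` (`rateBounds`). The uniform deviations come from
Bernstein's inequality and a union bound.

`L` is the mean of i.i.d. copies of `2 𝒵(i)` minus its expectation, so `√n L` is asymptotically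
`N(0, 4 σ_i²)`. Uniformity in `n` rests on a bound for the columns of `Φ⁰`, which follows from
positive definiteness of the Hessian: on the first canonical pair the form is bounded below by a
multiple of `ρ`, and off it by the gap `ρ - Λ₂` (`le_dotProduct_H0_mulVec`). Squaring removes the
sign: `√n ((x⁰ - L + R)² - (x⁰)²)` is `-2 x⁰ √n L + o(1)`, and when `x⁰ i = 0` the square times `n`
is `(√n L)² + o(1)`.

Two devices keep the bookkeeping deterministic. Statements in probability are reduced to statements
along sample paths, over every filter below `atTop` (`tendsto_measure_of_forall_path`). Because the
target law moves with `n`, the limit theorems compare characteristic functions with those of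
rescalings of one fixed law by bounded factors, and compactness of the range of factors gives weak
closeness (`asympLaw_of_tendsto_charFun`). -/

theorem exp_le_one_add_add_sq_mul_exp_abs (x : ℝ) :
    Real.exp x ≤ 1 + x + x ^ 2 * Real.exp |x| := by
  have h1 : 1 + |x| ≤ Real.exp |x| := by linarith [Real.add_one_le_exp |x|]
  rcases le_or_gt |x| 1 with h | h
  · have h2 := Real.abs_exp_sub_one_sub_id_le h
    have h3 := (abs_le.1 h2).2
    nlinarith [sq_nonneg x, abs_nonneg x]
  · rcases le_or_gt 0 x with hx | hx
    · rw [abs_of_nonneg hx] at h ⊢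
      have : 1 ≤ x ^ 2 := by nlinarith
      nlinarith [mul_le_mul_of_nonneg_right this (Real.exp_pos x).le]
    · rw [abs_of_neg hx] at h h1 ⊢
      have : Real.exp x ≤ 1 := Real.exp_le_one_iff.2 hx.le
      nlinarith [mul_nonneg (sq_nonneg x) (sub_nonneg.2 h1)]

/-- `Q` has an exponential moment of order `c` bounded by `B`. -/
structure ExpMoment {E : Type*} [MeasurableSpace E] (μ : Measure E) (Q : E → ℝ) (c B : ℝ) :
    Prop where
  aemeasurable : AEMeasurable Q μ
  integrable : Integrable (fun z => Real.exp (c * |Q z|)) μ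
  le : ∫ z, Real.exp (c * |Q z|) ∂μ ≤ B

section ExpMoment

variable {E : Type*} [MeasurableSpace E] {μ : Measure E} {Q Q' : E → ℝ} {c B : ℝ}

theorem ExpMoment.of_le (h : ExpMoment μ Q c B) (hQ' : AEMeasurable Q' μ)
    (hc : 0 ≤ c) (hle : ∀ z, |Q' z| ≤ |Q z|) : ExpMoment μ Q' c B := by
  have hle' : ∀ z, Real.exp (c * |Q' z|) ≤ Real.exp (c * |Q z|) := fun z =>
    Real.exp_le_exp.2 (mul_le_mul_of_nonneg_left (hle z) hc)
  have hint : Integrable (fun z => Real.exp (c * |Q' z|)) μ := by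
    refine h.integrable.mono (by fun_prop) (ae_of_all _ fun z => ?_)
    rw [Real.norm_of_nonneg (Real.exp_pos _).le, Real.norm_of_nonneg (Real.exp_pos _).le]
    exact hle' z
  exact ⟨hQ', hint, (integral_mono hint h.integrable hle').trans h.le⟩

/-- By `exp (u + v) ≤ (exp (2u) + exp (2v)) / 2`, a sum costs half of the order while the bound `B`
stays the same. -/
theorem ExpMoment.add (h : ExpMoment μ Q (2 * c) B) (h' : ExpMoment μ Q' (2 * c) B) (hc : 0 ≤ c) :
    ExpMoment μ (fun z => Q z + Q' z) c B := by
  have key : ∀ z, Real.exp (c * |Q z + Q' z|) ≤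
      (1 / 2) * Real.exp (2 * c * |Q z|) + (1 / 2) * Real.exp (2 * c * |Q' z|) := fun z => by
    have h1 : c * |Q z + Q' z| ≤ c * |Q z| + c * |Q' z| := by
      rw [← mul_add]; exact mul_le_mul_of_nonneg_left (abs_add_le _ _) hc
    have h2 := Real.exp_le_exp.2 h1
    have h3 : Real.exp (2 * c * |Q z|) = Real.exp (c * |Q z|) ^ 2 := by
      rw [← Real.exp_nat_mul]; congr 1; push_cast; ring
    have h4 : Real.exp (2 * c * |Q' z|) = Real.exp (c * |Q' z|) ^ 2 := by
      rw [← Real.exp_nat_mul]; congr 1; push_cast; ring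
    rw [Real.exp_add] at h2
    rw [h3, h4]
    nlinarith [sq_nonneg (Real.exp (c * |Q z|) - Real.exp (c * |Q' z|))]
  have i1 := h.integrable.const_mul (1 / 2)
  have i2 := h'.integrable.const_mul (1 / 2)
  have m1 := h.aemeasurable
  have m2 := h'.aemeasurable
  have hint : Integrable (fun z => Real.exp (c * |Q z + Q' z|)) μ := by
    refine (i1.add i2).mono' (by fun_prop) (ae_of_all _ fun z => ?_)
    rw [Real.norm_of_nonneg (Real.exp_pos _).le]
    exact key z
  refine ⟨by fun_prop, hint, ?_⟩
  calc _ ≤ ∫ z, (1 / 2) * Real.exp (2 * c * |Q z|) + (1 / 2) * Real.exp (2 * c * |Q' z|) ∂μ :=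
        integral_mono hint (i1.add i2) key
    _ ≤ B := by
        rw [integral_add i1 i2, integral_const_mul, integral_const_mul]
        linarith [h.le, h'.le]

theorem ExpMoment.neg (h : ExpMoment μ Q c B) : ExpMoment μ (fun z => -Q z) c B :=
  ⟨h.aemeasurable.neg, by simpa using h.integrable, by simpa using h.le⟩

theorem ExpMoment.integrable_pow (h : ExpMoment μ Q c B) (hc : 0 < c) (k : ℕ) :
    Integrable (fun z => |Q z| ^ k) μ := by
  have m1 := h.aemeasurable
  refine (h.integrable.const_mul (k.factorial / c ^ k)).mono' (by fun_prop)
    (ae_of_all _ fun z => ?_)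
  have := Real.pow_div_factorial_le_exp (c * |Q z|) (by positivity) k
  rw [Real.norm_of_nonneg (by positivity), div_mul_eq_mul_div, le_div_iff₀ (by positivity)]
  rw [div_le_iff₀ (by positivity), mul_pow] at this
  linarith

theorem ExpMoment.integrable_self (h : ExpMoment μ Q c B) (hc : 0 < c) : Integrable Q μ := by
  have := h.integrable_pow hc 1
  simp only [pow_one] at this
  exact (integrable_norm_iff h.aemeasurable.aestronglyMeasurable).1 this

theorem ExpMoment.integral_pow_le (h : ExpMoment μ Q c B) (hc : 0 < c) (k : ℕ) :
    ∫ z, |Q z| ^ k ∂μ ≤ k.factorial / c ^ k * B := by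
  calc _ ≤ ∫ z, k.factorial / c ^ k * Real.exp (c * |Q z|) ∂μ := by
        refine integral_mono (h.integrable_pow hc k) (h.integrable.const_mul _) fun z => ?_
        have := Real.pow_div_factorial_le_exp (c * |Q z|) (by positivity) k
        simp only
        rw [div_mul_eq_mul_div, le_div_iff₀ (by positivity)]
        rw [div_le_iff₀ (by positivity), mul_pow] at this
        linarith
    _ ≤ _ := by
        rw [integral_const_mul]
        exact mul_le_mul_of_nonneg_left h.le (by positivity)

theorem ExpMoment.abs_integral_le (h : ExpMoment μ Q c B) (hc : 0 < c) :
    |∫ z, Q z ∂μ| ≤ B / c := by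
  have := h.integral_pow_le hc 1
  simp only [pow_one, Nat.factorial_one, Nat.cast_one] at this
  calc _ ≤ ∫ z, |Q z| ∂μ := abs_integral_le_integral_abs
    _ ≤ _ := by rw [div_mul_eq_mul_div, one_mul] at this; exact this

/-- Centering multiplies the bound on an exponential moment by a constant. -/
theorem ExpMoment.center (h : ExpMoment μ Q c B) (hc : 0 < c) :
    ExpMoment μ (fun z => Q z - ∫ y, Q y ∂μ) c (Real.exp B * B) := by
  have m1 := h.aemeasurable
  have hm := h.abs_integral_le hc
  set m := ∫ y, Q y ∂μ
  have key : ∀ z, Real.exp (c * |Q z - m|) ≤ Real.exp B * Real.exp (c * |Q z|) := fun z => by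
    rw [← Real.exp_add]
    refine Real.exp_le_exp.2 ?_
    have h1 : |Q z - m| ≤ |Q z| + |m| := abs_sub _ _
    rw [le_div_iff₀ hc] at hm
    nlinarith
  have hint : Integrable (fun z => Real.exp (c * |Q z - m|)) μ := by
    refine (h.integrable.const_mul (Real.exp B)).mono' (by fun_prop) (ae_of_all _ fun z => ?_)
    rw [Real.norm_of_nonneg (Real.exp_pos _).le]
    exact key z
  refine ⟨by fun_prop, hint, (integral_mono hint (h.integrable.const_mul _) key).trans ?_⟩
  rw [integral_const_mul]
  exact mul_le_mul_of_nonneg_left h.le (Real.exp_pos _).le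

/-- In `exp x ≤ 1 + x + x² exp |x|` at `x = t Q` the linear term integrates to zero. With `|t| ≤ c /
2`, half of the available exponent `c |Q|` absorbs `exp |t Q|` and the other half absorbs `Q²`, at
the price of the factor `8 / c²`. -/
theorem ExpMoment.mgf_le [IsProbabilityMeasure μ] (h : ExpMoment μ Q c B) (hc : 0 < c)
    (h0 : ∫ z, Q z ∂μ = 0) {t : ℝ} (ht : |t| ≤ c / 2) :
    Integrable (fun z => Real.exp (t * Q z)) μ ∧
      mgf Q μ t ≤ Real.exp (8 * B / c ^ 2 * t ^ 2) := by
  have m1 := h.aemeasurable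
  have hint : Integrable (fun z => Real.exp (t * Q z)) μ := by
    refine h.integrable.mono' (by fun_prop) (ae_of_all _ fun z => ?_)
    rw [Real.norm_of_nonneg (Real.exp_pos _).le]
    refine Real.exp_le_exp.2 ((le_abs_self _).trans ?_)
    rw [abs_mul]
    exact mul_le_mul_of_nonneg_right (by linarith) (abs_nonneg _)
  have key : ∀ z, Real.exp (t * Q z) ≤
      1 + t * Q z + (8 / c ^ 2 * t ^ 2) * Real.exp (c * |Q z|) := fun z => by
    have h1 := exp_le_one_add_add_sq_mul_exp_abs (t * Q z)
    have h2 : Real.exp |t * Q z| ≤ Real.exp (c / 2 * |Q z|) := by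
      rw [abs_mul]
      exact Real.exp_le_exp.2 (mul_le_mul_of_nonneg_right ht (abs_nonneg _))
    have h3 : (c / 2 * |Q z|) ^ 2 ≤ 2 * Real.exp (c / 2 * |Q z|) := by
      have := Real.pow_div_factorial_le_exp (c / 2 * |Q z|) (by positivity) 2
      norm_num at this
      linarith
    have h4 : Real.exp (c * |Q z|) = Real.exp (c / 2 * |Q z|) * Real.exp (c / 2 * |Q z|) := by
      rw [← Real.exp_add]; congr 1; ring
    have h5 : (t * Q z) ^ 2 ≤ 8 / c ^ 2 * t ^ 2 * Real.exp (c / 2 * |Q z|) := by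
      have h6 : Q z ^ 2 ≤ 8 / c ^ 2 * Real.exp (c / 2 * |Q z|) := by
        rw [mul_pow, sq_abs] at h3
        rw [div_mul_eq_mul_div, le_div_iff₀ (by positivity)]
        nlinarith
      nlinarith [mul_le_mul_of_nonneg_left h6 (sq_nonneg t)]
    calc _ ≤ _ := h1
      _ ≤ 1 + t * Q z + (8 / c ^ 2 * t ^ 2 * Real.exp (c / 2 * |Q z|)) *
            Real.exp (c / 2 * |Q z|) := by
          gcongr
      _ = _ := by rw [h4]; ring
  have hQ := h.integrable_self hc
  have i1 : Integrable (fun z => 1 + t * Q z) μ := (integrable_const _).add (hQ.const_mul _)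
  have i2 := h.integrable.const_mul (8 / c ^ 2 * t ^ 2)
  refine ⟨hint, ?_⟩
  calc mgf Q μ t ≤ ∫ z, 1 + t * Q z + (8 / c ^ 2 * t ^ 2) * Real.exp (c * |Q z|) ∂μ :=
        integral_mono hint (i1.add i2) key
    _ = 1 + (8 / c ^ 2 * t ^ 2) * ∫ z, Real.exp (c * |Q z|) ∂μ := by
        rw [integral_add i1 i2, integral_add (integrable_const _) (hQ.const_mul _),
          integral_const_mul, integral_const_mul, h0]
        simp
    _ ≤ 1 + (8 / c ^ 2 * t ^ 2) * B := by
        gcongr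
        exact h.le
    _ ≤ Real.exp ((8 / c ^ 2 * t ^ 2) * B) := by
        linarith [Real.add_one_le_exp ((8 / c ^ 2 * t ^ 2) * B)]
    _ = _ := by congr 1; ring

end ExpMoment

theorem hasSubgaussianMGF_mono {E : Type*} [MeasurableSpace E] {μ : Measure E} {U : E → ℝ}
    {k k' : ℝ≥0} (h : HasSubgaussianMGF U k μ) (hk : k ≤ k') : HasSubgaussianMGF U k' μ :=
  ⟨h.integrable_exp_mul, fun t => (h.mgf_le t).trans <| Real.exp_le_exp.2 <| by
    have : (k : ℝ) ≤ k' := hk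
    gcongr⟩

/-- The square of a sub-Gaussian random variable has an exponential moment. -/
theorem exists_expMoment_sq : ∃ c B : ℝ, 0 < c ∧ ∀ {E : Type} [MeasurableSpace E]
    (μ : Measure E) [IsProbabilityMeasure μ] (U : E → ℝ) (k : ℝ≥0) (a : ℝ), 0 ≤ a → a * k ≤ c →
    HasSubgaussianMGF U k μ → ExpMoment μ (fun z => U z ^ 2) a B := by
  obtain ⟨c, hc, hint⟩ := IsGaussian.exists_integrable_exp_sq (gaussianReal 0 1)
  refine ⟨c, ∫ x, Real.exp (c * ‖x‖ ^ 2) ∂gaussianReal 0 1, hc, ?_⟩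
  intro E _ μ _ U k a ha hak hU
  have hm := hU.aemeasurable
  -- The square is linearised by an independent standard Gaussian `g`: `exp (a U²) = E exp (√(2a) g
  -- U)`. After Tonelli the sub-Gaussian bound in `U` leaves `E exp (a k g²)`, finite because `a k ≤
  -- c` with `c` from Fernique's theorem.
  have hg : ∀ z, ENNReal.ofReal (Real.exp (a * |U z ^ 2|)) =
      ∫⁻ g, ENNReal.ofReal (Real.exp (√(2 * a) * g * U z)) ∂gaussianReal 0 1 := fun z => by
    have h1 : mgf id (gaussianReal 0 1) (√(2 * a) * U z) = Real.exp (a * |U z ^ 2|) := by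
      rw [mgf_id_gaussianReal]
      simp only [zero_mul, zero_add, NNReal.coe_one, one_mul, mul_pow, abs_pow, sq_abs]
      rw [Real.sq_sqrt (by positivity)]
      congr 1; ring
    rw [← h1, mgf, ofReal_integral_eq_lintegral_ofReal]
    · simp only [id]
      refine lintegral_congr fun g => ?_
      congr 2; ring
    · exact integrable_exp_mul_gaussianReal _
    · exact ae_of_all _ fun _ => (Real.exp_pos _).le
  have hle : ∫⁻ z, ENNReal.ofReal (Real.exp (a * |U z ^ 2|)) ∂μ ≤
      ENNReal.ofReal (∫ x, Real.exp (c * ‖x‖ ^ 2) ∂gaussianReal 0 1) := by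
    simp_rw [hg]
    rw [lintegral_lintegral_swap]
    · rw [ofReal_integral_eq_lintegral_ofReal hint (ae_of_all _ fun _ => (Real.exp_pos _).le)]
      refine lintegral_mono fun g => ?_
      rw [← ofReal_integral_eq_lintegral_ofReal (hU.integrable_exp_mul _)
        (ae_of_all _ fun _ => (Real.exp_pos _).le)]
      refine ENNReal.ofReal_le_ofReal ((hU.mgf_le _).trans (Real.exp_le_exp.2 ?_))
      rw [mul_pow, Real.sq_sqrt (by positivity), Real.norm_eq_abs, sq_abs]
      nlinarith [sq_nonneg g]
    · have : AEMeasurable (fun p : E × ℝ => U p.1) (μ.prod (gaussianReal 0 1)) :=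
        hm.comp_quasiMeasurePreserving Measure.quasiMeasurePreserving_fst
      simp only [Function.uncurry_def]
      fun_prop
  have hint' : Integrable (fun z => Real.exp (a * |U z ^ 2|)) μ := by
    refine ⟨by fun_prop, ?_⟩
    rw [hasFiniteIntegral_iff_ofReal (ae_of_all _ fun _ => (Real.exp_pos _).le)]
    exact hle.trans_lt ENNReal.ofReal_lt_top
  refine ⟨by fun_prop, hint', ?_⟩
  rw [← ofReal_integral_eq_lintegral_ofReal hint' (ae_of_all _ fun _ => (Real.exp_pos _).le)] at hle
  exact (ENNReal.ofReal_le_ofReal_iff (integral_nonneg fun _ => (Real.exp_pos _).le)).1 hle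

/-- The product of two sub-Gaussian random variables has an exponential moment. -/
theorem exists_expMoment_mul (k : ℝ≥0) : ∃ c B : ℝ, 0 < c ∧ ∀ {E : Type} [MeasurableSpace E]
    (μ : Measure E) [IsProbabilityMeasure μ] (U V : E → ℝ),
    HasSubgaussianMGF U k μ → HasSubgaussianMGF V k μ →
      ExpMoment μ (fun z => U z * V z) c B := by
  obtain ⟨c, B, hc, h⟩ := exists_expMoment_sq
  have hk : (0 : ℝ) < k + 1 := by positivity
  -- The product is dominated by `U² + V²`. The sum of the squares costs a factor `2` in the order;
  -- `k + 1` replaces `k` so that `k = 0` needs no separate case.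
  refine ⟨c / (k + 1) / 2, B, by positivity, ?_⟩
  intro E _ μ _ U V hU hV
  have hck : 2 * (c / (k + 1) / 2) * k ≤ c := by
    have : 2 * (c / (k + 1) / 2) * k = c * (k / (k + 1)) := by field_simp
    rw [this]
    have : (k : ℝ) / (k + 1) ≤ 1 := by rw [div_le_one hk]; linarith
    nlinarith
  have hs := (h μ U k (2 * (c / (k + 1) / 2)) (by positivity) hck hU).add
    (h μ V k _ (by positivity) hck hV) (by positivity)
  refine hs.of_le (hU.aemeasurable.mul hV.aemeasurable) (by positivity) fun z => ?_
  rw [abs_mul, abs_of_nonneg (by positivity : 0 ≤ U z ^ 2 + V z ^ 2), ← sq_abs (U z),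
    ← sq_abs (V z)]
  nlinarith [sq_nonneg (|U z| - |V z|), abs_nonneg (U z), abs_nonneg (V z), sq_nonneg (|U z|),
    sq_nonneg (|V z|)]

/-- **Bernstein's inequality** for the mean of i.i.d. copies of a centered random variable with an
exponential moment. -/
theorem measure_mean_gt_le {E Ω : Type*} [MeasurableSpace E] [MeasurableSpace Ω] {μ : Measure E}
    {P : Measure Ω} [IsProbabilityMeasure μ] [IsProbabilityMeasure P] {Q : E → ℝ} {c B : ℝ}
    (hc : 0 < c) (h : ExpMoment μ Q c B) (h0 : ∫ z, Q z ∂μ = 0) (hQ : Measurable Q) {n : ℕ}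
    (Z : Fin n → Ω → E) (hZ : ∀ j, HasLaw (Z j) μ P) (hind : iIndepFun Z P) {t : ℝ} (ht : 0 ≤ t)
    {D : ℝ} (hD : 0 < D) (hBD : 8 * B / c ^ 2 ≤ D) (htc : t / (2 * D) ≤ c / 2) :
    P {ω | t < (n : ℝ)⁻¹ * ∑ j, Q (Z j ω)} ≤
      ENNReal.ofReal (Real.exp (-(n * t ^ 2 / (4 * D)))) := by
  -- This `l` minimises the Chernoff exponent `-l t + D l²`, whose minimum is `-t² / (4 D)`.
  set l := t / (2 * D) with hl
  have hl0 : 0 ≤ l := by positivity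
  obtain ⟨hi, hm⟩ := h.mgf_le hc h0 (t := l) (by rw [abs_of_nonneg hl0]; exact htc)
  have hmZ : ∀ j, AEMeasurable (Z j) P := fun j => (hZ j).aemeasurable
  have hQZ : ∀ j, AEMeasurable (fun ω => Q (Z j ω)) P := fun j => hQ.comp_aemeasurable (hmZ j)
  have hmgf : ∀ j, mgf (fun ω => Q (Z j ω)) P l = mgf Q μ l := fun j => by
    rw [← (hZ j).map_eq, mgf_map (hmZ j)]
    · rfl
    · rw [(hZ j).map_eq]
      exact hi.aestronglyMeasurable
  have hind' : iIndepFun (fun j ω => Q (Z j ω)) P := hind.comp (fun _ => Q) (fun _ => hQ)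
  have hiZ : ∀ j, Integrable (fun ω => Real.exp (l * Q (Z j ω))) P := fun j => by
    have := hi
    rw [← (hZ j).map_eq] at this
    exact this.comp_aemeasurable (hmZ j)
  have hsum := hind'.mgf_sum₀ (t := l) hQZ Finset.univ
  have hisum : Integrable (fun ω => Real.exp (l * (∑ j, fun ω => Q (Z j ω)) ω)) P := by
    -- The Bochner integral of a non-integrable function is zero, whereas the product formula for
    -- independent summands makes this one positive.
    refine .of_integral_ne_zero (ne_of_gt ?_)
    change 0 < mgf _ P l
    rw [hsum]
    exact Finset.prod_pos fun j _ => mgf_pos (hiZ j)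
  rcases Nat.eq_zero_or_pos n with rfl | hn
  · have : (Real.exp (-(((0 : ℕ) : ℝ) * t ^ 2 / (4 * D)))) = 1 := by simp
    rw [this, ENNReal.ofReal_one]
    exact prob_le_one
  have hn' : (0 : ℝ) < n := by exact_mod_cast hn
  have hch := measure_ge_le_exp_mul_mgf (n * t) hl0 hisum
  have hsub : {ω | t < (n : ℝ)⁻¹ * ∑ j, Q (Z j ω)} ⊆
      {ω | n * t ≤ (∑ j, fun ω => Q (Z j ω)) ω} := fun ω hω => by
    simp only [Set.mem_ofPred_eq, Finset.sum_apply] at hω ⊢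
    rw [inv_mul_eq_div, lt_div_iff₀ hn'] at hω
    linarith
  refine (measure_mono hsub).trans ?_
  rw [← ENNReal.ofReal_toReal (measure_ne_top P _)]
  refine ENNReal.ofReal_le_ofReal (hch.trans ?_)
  rw [hsum]
  simp_rw [hmgf]
  rw [Finset.prod_const, Finset.card_univ, Fintype.card_fin]
  calc _ ≤ Real.exp (-l * (n * t)) * Real.exp (D * l ^ 2) ^ n := by
        gcongr
        · exact mgf_nonneg
        · exact hm.trans (Real.exp_le_exp.2 (by gcongr))
    _ = _ := by
        rw [← Real.exp_nat_mul, ← Real.exp_add, hl]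
        congr 1
        field_simp
        ring

theorem measure_abs_mean_gt_le {E Ω : Type*} [MeasurableSpace E] [MeasurableSpace Ω]
    {μ : Measure E} {P : Measure Ω} [IsProbabilityMeasure μ] [IsProbabilityMeasure P] {Q : E → ℝ}
    {c B : ℝ} (hc : 0 < c) (h : ExpMoment μ Q c B) (h0 : ∫ z, Q z ∂μ = 0) (hQ : Measurable Q)
    {n : ℕ} (Z : Fin n → Ω → E) (hZ : ∀ j, HasLaw (Z j) μ P) (hind : iIndepFun Z P) {t : ℝ}
    (ht : 0 ≤ t) {D : ℝ} (hD : 0 < D) (hBD : 8 * B / c ^ 2 ≤ D) (htc : t / (2 * D) ≤ c / 2) :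
    P {ω | t < |(n : ℝ)⁻¹ * ∑ j, Q (Z j ω)|} ≤
      ENNReal.ofReal (2 * Real.exp (-(n * t ^ 2 / (4 * D)))) := by
  have h1 := measure_mean_gt_le hc h h0 hQ Z hZ hind ht hD hBD htc
  have h2 := measure_mean_gt_le hc h.neg (by rw [integral_neg, h0, neg_zero]) hQ.neg Z hZ hind ht
    hD hBD htc
  have hsub : {ω | t < |(n : ℝ)⁻¹ * ∑ j, Q (Z j ω)|} ⊆ {ω | t < (n : ℝ)⁻¹ * ∑ j, Q (Z j ω)} ∪
      {ω | t < (n : ℝ)⁻¹ * ∑ j, -Q (Z j ω)} := fun ω hω => by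
    simp only [Set.mem_ofPred_eq, Set.mem_union, Finset.sum_neg_distrib, mul_neg] at hω ⊢
    exact lt_abs.1 hω
  refine (measure_mono hsub).trans ((measure_union_le _ _).trans ((add_le_add h1 h2).trans ?_))
  rw [← ENNReal.ofReal_add (Real.exp_pos _).le (Real.exp_pos _).le, two_mul]

/-! ### Asymptotic laws and characteristic functions -/

section AsympLaw

variable {Ω : ℕ → Type*} [∀ n, MeasurableSpace (Ω n)] {P : ∀ n, Measure (Ω n)}
  [∀ n, IsProbabilityMeasure (P n)] {T U : ∀ n, Ω n → ℝ}

/-- Pointwise convergence of the characteristic functions to those of a bounded family of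
rescalings of a fixed law. -/
theorem asympLaw_of_tendsto_charFun (hT : ∀ n, AEMeasurable (T n) (P n)) (μ : Measure ℝ)
    [IsProbabilityMeasure μ] (c : ℕ → ℝ) (R : ℝ) (hc : ∀ n, |c n| ≤ R)
    (h : ∀ t, Tendsto (fun n => charFun ((P n).map (T n)) t - charFun (μ.map fun x => c n * x) t)
      atTop (𝓝 0)) :
    AsympLaw P T fun n => μ.map fun x => c n * x := by
  refine ⟨hT, fun f => ?_⟩
  have hprob : ∀ a : ℝ, IsProbabilityMeasure (μ.map fun x => a * x) := fun a =>
    Measure.isProbabilityMeasure_map (by fun_prop)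
  have hprobT : ∀ n, IsProbabilityMeasure ((P n).map (T n)) := fun n =>
    Measure.isProbabilityMeasure_map (hT n)
  let ν : ℝ → ProbabilityMeasure ℝ := fun a => ⟨μ.map fun x => a * x, hprob a⟩
  let τ : ℕ → ProbabilityMeasure ℝ := fun n => ⟨(P n).map (T n), hprobT n⟩
  have hνcont : ∀ g : ℝ →ᵇ ℝ, Continuous fun a => ∫ x, g x ∂(ν a : Measure ℝ) := fun g => by
    have : (fun a => ∫ x, g x ∂(ν a : Measure ℝ)) = fun a => ∫ x, g (a * x) ∂μ := by
      ext a
      exact integral_map (by fun_prop) g.continuous.aestronglyMeasurable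
    rw [this]
    refine continuous_of_dominated (F := fun a x => g (a * x)) (bound := fun _ => ‖g‖)
      (fun a => ?_) (fun a => ?_) (integrable_const _) ?_
    · exact (g.continuous.comp (by fun_prop)).aestronglyMeasurable
    · exact ae_of_all _ fun x => g.norm_coe_le_norm _
    · exact ae_of_all _ fun x => g.continuous.comp (by fun_prop)
  have hνtend : ∀ {a : ℕ → ℝ} {b : ℝ}, Tendsto a atTop (𝓝 b) →
      Tendsto (fun k => ν (a k)) atTop (𝓝 (ν b)) := fun {a b} hab => by
    rw [ProbabilityMeasure.tendsto_iff_forall_integral_tendsto]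
    exact fun g => ((hνcont g).tendsto b).comp hab
  -- The factors `c n` stay in `[-R, R]`, so every subsequence has a further one along which they
  -- converge to some `b`. Along it the rescaled laws converge weakly to the rescaling by `b`; by
  -- Lévy's theorem the laws of `T n` do so too, and the two integrals have the same limit.
  refine tendsto_of_subseq_tendsto fun ns hns => ?_
  obtain ⟨b, -, φ, hφ, hb⟩ := (isCompact_Icc (a := -R) (b := R)).tendsto_subseq
    (x := fun k => c (ns k)) fun k => abs_le.1 (hc _)
  refine ⟨φ, ?_⟩
  have hsub : Tendsto (fun k => ns (φ k)) atTop atTop := hns.comp hφ.tendsto_atTop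
  have h1 : Tendsto (fun k => τ (ns (φ k))) atTop (𝓝 (ν b)) := by
    rw [ProbabilityMeasure.tendsto_iff_tendsto_charFun]
    intro t
    have h2 := (h t).comp hsub
    have h3 := ProbabilityMeasure.tendsto_iff_tendsto_charFun.1 (hνtend hb) t
    have h4 := h2.add h3
    rw [zero_add] at h4
    refine h4.congr fun k => ?_
    simp [τ, ν]
  have h5 := ProbabilityMeasure.tendsto_iff_forall_integral_tendsto.1 h1 f
  have h6 := ProbabilityMeasure.tendsto_iff_forall_integral_tendsto.1 (hνtend hb) f
  have h7 := h5.sub h6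
  rw [sub_self] at h7
  refine h7.congr fun k => ?_
  simp only [τ, ν, ProbabilityMeasure.coe_mk, Function.comp]
  rw [integral_map (hT _) f.continuous.aestronglyMeasurable]

omit [∀ n, IsProbabilityMeasure (P n)] in
theorem AsympLaw.comp {ν : ℕ → Measure ℝ} (h : AsympLaw P T ν) {g : ℝ → ℝ} (hg : Continuous g) :
    AsympLaw P (fun n ω => g (T n ω)) fun n => (ν n).map g := by
  refine ⟨fun n => hg.measurable.comp_aemeasurable (h.1 n), fun f => ?_⟩
  refine (h.2 (f.compContinuous ⟨g, hg⟩)).congr fun n => ?_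
  rw [integral_map hg.measurable.aemeasurable f.continuous.aestronglyMeasurable]
  simp

theorem AsympLaw.tendsto_charFun {ν : ℕ → Measure ℝ} [∀ n, IsProbabilityMeasure (ν n)]
    (h : AsympLaw P T ν) (t : ℝ) :
    Tendsto (fun n => charFun ((P n).map (T n)) t - charFun (ν n) t) atTop (𝓝 0) := by
  let fc : ℝ →ᵇ ℝ := BoundedContinuousFunction.ofNormedAddCommGroup (fun x => Real.cos (t * x))
    (by fun_prop) 1 fun x => by simpa using Real.abs_cos_le_one _
  let fs : ℝ →ᵇ ℝ := BoundedContinuousFunction.ofNormedAddCommGroup (fun x => Real.sin (t * x))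
    (by fun_prop) 1 fun x => by simpa using Real.abs_sin_le_one _
  have key : ∀ (m : Measure ℝ) [IsProbabilityMeasure m],
      charFun m t = ((∫ x, fc x ∂m : ℝ) : ℂ) + ((∫ x, fs x ∂m : ℝ) : ℂ) * Complex.I := by
    intro m _
    rw [charFun_apply_real, ← integral_complex_ofReal, ← integral_complex_ofReal,
      ← integral_mul_const, ← integral_add]
    · refine integral_congr_ae (ae_of_all _ fun x => ?_)
      simp only [fc, fs, BoundedContinuousFunction.coe_ofNormedAddCommGroup]
      rw [← Complex.ofReal_mul, Complex.exp_mul_I]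
      push_cast
      rfl
    · exact (fc.integrable m).ofReal
    · exact ((fs.integrable m).ofReal).mul_const _
  have hprobT : ∀ n, IsProbabilityMeasure ((P n).map (T n)) := fun n =>
    Measure.isProbabilityMeasure_map (h.1 n)
  have h1 := (Complex.continuous_ofReal.tendsto 0).comp (h.2 fc)
  have h2 := ((Complex.continuous_ofReal.tendsto 0).comp (h.2 fs)).mul_const Complex.I
  have h3 := h1.add h2
  simp only [Complex.ofReal_zero, zero_mul, add_zero] at h3
  refine h3.congr fun n => ?_
  rw [key, key, integral_map (h.1 n) fc.continuous.aestronglyMeasurable,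
    integral_map (h.1 n) fs.continuous.aestronglyMeasurable]
  simp only [Function.comp_apply]
  push_cast
  ring

/-- The characteristic functions of two sequences whose difference tends to zero in probability
are asymptotically equal. -/
theorem tendsto_charFun_sub_of_tendsto_measure (hT : ∀ n, AEMeasurable (T n) (P n))
    (hU : ∀ n, AEMeasurable (U n) (P n))
    (h : ∀ δ : ℝ, 0 < δ → Tendsto (fun n => P n {ω | δ < |T n ω - U n ω|}) atTop (𝓝 0)) (t : ℝ) :
    Tendsto (fun n => charFun ((P n).map (T n)) t - charFun ((P n).map (U n)) t)
      atTop (𝓝 0) := by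
  rw [tendsto_zero_iff_norm_tendsto_zero]
  refine tendsto_order.2 ⟨fun a ha => Eventually.of_forall fun n => ha.trans_le (norm_nonneg _),
    fun ε hε => ?_⟩
  -- Where `T` and `U` differ by at most `δ` the exponentials differ by at most `|t| δ ≤ ε / 2`. The
  -- exceptional event has probability below `ε / 4` and there the difference is at most `2`.
  set δ := ε / (2 * (|t| + 1)) with hδ
  have hδ0 : 0 < δ := by positivity
  have h1 := (ENNReal.tendsto_toReal ENNReal.zero_ne_top).comp (h δ hδ0)
  have h2 := (tendsto_order.1 h1).2 (ε / 4) (by simpa using by positivity)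
  filter_upwards [h2] with n hn
  have mT := hT n
  have mU := hU n
  set A : Set (Ω n) := {ω | δ < |T n ω - U n ω|} with hA
  have hAm : NullMeasurableSet A (P n) :=
    nullMeasurableSet_lt aemeasurable_const (by fun_prop)
  have hbd : ∀ x : ℝ, ‖Complex.exp (t * x * Complex.I)‖ = 1 := fun x => by
    rw [← Complex.ofReal_mul, Complex.norm_exp_ofReal_mul_I]
  have iT : Integrable (fun ω => Complex.exp (t * T n ω * Complex.I)) (P n) :=
    (integrable_const (1 : ℝ)).mono' (by fun_prop) (ae_of_all _ fun ω => (hbd _).le)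
  have iU : Integrable (fun ω => Complex.exp (t * U n ω * Complex.I)) (P n) :=
    (integrable_const (1 : ℝ)).mono' (by fun_prop) (ae_of_all _ fun ω => (hbd _).le)
  rw [charFun_apply_real, charFun_apply_real, integral_map mT (by fun_prop),
    integral_map mU (by fun_prop), ← integral_sub iT iU]
  have hpt : ∀ ω, ‖Complex.exp (t * T n ω * Complex.I) - Complex.exp (t * U n ω * Complex.I)‖ ≤
      |t| * δ + A.indicator (fun _ => (2 : ℝ)) ω := fun ω => by
    by_cases hω : ω ∈ A
    · rw [Set.indicator_of_mem hω]
      calc _ ≤ ‖Complex.exp (t * T n ω * Complex.I)‖ + ‖Complex.exp (t * U n ω * Complex.I)‖ :=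
            norm_sub_le _ _
        _ = 2 := by rw [hbd, hbd]; norm_num
        _ ≤ _ := by linarith [show 0 ≤ |t| * δ by positivity]
    · rw [Set.indicator_of_notMem hω, add_zero]
      have hω' : |T n ω - U n ω| ≤ δ := not_lt.1 hω
      have e1 : Complex.exp (t * T n ω * Complex.I) - Complex.exp (t * U n ω * Complex.I) =
          Complex.exp (t * U n ω * Complex.I) *
            (Complex.exp (Complex.I * ((t * (T n ω - U n ω) : ℝ) : ℂ)) - 1) := by
        rw [mul_sub, ← Complex.exp_add, mul_one]
        congr 2
        push_cast
        ring
      rw [e1, norm_mul, hbd, one_mul]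
      refine (Real.norm_exp_I_mul_ofReal_sub_one_le).trans ?_
      rw [Real.norm_eq_abs, abs_mul]
      gcongr
  have hiA : Integrable (A.indicator fun _ => (2 : ℝ)) (P n) :=
    (integrable_const _).indicator₀ hAm
  calc _ ≤ ∫ ω, ‖Complex.exp (t * T n ω * Complex.I) - Complex.exp (t * U n ω * Complex.I)‖ ∂P n :=
        norm_integral_le_integral_norm _
    _ ≤ ∫ ω, |t| * δ + A.indicator (fun _ => (2 : ℝ)) ω ∂P n :=
        integral_mono (iT.sub iU).norm ((integrable_const _).add hiA) hpt
    _ = |t| * δ + (P n).real A * 2 := by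
        rw [integral_add (integrable_const _) hiA, integral_indicator₀ hAm]
        simp
    _ < ε := by
        have e2 : |t| * δ ≤ ε / 2 := by
          rw [hδ, mul_div_assoc', div_le_iff₀ (by positivity)]
          nlinarith [abs_nonneg t]
        have e3 : (P n).real A < ε / 4 := hn
        linarith

/-- **Slutsky's theorem** for a bounded family of rescalings of a fixed law. -/
theorem AsympLaw.of_tendsto_measure {μ : Measure ℝ} [IsProbabilityMeasure μ] {c : ℕ → ℝ} {R : ℝ}
    (hc : ∀ n, |c n| ≤ R) (hU : AsympLaw P U fun n => μ.map fun x => c n * x)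
    (hT : ∀ n, AEMeasurable (T n) (P n))
    (h : ∀ δ : ℝ, 0 < δ → Tendsto (fun n => P n {ω | δ < |T n ω - U n ω|}) atTop (𝓝 0)) :
    AsympLaw P T fun n => μ.map fun x => c n * x := by
  have hprob : ∀ n, IsProbabilityMeasure (μ.map fun x => c n * x) := fun n =>
    Measure.isProbabilityMeasure_map (by fun_prop)
  refine asympLaw_of_tendsto_charFun hT μ c R hc fun t => ?_
  have := (tendsto_charFun_sub_of_tendsto_measure hT hU.1 h t).add (hU.tendsto_charFun t)
  rw [add_zero] at this
  exact this.congr fun n => by ring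

theorem AsympLaw.tendstoInDistribution {ν : ℕ → Measure ℝ} (h : AsympLaw P T ν) {Ω' : Type*}
    [MeasurableSpace Ω'] {P' : Measure Ω'} [IsProbabilityMeasure P'] {Y : Ω' → ℝ}
    (hY : AEMeasurable Y P')
    (hν : ∀ f : ℝ →ᵇ ℝ, Tendsto (fun n => ∫ x, f x ∂ν n) atTop (𝓝 (∫ ω, f (Y ω) ∂P'))) :
    TendstoInDistribution T atTop Y P P' := by
  have hT : ∀ n, AEMeasurable (T n) (P n) := h.1
  refine ⟨hT, hY, ProbabilityMeasure.tendsto_iff_forall_integral_tendsto.2 fun f => ?_⟩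
  have := (h.2 f).add (hν f)
  rw [zero_add] at this
  simp only [ProbabilityMeasure.coe_mk]
  rw [integral_map hY f.continuous.aestronglyMeasurable]
  refine this.congr fun n => ?_
  rw [integral_map (hT n) f.continuous.aestronglyMeasurable]
  ring

theorem tendsto_integral_map_mul (μ : Measure ℝ) [IsProbabilityMeasure μ] {c : ℕ → ℝ} {b : ℝ}
    (hc : Tendsto c atTop (𝓝 b)) (f : ℝ →ᵇ ℝ) :
    Tendsto (fun n => ∫ x, f x ∂(μ.map fun x => c n * x)) atTop (𝓝 (∫ x, f (b * x) ∂μ)) := by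
  have e : ∀ a : ℝ, ∫ x, f x ∂(μ.map fun x => a * x) = ∫ x, f (a * x) ∂μ := fun a =>
    integral_map (by fun_prop) f.continuous.aestronglyMeasurable
  simp_rw [e]
  have hcont : Continuous fun a : ℝ => ∫ x, f (a * x) ∂μ := by
    refine continuous_of_dominated (F := fun a x => f (a * x)) (bound := fun _ => ‖f‖)
      (fun a => ?_) (fun a => ?_) (integrable_const _) ?_
    · exact (f.continuous.comp (by fun_prop)).aestronglyMeasurable
    · exact ae_of_all _ fun x => f.norm_coe_le_norm _
    · exact ae_of_all _ fun x => f.continuous.comp (by fun_prop)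
  exact (hcont.tendsto b).comp hc

end AsympLaw

/-! ### A central limit theorem for triangular arrays -/

/-- For `|x| ≤ 1` this is Taylor's formula. The constant `4` is large enough to cover `|x| > 1` by
the crude bound `2 + |x| + x² / 2`, so that no truncation is needed in the central limit theorem. -/
theorem norm_exp_mul_I_sub_le (x : ℝ) :
    ‖Complex.exp (x * Complex.I) - (1 + x * Complex.I - x ^ 2 / 2)‖ ≤ 4 * |x| ^ 3 := by
  rcases le_or_gt |x| 1 with h | h
  · have hn : ‖(x : ℂ) * Complex.I‖ = |x| := by simp
    have := Complex.exp_bound (x := x * Complex.I) (by rw [hn]; exact h) (n := 3) (by norm_num)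
    have e : ∑ m ∈ Finset.range 3, ((x : ℂ) * Complex.I) ^ m / (m.factorial : ℂ) =
        1 + x * Complex.I - x ^ 2 / 2 := by
      simp [Finset.sum_range_succ, mul_pow, Nat.factorial]
      ring
    rw [e, hn] at this
    refine this.trans ?_
    norm_num [Nat.factorial]
    nlinarith [show 0 ≤ |x| ^ 3 by positivity]
  · have h1 : ‖Complex.exp (x * Complex.I)‖ = 1 := Complex.norm_exp_ofReal_mul_I x
    have h2 : ‖(1 : ℂ) + x * Complex.I - x ^ 2 / 2‖ ≤ 1 + |x| + |x| ^ 2 / 2 := by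
      refine (norm_sub_le _ _).trans (add_le_add ((norm_add_le _ _).trans ?_) ?_)
      · simp
      · simp
    refine (norm_sub_le _ _).trans ?_
    rw [h1]
    nlinarith [mul_pos (sub_pos.2 h) (sub_pos.2 h), sq_nonneg |x|,
      mul_nonneg (sub_pos.2 h).le (sq_nonneg |x|)]

theorem abs_exp_neg_sub_le {y : ℝ} (hy : 0 ≤ y) : |Real.exp (-y) - (1 - y)| ≤ y ^ 2 := by
  rcases le_or_gt y 1 with h | h
  · have := Real.abs_exp_sub_one_sub_id_le (x := -y) (by rw [abs_neg, abs_of_nonneg hy]; exact h)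
    rw [neg_sq] at this
    convert this using 2
    ring
  · have h1 : Real.exp (-y) ≤ 1 := Real.exp_le_one_iff.2 (by linarith)
    have h2 := Real.exp_pos (-y)
    rw [abs_le]
    constructor <;> nlinarith

/-- Both functions agree with `1 - h² var / 2`: the characteristic function up to the third absolute
moment, which is at most `6 B / c³` and is multiplied by `4`, and the Gaussian factor up to the
square of `h² var / 2`, with `var ≤ 2 B / c²`. -/
theorem norm_charFun_sub_le {E : Type*} [MeasurableSpace E] {μ : Measure E}
    [IsProbabilityMeasure μ] {W : E → ℝ} {c B : ℝ} (hc : 0 < c) (hW : ExpMoment μ W c B)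
    (h0 : ∫ z, W z ∂μ = 0) (h : ℝ) :
    ‖charFun (μ.map W) h - Real.exp (-(h ^ 2 * variance W μ / 2))‖ ≤
      24 / c ^ 3 * B * |h| ^ 3 + (h ^ 2 * (2 / c ^ 2 * B) / 2) ^ 2 := by
  have m1 := hW.aemeasurable
  have hvar : variance W μ = ∫ z, W z ^ 2 ∂μ := by
    rw [variance_eq_integral m1, h0]; simp
  have hv0 : 0 ≤ variance W μ := variance_nonneg _ _
  have hvle : variance W μ ≤ 2 / c ^ 2 * B := by
    have := hW.integral_pow_le hc 2
    rw [hvar]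
    simpa using this
  have i1 := hW.integrable_self hc
  have i2 : Integrable (fun z => W z ^ 2) μ := by simpa using hW.integrable_pow hc 2
  have i3 := hW.integrable_pow hc 3
  have ie : Integrable (fun z => Complex.exp (h * W z * Complex.I)) μ :=
    (integrable_const (1 : ℝ)).mono' (by fun_prop) (ae_of_all _ fun z => by
      rw [← Complex.ofReal_mul, Complex.norm_exp_ofReal_mul_I])
  have ip1 : Integrable (fun z => (1 : ℂ) + ((h * W z : ℝ) : ℂ) * Complex.I) μ :=
    (integrable_const _).add (((i1.const_mul h).ofReal).mul_const _)
  have ip2 : Integrable (fun z => ((h * W z : ℝ) : ℂ) ^ 2 / 2) μ := by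
    have : (fun z => ((h * W z : ℝ) : ℂ) ^ 2 / 2) = fun z => ((h ^ 2 * W z ^ 2 / 2 : ℝ) : ℂ) := by
      ext z; push_cast; ring
    rw [this]
    exact ((i2.const_mul (h ^ 2)).div_const 2).ofReal
  have hint : ∫ z, (1 : ℂ) + ((h * W z : ℝ) : ℂ) * Complex.I - ((h * W z : ℝ) : ℂ) ^ 2 / 2 ∂μ =
      ((1 - h ^ 2 * variance W μ / 2 : ℝ) : ℂ) := by
    rw [integral_sub ip1 ip2, integral_add (integrable_const _)
      (((i1.const_mul h).ofReal).mul_const _), integral_mul_const]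
    have e1 : ∫ z, ((h * W z : ℝ) : ℂ) ∂μ = 0 := by
      rw [integral_complex_ofReal, integral_const_mul, h0]; simp
    have e2 : ∫ z, ((h * W z : ℝ) : ℂ) ^ 2 / 2 ∂μ = ((h ^ 2 * variance W μ / 2 : ℝ) : ℂ) := by
      rw [hvar, ← integral_const_mul, ← integral_div, ← integral_complex_ofReal]
      refine integral_congr_ae (ae_of_all _ fun z => ?_)
      push_cast; ring
    rw [e1, e2]
    simp
  have hA : ‖charFun (μ.map W) h - ((1 - h ^ 2 * variance W μ / 2 : ℝ) : ℂ)‖ ≤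
      24 / c ^ 3 * B * |h| ^ 3 := by
    have e := integral_sub ie (ip1.sub ip2)
    simp only [Pi.sub_apply] at e
    rw [charFun_apply_real, integral_map m1 (by fun_prop), ← hint, ← e]
    calc _ ≤ ∫ z, ‖Complex.exp (h * W z * Complex.I) -
          (1 + ((h * W z : ℝ) : ℂ) * Complex.I - ((h * W z : ℝ) : ℂ) ^ 2 / 2)‖ ∂μ :=
          norm_integral_le_integral_norm _
      _ ≤ ∫ z, 4 * |h| ^ 3 * |W z| ^ 3 ∂μ := by
          refine integral_mono (ie.sub (ip1.sub ip2)).norm (i3.const_mul _) fun z => ?_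
          have := norm_exp_mul_I_sub_le (h * W z)
          rw [abs_mul, mul_pow] at this
          simp only
          rw [← Complex.ofReal_mul]
          linarith
      _ = 4 * |h| ^ 3 * ∫ z, |W z| ^ 3 ∂μ := integral_const_mul _ _
      _ ≤ 4 * |h| ^ 3 * (6 / c ^ 3 * B) := by
          have := hW.integral_pow_le hc 3
          norm_num [Nat.factorial] at this
          gcongr
      _ = _ := by ring
  have hB : ‖((1 - h ^ 2 * variance W μ / 2 : ℝ) : ℂ) -
      Real.exp (-(h ^ 2 * variance W μ / 2))‖ ≤ (h ^ 2 * (2 / c ^ 2 * B) / 2) ^ 2 := by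
    rw [← Complex.ofReal_sub, Complex.norm_real, Real.norm_eq_abs, abs_sub_comm]
    refine (abs_exp_neg_sub_le (by positivity)).trans ?_
    gcongr
  calc _ ≤ _ := norm_sub_le_norm_sub_add_norm_sub _ _ _
    _ ≤ _ := add_le_add hA hB

/-- Telescoping in the unit disc. An error `o(1/n)` for one summand becomes `o(1)` for the
characteristic function of the sum. -/
theorem norm_pow_sub_pow_le_mul {a b : ℂ} (ha : ‖a‖ ≤ 1) (hb : ‖b‖ ≤ 1) (n : ℕ) :
    ‖a ^ n - b ^ n‖ ≤ n * ‖a - b‖ := by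
  induction n with
  | zero => simp
  | succ n ih =>
    have e : a ^ (n + 1) - b ^ (n + 1) = a * (a ^ n - b ^ n) + (a - b) * b ^ n := by ring
    rw [e]
    refine (norm_add_le _ _).trans ?_
    rw [norm_mul, norm_mul, norm_pow]
    have h1 : ‖b‖ ^ n ≤ 1 := pow_le_one₀ (norm_nonneg _) hb
    push_cast
    nlinarith [norm_nonneg (a ^ n - b ^ n), norm_nonneg (a - b)]

section CLT

variable {Ω : ℕ → Type*} [∀ n, MeasurableSpace (Ω n)] {P : ∀ n, Measure (Ω n)}
  [∀ n, IsProbabilityMeasure (P n)] {E : ℕ → Type*} [∀ n, MeasurableSpace (E n)]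
  {μ : ∀ n, Measure (E n)} [∀ n, IsProbabilityMeasure (μ n)]

/-- The **central limit theorem** for rows of i.i.d. centered random variables with a uniformly
bounded exponential moment. -/
theorem asympLaw_sum {W : ∀ n, E n → ℝ} {c B : ℝ} (hc : 0 < c)
    (hW : ∀ n, ExpMoment (μ n) (W n) c B) (hWm : ∀ n, Measurable (W n))
    (h0 : ∀ n, ∫ z, W n z ∂μ n = 0) (Z : ∀ n, Fin n → Ω n → E n)
    (hZ : ∀ n j, HasLaw (Z n j) (μ n) (P n)) (hind : ∀ n, iIndepFun (Z n) (P n)) :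
    AsympLaw P (fun n ω => (√n)⁻¹ * ∑ j, W n (Z n j ω))
      fun n => (gaussianReal 0 1).map fun x => √(variance (W n) (μ n)) * x := by
  have mWZ : ∀ n j, AEMeasurable (fun ω => W n (Z n j ω)) (P n) := fun n j =>
    (hWm n).comp_aemeasurable (hZ n j).aemeasurable
  have hvle : ∀ n, variance (W n) (μ n) ≤ 2 / c ^ 2 * B := fun n => by
    have := (hW n).integral_pow_le hc 2
    rw [variance_eq_integral (hWm n).aemeasurable, h0 n]
    simpa using this
  refine asympLaw_of_tendsto_charFun
    (fun n => (Finset.aemeasurable_fun_sum _ fun j _ => mWZ n j).const_mul _) _ _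
    (√(2 / c ^ 2 * B)) (fun n => ?_) fun t => ?_
  · rw [abs_of_nonneg (Real.sqrt_nonneg _)]
    exact Real.sqrt_le_sqrt (hvle n)
  set K1 := 24 / c ^ 3 * B * |t| ^ 3
  set K2 := (t ^ 2 * (2 / c ^ 2 * B) / 2) ^ 2
  -- The one-summand error at `h = t / √n` is `K1 n^(-3/2) + K2 n^(-2)`, and there are `n` summands.
  have hlim : Tendsto (fun n : ℕ => K1 * (√n)⁻¹ + K2 * (n : ℝ)⁻¹) atTop (𝓝 0) := by
    have h1 : Tendsto (fun n : ℕ => (√(n : ℝ))⁻¹) atTop (𝓝 0) :=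
      tendsto_inv_atTop_zero.comp (Real.tendsto_sqrt_atTop.comp tendsto_natCast_atTop_atTop)
    have h2 : Tendsto (fun n : ℕ => ((n : ℝ))⁻¹) atTop (𝓝 0) := tendsto_inv_atTop_nhds_zero_nat
    simpa using (h1.const_mul K1).add (h2.const_mul K2)
  refine squeeze_zero_norm' ?_ hlim
  filter_upwards [eventually_gt_atTop 0] with n hn
  have hn' : (0 : ℝ) < n := by exact_mod_cast hn
  have hcf : charFun ((P n).map fun ω => (√n)⁻¹ * ∑ j, W n (Z n j ω)) t =
      charFun ((μ n).map (W n)) ((√n)⁻¹ * t) ^ n := by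
    have hind' : iIndepFun (fun j ω => W n (Z n j ω)) (P n) :=
      (hind n).comp (fun _ => W n) fun _ => hWm n
    rw [charFun_map_mul_comp (Finset.aemeasurable_fun_sum _ fun j _ => mWZ n j),
      hind'.charFun_map_fun_sum_eq_prod (mWZ n)]
    have e : ∀ j, (P n).map (fun ω => W n (Z n j ω)) = (μ n).map (W n) := fun j => by
      rw [← (hZ n j).map_eq, AEMeasurable.map_map_of_aemeasurable (hWm n).aemeasurable
        (hZ n j).aemeasurable]
      rfl
    simp [e]
  set v := variance (W n) (μ n) with hv
  have hv0 : 0 ≤ v := variance_nonneg _ _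
  have hg : charFun ((gaussianReal 0 1).map fun x => √v * x) t =
      ((Real.exp (-(((√n)⁻¹ * t) ^ 2 * v / 2)) : ℝ) : ℂ) ^ n := by
    have e : (n : ℝ) * -(((√n)⁻¹ * t) ^ 2 * v / 2) = -((√v * t) ^ 2 / 2) := by
      rw [mul_pow, mul_pow, inv_pow, Real.sq_sqrt hn'.le, Real.sq_sqrt hv0]
      field_simp
    rw [← Complex.ofReal_pow, ← Real.exp_nat_mul, e, Complex.ofReal_exp, charFun_map_mul,
      charFun_gaussianReal]
    congr 1
    push_cast
    simp
  rw [hcf, hg]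
  have hprob : IsProbabilityMeasure ((μ n).map (W n)) :=
    Measure.isProbabilityMeasure_map (hWm n).aemeasurable
  refine (norm_pow_sub_pow_le_mul (norm_charFun_le_one _) ?_ n).trans ?_
  · rw [Complex.norm_real, Real.norm_of_nonneg (Real.exp_pos _).le]
    exact Real.exp_le_one_iff.2 (by rw [neg_nonpos]; positivity)
  · have := norm_charFun_sub_le hc (hW n) (h0 n) ((√n)⁻¹ * t)
    refine (mul_le_mul_of_nonneg_left this hn'.le).trans (le_of_eq ?_)
    have hs : 0 < √(n : ℝ) := Real.sqrt_pos.2 hn'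
    have hsq : (n : ℝ) = √n ^ 2 := (Real.sq_sqrt hn'.le).symm
    rw [abs_mul, abs_of_pos (inv_pos.2 hs)]
    simp only [K1, K2]
    generalize √(n : ℝ) = s at *
    rw [hsq]
    field_simp

end CLT

/-! ### Stochastic orders -/

section IsBigOp

variable {Ω : ℕ → Type*} [∀ n, MeasurableSpace (Ω n)] {P : ∀ n, Measure (Ω n)}
  [∀ n, IsProbabilityMeasure (P n)]

/-- To show that `R n` tends to zero in probability when finitely many `T i n` are `O_p(rate i n)`,
it suffices to do so along all sample paths on which the latter are `O(rate i n)`. -/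
theorem tendsto_measure_of_forall_path {ι : Type*} [Fintype ι] {T : ι → ∀ n, Ω n → ℝ}
    {rate : ι → ℕ → ℝ} (hrate : ∀ i n, 0 ≤ rate i n) (hT : ∀ i, IsBigOp P (T i) (rate i))
    {A : ∀ n, Set (Ω n)} (hA : Tendsto (fun n => P n (A n)) atTop (𝓝 0)) {R : ∀ n, Ω n → ℝ}
    (hR : ∀ (l : Filter ℕ), l ≤ atTop → ∀ ω : ∀ n, Ω n,
      (∀ i, (fun n => T i n (ω n)) =O[l] rate i) → (∀ᶠ n in l, ω n ∉ A n) →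
        Tendsto (fun n => R n (ω n)) l (𝓝 0)) (δ : ℝ) (hδ : 0 < δ) :
    Tendsto (fun n => P n {ω | δ < |R n ω|}) atTop (𝓝 0) := by
  classical
  -- On the event where all bounds hold with constants `C`, `R` is eventually uniformly small.
  -- Otherwise bad points exist for infinitely many `n`; a path through them, with the filter
  -- `atTop` restricted to these `n`, contradicts `hR`. This is why `hR` is required for all filters
  -- below `atTop`.
  have claim : ∀ C : ι → ℝ, ∀ᶠ n in atTop, ∀ ω, (∀ i, |T i n ω| ≤ C i * rate i n) → ω ∉ A n →
      |R n ω| ≤ δ := by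
    intro C
    by_contra hcon
    rw [not_eventually] at hcon
    set S : Set ℕ := {n | ¬ ∀ ω, (∀ i, |T i n ω| ≤ C i * rate i n) → ω ∉ A n → |R n ω| ≤ δ}
    have hne : ∀ n, Nonempty (Ω n) := fun n => nonempty_of_isProbabilityMeasure (P n)
    have hex : ∀ n, ∃ ω, n ∈ S → (∀ i, |T i n ω| ≤ C i * rate i n) ∧ ω ∉ A n ∧ δ < |R n ω| := by
      intro n
      by_cases hn : n ∈ S
      · have hn' := hn
        simp only [S, Set.mem_ofPred_eq] at hn'
        push Not at hn'
        obtain ⟨ω, h1, h2, h3⟩ := hn'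
        exact ⟨ω, fun _ => ⟨h1, h2, h3⟩⟩
      · exact ⟨(hne n).some, fun h => absurd h hn⟩
    choose ω hω using hex
    set l := atTop ⊓ 𝓟 S
    have hl : l.NeBot := frequently_mem_iff_neBot.1 hcon
    have hmem : ∀ᶠ n in l, n ∈ S := mem_inf_of_right (mem_principal_self S)
    have h := hR l inf_le_left ω (fun i => IsBigO.of_bound (C i) ?_) ?_
    · have h1 : ∀ᶠ n in l, |R n (ω n)| < δ := by
        have := h.abs
        rw [abs_zero] at this
        exact (tendsto_order.1 this).2 δ hδ
      obtain ⟨n, hn1, hn2⟩ := (h1.and hmem).exists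
      exact absurd hn1 (not_lt.2 (hω n hn2).2.2.le)
    · filter_upwards [hmem] with n hn
      rw [Real.norm_eq_abs, Real.norm_of_nonneg (hrate i n)]
      exact (hω n hn).1 i
    · filter_upwards [hmem] with n hn
      exact (hω n hn).2.1
  rw [ENNReal.tendsto_nhds_zero] at hA ⊢
  intro ε hε
  obtain ⟨η, hη, hηε⟩ : ∃ η : ℝ, 0 < η ∧ ENNReal.ofReal η ≤ ε := by
    rcases eq_or_ne ε ⊤ with rfl | hne
    · exact ⟨1, one_pos, le_top⟩
    · exact ⟨ε.toReal, ENNReal.toReal_pos hε.ne' hne, ENNReal.ofReal_toReal_le⟩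
  -- The probability `η` is shared equally among the exceptional events of the `T i` and the event
  -- `A n`.
  set N : ℝ := Fintype.card ι + 1 with hN
  have hN0 : 0 < N := by positivity
  choose C hC using fun i => hT i (η / N) (by positivity)
  have hC' := eventually_all.2 hC
  filter_upwards [claim C, hC', hA (ENNReal.ofReal (η / N)) (by positivity)] with n h1 h2 h3
  have hsub : {ω | δ < |R n ω|} ⊆ (⋃ i, {ω | C i * rate i n < |T i n ω|}) ∪ A n := fun ω hω => by
    by_contra hcon
    simp only [Set.mem_union, Set.mem_iUnion, Set.mem_ofPred_eq, not_or, not_exists, not_lt]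
      at hcon hω
    exact absurd (h1 ω hcon.1 hcon.2) (not_le.2 hω)
  calc _ ≤ P n ((⋃ i, {ω | C i * rate i n < |T i n ω|}) ∪ A n) := measure_mono hsub
    _ ≤ P n (⋃ i, {ω | C i * rate i n < |T i n ω|}) + P n (A n) := measure_union_le _ _
    _ ≤ (∑ i : ι, ENNReal.ofReal (η / N)) + ENNReal.ofReal (η / N) := by
        refine add_le_add ((measure_iUnion_fintype_le _ _).trans ?_) h3
        exact Finset.sum_le_sum fun i _ => h2 i
    _ = ENNReal.ofReal η := by
        rw [← ENNReal.ofReal_sum_of_nonneg fun _ _ => by positivity,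
          ← ENNReal.ofReal_add (Finset.sum_nonneg fun _ _ => by positivity) (by positivity)]
        congr 1
        rw [Finset.sum_const, Finset.card_univ, nsmul_eq_mul]
        field_simp
        rw [hN]
    _ ≤ ε := hηε

variable {E : ℕ → Type*} [∀ n, MeasurableSpace (E n)]
  {μ : ∀ n, Measure (E n)} [∀ n, IsProbabilityMeasure (μ n)]

/-- The maximum of finitely many means of i.i.d. centered random variables with a uniformly
bounded exponential moment. -/
theorem isBigOp_iSup_mean {ι : ℕ → Type*} [∀ n, Fintype (ι n)] {Q : ∀ n, ι n → E n → ℝ} {c B : ℝ}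
    (hc : 0 < c) (hQ : ∀ n k, ExpMoment (μ n) (Q n k) c B) (hQm : ∀ n k, Measurable (Q n k))
    (h0 : ∀ n k, ∫ z, Q n k z ∂μ n = 0) (Z : ∀ n, Fin n → Ω n → E n)
    (hZ : ∀ n j, HasLaw (Z n j) (μ n) (P n)) (hind : ∀ n, iIndepFun (Z n) (P n))
    {τ : ℕ → ℝ} (hτ0 : ∀ n, 0 ≤ τ n) (hτ : Tendsto τ atTop (𝓝 0))
    (hτ1 : ∀ᶠ n : ℕ in atTop, 1 ≤ n * τ n ^ 2) {a : ℝ}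
    (hcard : ∀ᶠ n : ℕ in atTop, (Fintype.card (ι n) : ℝ) ≤ Real.exp (a * (n * τ n ^ 2))) :
    IsBigOp P (fun n ω => ⨆ k, |(n : ℝ)⁻¹ * ∑ j, Q n k (Z n j ω)|) τ := by
  intro ε hε
  set D := |8 * B / c ^ 2| + 1 with hD
  have hD0 : 0 < D := by positivity
  obtain ⟨b, hb0, hb⟩ : ∃ b : ℝ, 0 ≤ b ∧ 2 * Real.exp (-b) ≤ ε := by
    refine ⟨max 0 (-Real.log (ε / 2)), le_max_left _ _, ?_⟩
    have : Real.exp (-max 0 (-Real.log (ε / 2))) ≤ Real.exp (Real.log (ε / 2)) :=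
      Real.exp_le_exp.2 (by linarith [le_max_right 0 (-Real.log (ε / 2))])
    rw [Real.exp_log (by positivity)] at this
    linarith
  -- At the threshold `C τ`, Bernstein's exponent is `(|a| + b) n τ²`. The part `|a| n τ²` beats the
  -- number of variables in the union bound, and `b n τ² ≥ b` leaves `2 exp (-b) ≤ ε`.
  set C := √(4 * D * (|a| + b)) with hC
  have hC0 : 0 ≤ C := Real.sqrt_nonneg _
  have hCsq : C ^ 2 = 4 * D * (|a| + b) := Real.sq_sqrt (by positivity)
  refine ⟨C, ?_⟩
  have hsmall : ∀ᶠ n in atTop, C * τ n / (2 * D) ≤ c / 2 := by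
    have : Tendsto (fun n => C * τ n / (2 * D)) atTop (𝓝 0) := by
      simpa using (hτ.const_mul C).div_const (2 * D)
    exact (this.eventually (gt_mem_nhds (by positivity : (0 : ℝ) < c / 2))).mono fun _ h => h.le
  filter_upwards [hsmall, hτ1, hcard] with n h1 h2 h3
  have hCτ : 0 ≤ C * τ n := mul_nonneg hC0 (hτ0 n)
  have hsub : {ω | C * τ n < |(⨆ k, |(n : ℝ)⁻¹ * ∑ j, Q n k (Z n j ω)|)|} ⊆
      ⋃ k, {ω | C * τ n < |(n : ℝ)⁻¹ * ∑ j, Q n k (Z n j ω)|} := fun ω hω => by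
    by_contra hcon
    simp only [Set.mem_iUnion, Set.mem_ofPred_eq, not_exists, not_lt] at hcon hω
    rw [abs_of_nonneg (Real.iSup_nonneg fun _ => abs_nonneg _)] at hω
    exact absurd (Real.iSup_le hcon hCτ) (not_le.2 hω)
  refine (measure_mono hsub).trans ((measure_iUnion_fintype_le _ _).trans ?_)
  have h4 : ∀ k, P n {ω | C * τ n < |(n : ℝ)⁻¹ * ∑ j, Q n k (Z n j ω)|} ≤
      ENNReal.ofReal (2 * Real.exp (-(n * (C * τ n) ^ 2 / (4 * D)))) := fun k =>
    measure_abs_mean_gt_le hc (hQ n k) (h0 n k) (hQm n k) (Z n) (hZ n) (hind n) hCτ hD0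
      (by rw [hD]; linarith [le_abs_self (8 * B / c ^ 2)]) h1
  refine (Finset.sum_le_sum fun k _ => h4 k).trans ?_
  rw [Finset.sum_const, Finset.card_univ, nsmul_eq_mul, ← ENNReal.ofReal_natCast,
    ← ENNReal.ofReal_mul (by positivity)]
  refine ENNReal.ofReal_le_ofReal ?_
  have e1 : n * (C * τ n) ^ 2 / (4 * D) = (|a| + b) * (n * τ n ^ 2) := by
    rw [mul_pow, hCsq]
    field_simp
  rw [e1]
  calc _ ≤ Real.exp (a * (n * τ n ^ 2)) * (2 * Real.exp (-((|a| + b) * (n * τ n ^ 2)))) := by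
        gcongr
    _ = 2 * Real.exp (a * (n * τ n ^ 2) + -((|a| + b) * (n * τ n ^ 2))) := by
        rw [Real.exp_add]; ring
    _ ≤ 2 * Real.exp (-b) := by
        gcongr
        nlinarith [le_abs_self a]
    _ ≤ ε := hb

end IsBigOp

/-! ### Bilinear forms given by block matrices -/

/-- The embedding of `ℝ^p` in `ℝ^(p+q)`. -/
def inX {p q : ℕ} : (Fin p → ℝ) →ₗ[ℝ] (Fin p ⊕ Fin q → ℝ) where
  toFun a := Sum.elim a 0
  map_add' a b := by ext (k | k) <;> simp
  map_smul' c a := by ext (k | k) <;> simp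

/-- The embedding of `ℝ^q` in `ℝ^(p+q)`. -/
def inY {p q : ℕ} : (Fin q → ℝ) →ₗ[ℝ] (Fin p ⊕ Fin q → ℝ) where
  toFun b := Sum.elim 0 b
  map_add' a b := by ext (k | k) <;> simp
  map_smul' c a := by ext (k | k) <;> simp

/-- The bilinear form of the symmetric block matrix with blocks `A`, `B`, `Bᵀ`, `D`. -/
def blockForm {p q : ℕ} (A : Matrix (Fin p) (Fin p) ℝ) (B : Matrix (Fin p) (Fin q) ℝ)
    (D : Matrix (Fin q) (Fin q) ℝ) : LinearMap.BilinForm ℝ (Fin p ⊕ Fin q → ℝ) :=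
  Matrix.toBilin' (fromBlocks A B Bᵀ D)

section BlockForm

variable {p q : ℕ} {A : Matrix (Fin p) (Fin p) ℝ} {B : Matrix (Fin p) (Fin q) ℝ}
  {D : Matrix (Fin q) (Fin q) ℝ}

theorem blockForm_inX_inX (a a' : Fin p → ℝ) :
    blockForm A B D (inX a) (inX a') = a ⬝ᵥ A *ᵥ a' := by
  rw [blockForm, Matrix.toBilin'_apply', inX]
  simp [dotProduct, Fintype.sum_sum_type, mulVec]

theorem blockForm_inX_inY (a : Fin p → ℝ) (b : Fin q → ℝ) :
    blockForm A B D (inX a) (inY b) = a ⬝ᵥ B *ᵥ b := by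
  rw [blockForm, Matrix.toBilin'_apply', inX, inY]
  simp [dotProduct, Fintype.sum_sum_type, mulVec]

theorem blockForm_inY_inX (a : Fin p → ℝ) (b : Fin q → ℝ) :
    blockForm A B D (inY b) (inX a) = b ⬝ᵥ Bᵀ *ᵥ a := by
  rw [blockForm, Matrix.toBilin'_apply', inX, inY]
  simp [dotProduct, Fintype.sum_sum_type, mulVec]

theorem blockForm_inY_inY (b b' : Fin q → ℝ) :
    blockForm A B D (inY b) (inY b') = b ⬝ᵥ D *ᵥ b' := by
  rw [blockForm, Matrix.toBilin'_apply', inY]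
  simp [dotProduct, Fintype.sum_sum_type, mulVec]

end BlockForm

/-- The linear form on the sample space with coefficients `u`. -/
def lin {p q : ℕ} (u : Fin p ⊕ Fin q → ℝ) (z : (Fin p → ℝ) × (Fin q → ℝ)) : ℝ :=
  u ⬝ᵥ Sum.elim z.1 z.2

theorem measurable_lin {p q : ℕ} (u : Fin p ⊕ Fin q → ℝ) : Measurable (lin u) := by
  unfold lin
  simp only [dotProduct, Fintype.sum_sum_type, Sum.elim_inl, Sum.elim_inr]
  fun_prop

theorem lin_inX {p q : ℕ} (a : Fin p → ℝ) (z : (Fin p → ℝ) × (Fin q → ℝ)) :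
    lin (inX a) z = a ⬝ᵥ z.1 := by
  simp [lin, inX, dotProduct, Fintype.sum_sum_type]

theorem lin_inY {p q : ℕ} (b : Fin q → ℝ) (z : (Fin p → ℝ) × (Fin q → ℝ)) :
    lin (inY b) z = b ⬝ᵥ z.2 := by
  simp [lin, inY, dotProduct, Fintype.sum_sum_type]

theorem inX_add_inY {p q : ℕ} (u : Fin p ⊕ Fin q → ℝ) :
    inX (fun k => u (Sum.inl k)) + inY (fun k => u (Sum.inr k)) = u := by
  ext (k | k) <;> simp [inX, inY]

/-- The second-moment form of a sample. -/
def sampleForm {n p q : ℕ} (z : Fin n → (Fin p → ℝ) × (Fin q → ℝ)) :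
    LinearMap.BilinForm ℝ (Fin p ⊕ Fin q → ℝ) :=
  blockForm (hatCovX z) (hatCovXY z) (hatCovY z)

/-- The four empirical blocks assemble into the second-moment matrix of the stacked observations.
Symmetry and positivity of the sample form, hence Cauchy-Schwarz, are read off from this expression.
-/
theorem sampleForm_apply {n p q : ℕ} (z : Fin n → (Fin p → ℝ) × (Fin q → ℝ))
    (u v : Fin p ⊕ Fin q → ℝ) :
    sampleForm z u v = (n : ℝ)⁻¹ * ∑ j, lin u (z j) * lin v (z j) := by
  have hJ : fromBlocks (hatCovX z) (hatCovXY z) (hatCovXY z)ᵀ (hatCovY z) =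
      (n : ℝ)⁻¹ • ∑ j, vecMulVec (Sum.elim (z j).1 (z j).2) (Sum.elim (z j).1 (z j).2) := by
    ext (k | k) (l | l) <;>
      simp [hatCovX, hatCovY, hatCovXY, Matrix.sum_apply, vecMulVec_apply, mul_comm]
  rw [sampleForm, blockForm, Matrix.toBilin'_apply', hJ, smul_mulVec, dotProduct_smul,
    sum_mulVec, dotProduct_sum, smul_eq_mul]
  congr 1
  refine Finset.sum_congr rfl fun j _ => ?_
  rw [vecMulVec_mulVec, lin, lin, op_smul_eq_smul, dotProduct_smul, smul_eq_mul,
    dotProduct_comm v, mul_comm]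

/-- Eigenvalue bounds give bounds on the quadratic form. -/
theorem EigenvaluesBounded.bounds {m : ℕ} {S : Matrix (Fin m) (Fin m) ℝ} {M : ℝ}
    (h : EigenvaluesBounded S M) (hS : S.IsHermitian) (a : Fin m → ℝ) :
    M⁻¹ * (a ⬝ᵥ a) ≤ a ⬝ᵥ S *ᵥ a ∧ a ⬝ᵥ S *ᵥ a ≤ M * (a ⬝ᵥ a) := by
  -- The two bounds say that `S - M⁻¹` and `M - S` are positive semidefinite. Both have the shape `ε
  -- S + c` with `ε = ±1`, and each of their eigenvalues comes from one of `S`.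
  have hev : ∀ (ε c : ℝ) (hH : (ε • S + c • (1 : Matrix (Fin m) (Fin m) ℝ)).IsHermitian) j,
      ε ≠ 0 → Module.End.HasEigenvalue (Matrix.toLin' S) (ε⁻¹ * (hH.eigenvalues j - c)) := by
    intro ε c hH j hε
    refine Module.End.hasEigenvalue_of_hasEigenvector
      (x := (hH.eigenvectorBasis j : Fin m → ℝ)) ⟨?_, ?_⟩
    · rw [Module.End.mem_eigenspace_iff, Matrix.toLin'_apply]
      have h1 := hH.mulVec_eigenvectorBasis j
      rw [add_mulVec, smul_mulVec, smul_mulVec, one_mulVec] at h1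
      rw [mul_smul, sub_smul, ← h1, add_sub_cancel_right, smul_smul, inv_mul_cancel₀ hε, one_smul]
    · intro h0
      have h1 := hH.eigenvectorBasis.orthonormal.ne_zero j
      exact h1 (by ext k; exact congrFun h0 k)
  constructor
  · have hH : ((1 : ℝ) • S + (-M⁻¹) • (1 : Matrix (Fin m) (Fin m) ℝ)).IsHermitian := by
      rw [IsHermitian, conjTranspose_add, conjTranspose_smul, conjTranspose_smul, hS.eq,
        conjTranspose_one]
      simp
    have hp := hH.posSemidef_iff_eigenvalues_nonneg.2 fun j => by
      have := (h _ (hev 1 (-M⁻¹) hH j one_ne_zero)).1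
      simp only [inv_one, one_mul, sub_neg_eq_add] at this
      simp only [Pi.zero_apply]
      linarith
    have := hp.dotProduct_mulVec_nonneg a
    rw [star_trivial, add_mulVec, smul_mulVec, smul_mulVec, one_mulVec, dotProduct_add,
      dotProduct_smul, dotProduct_smul, smul_eq_mul, smul_eq_mul] at this
    linarith
  · have hH : ((-1 : ℝ) • S + M • (1 : Matrix (Fin m) (Fin m) ℝ)).IsHermitian := by
      rw [IsHermitian, conjTranspose_add, conjTranspose_smul, conjTranspose_smul, hS.eq,
        conjTranspose_one]
      simp
    have hp := hH.posSemidef_iff_eigenvalues_nonneg.2 fun j => by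
      have := (h _ (hev (-1) M hH j (by norm_num))).2
      rw [inv_neg_one] at this
      simp only [Pi.zero_apply]
      linarith
    have := hp.dotProduct_mulVec_nonneg a
    rw [star_trivial, add_mulVec, smul_mulVec, smul_mulVec, one_mulVec, dotProduct_add,
      dotProduct_smul, dotProduct_smul, smul_eq_mul, smul_eq_mul] at this
    linarith

theorem hasSubgaussianMGF_dotProduct {E : Type*} [MeasurableSpace E] {μ : Measure E}
    [IsProbabilityMeasure μ] {m : ℕ} (f : E → Fin m → ℝ) {K : ℝ≥0}
    (hf : ∀ a : Fin m → ℝ, a ⬝ᵥ a = 1 → HasSubgaussianMGF (fun z => a ⬝ᵥ f z) K μ)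
    (a : Fin m → ℝ) {R : ℝ≥0} (ha : a ⬝ᵥ a ≤ R) :
    HasSubgaussianMGF (fun z => a ⬝ᵥ f z) (R * K) μ := by
  rcases eq_or_ne (a ⬝ᵥ a) 0 with h0 | h0
  · have : a = 0 := dotProduct_self_eq_zero.1 h0
    subst this
    simp only [zero_dotProduct]
    exact hasSubgaussianMGF_mono HasSubgaussianMGF.fun_zero bot_le
  · have hpos : 0 < a ⬝ᵥ a := lt_of_le_of_ne (dotProduct_self_star_nonneg a) (Ne.symm h0)
    have hs : 0 < √(a ⬝ᵥ a) := Real.sqrt_pos.2 hpos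
    have h1 : ((√(a ⬝ᵥ a))⁻¹ • a) ⬝ᵥ ((√(a ⬝ᵥ a))⁻¹ • a) = 1 := by
      rw [smul_dotProduct, dotProduct_smul, smul_eq_mul, smul_eq_mul, ← mul_assoc, ← mul_inv,
        Real.mul_self_sqrt hpos.le, inv_mul_cancel₀ h0]
    have h2 := (hf _ h1).const_mul (√(a ⬝ᵥ a))
    have e : (fun z => a ⬝ᵥ f z) = fun z => √(a ⬝ᵥ a) * (((√(a ⬝ᵥ a))⁻¹ • a) ⬝ᵥ f z) := by
      ext z
      rw [smul_dotProduct, smul_eq_mul, mul_inv_cancel_left₀ hs.ne']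
    rw [e]
    have hle : √(a ⬝ᵥ a) ^ 2 ≤ (R : ℝ) := by rwa [Real.sq_sqrt hpos.le]
    refine hasSubgaussianMGF_mono h2 (mul_le_mul_left (b := ⟨√(a ⬝ᵥ a) ^ 2, sq_nonneg _⟩) ?_ K)
    exact hle

namespace Population

variable {r p q : ℕ} (θ : Population r p q)

/-- The second-moment form of the population. -/
def form : LinearMap.BilinForm ℝ (Fin p ⊕ Fin q → ℝ) := blockForm θ.covX θ.covXY θ.covY

variable {θ}

theorem SubGaussian.linX {K : ℝ≥0} (hK : θ.SubGaussian K) [IsProbabilityMeasure θ.law]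
    (a : Fin p → ℝ) {R : ℝ≥0} (ha : a ⬝ᵥ a ≤ R) :
    HasSubgaussianMGF (lin (inX a)) (R * K) θ.law := by
  have := hasSubgaussianMGF_dotProduct Prod.fst hK.1 a ha
  rwa [← funext (lin_inX (q := q) a)] at this

theorem SubGaussian.linY {K : ℝ≥0} (hK : θ.SubGaussian K) [IsProbabilityMeasure θ.law]
    (a : Fin q → ℝ) {R : ℝ≥0} (ha : a ⬝ᵥ a ≤ R) :
    HasSubgaussianMGF (lin (inY a)) (R * K) θ.law := by
  have := hasSubgaussianMGF_dotProduct Prod.snd hK.2 a ha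
  rwa [← funext (lin_inY (p := p) a)] at this

theorem SubGaussian.memLp_lin {K : ℝ≥0} (hK : θ.SubGaussian K) [IsProbabilityMeasure θ.law]
    (u : Fin p ⊕ Fin q → ℝ) : MemLp (lin u) 2 θ.law := by
  have h1 := (hK.linX (fun k => u (Sum.inl k))
    (Real.le_coe_toNNReal _)).memLp 2
  have h2 := (hK.linY (fun k => u (Sum.inr k))
    (Real.le_coe_toNNReal _)).memLp 2
  have h3 := h1.add h2
  have e : lin (inX fun k => u (Sum.inl k)) + lin (inY fun k => u (Sum.inr k)) = lin u := by
    ext z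
    conv_rhs => rw [← inX_add_inY u]
    simp [lin, add_dotProduct]
  rw [e] at h3
  exact h3

/-- Covariances are second moments because the vectors are centered. The population form thus
becomes an `L²` inner product of linear forms, from which symmetry, positivity and Cauchy-Schwarz
follow. -/
theorem form_apply (h : θ.IsCCA) {K : ℝ≥0} (hK : θ.SubGaussian K) (u v : Fin p ⊕ Fin q → ℝ) :
    θ.form u v = ∫ z, lin u z * lin v z ∂θ.law := by
  have hprob := h.isProb
  let co : Fin p ⊕ Fin q → (Fin p → ℝ) × (Fin q → ℝ) → ℝ := fun k z => Sum.elim z.1 z.2 k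
  have hco : ∀ k, MemLp (co k) 2 θ.law := fun k => by
    have := hK.memLp_lin (Pi.single k 1)
    have e : lin (Pi.single k (1 : ℝ)) = co k := by ext z; simp [lin, co]
    rwa [e] at this
  have hJ : ∀ k l, fromBlocks θ.covX θ.covXY θ.covXYᵀ θ.covY k l = ∫ z, co k z * co l z ∂θ.law := by
    rintro (k | k) (l | l) <;>
      simp [covX, covY, covXY, covariance, h.meanX, h.meanY, co, mul_comm]
  have hint : ∀ k l, Integrable (fun z => co k z * co l z) θ.law := fun k l =>
    (hco k).integrable_mul (hco l)
  have e : ∀ z, lin u z * lin v z = ∑ k, ∑ l, u k * v l * (co k z * co l z) := fun z => by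
    simp only [lin, dotProduct, Finset.sum_mul_sum, co]
    exact Finset.sum_congr rfl fun k _ => Finset.sum_congr rfl fun l _ => by ring
  simp_rw [e]
  rw [integral_finsetSum _ fun k _ => integrable_finsetSum _ fun l _ => (hint k l).const_mul _,
    form, blockForm, Matrix.toBilin'_apply]
  refine Finset.sum_congr rfl fun k _ => ?_
  rw [integral_finsetSum _ fun l _ => (hint k l).const_mul _]
  refine Finset.sum_congr rfl fun l _ => ?_
  rw [integral_const_mul, hJ]
  ring

end Population

/-! ### Consequences of the population assumptions -/

/-- The inequality is an equality at `t = 0`, so the coefficients linear in `t` agree. This extracts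
a Lagrange condition from a maximum without differentiating. -/
theorem eq_mul_of_forall_sq_le {ρ c m d : ℝ} (hρ : ρ ≠ 0)
    (h : ∀ t : ℝ, (ρ + t * c) ^ 2 ≤ ρ ^ 2 * (1 + 2 * t * m + t ^ 2 * d)) : c = ρ * m := by
  -- The hypothesis reads `t k + t² e ≤ 0`. At `t = k / D` with `D + e ≥ 1` it gives `k² (D + e) ≤
  -- 0`, hence `k = 0`.
  set k := 2 * ρ * (c - ρ * m) with hk
  set e := c ^ 2 - ρ ^ 2 * d with he
  set D := |e| + 1 with hD
  have hD0 : 0 < D := by positivity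
  have h1 := h (k / D)
  have h2 : k ^ 2 * (D + e) ≤ 0 := by
    have h3 : (k / D) * k + (k / D) ^ 2 * e ≤ 0 := by
      rw [hk, he] at *
      nlinarith
    have h4 : (k / D) * k + (k / D) ^ 2 * e = k ^ 2 * (D + e) / D ^ 2 := by
      field_simp
    rw [h4, div_le_iff₀ (by positivity), zero_mul] at h3
    exact h3
  have h5 : 1 ≤ D + e := by rw [hD]; linarith [neg_abs_le e]
  have h6 : k = 0 := by
    have : k ^ 2 ≤ 0 := by nlinarith [sq_nonneg k]
    exact pow_eq_zero_iff two_ne_zero |>.1 (le_antisymm this (sq_nonneg k))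
  rw [hk, mul_eq_zero] at h6
  rcases h6 with h6 | h6
  · exact absurd h6 (by simpa using hρ)
  · linarith

namespace Population

variable {r p q : ℕ} {θ : Population r p q}

theorem form_comm (h : θ.IsCCA) {K : ℝ≥0} (hK : θ.SubGaussian K) (u v : Fin p ⊕ Fin q → ℝ) :
    θ.form u v = θ.form v u := by
  rw [form_apply h hK, form_apply h hK]
  simp_rw [mul_comm]

theorem form_self_nonneg (h : θ.IsCCA) {K : ℝ≥0} (hK : θ.SubGaussian K)
    (u : Fin p ⊕ Fin q → ℝ) : 0 ≤ θ.form u u := by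
  rw [form_apply h hK]
  exact integral_nonneg fun z => mul_self_nonneg _

theorem form_sq_le (h : θ.IsCCA) {K : ℝ≥0} (hK : θ.SubGaussian K) (u v : Fin p ⊕ Fin q → ℝ) :
    θ.form u v ^ 2 ≤ θ.form u u * θ.form v v := by
  have := LinearMap.BilinForm.apply_mul_apply_le_of_forall_zero_le θ.form
    (form_self_nonneg h hK) u v
  rwa [form_comm h hK v u, ← sq] at this

theorem covX_isHermitian (θ : Population r p q) : θ.covX.IsHermitian := by
  ext k l
  simp [covX, covariance_comm]

theorem covY_isHermitian (θ : Population r p q) : θ.covY.IsHermitian := by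
  ext k l
  simp [covY, covariance_comm]

theorem form_inX_bounds {M : ℝ} (hX : EigenvaluesBounded θ.covX M) (a : Fin p → ℝ) :
    M⁻¹ * (a ⬝ᵥ a) ≤ θ.form (inX a) (inX a) ∧ θ.form (inX a) (inX a) ≤ M * (a ⬝ᵥ a) := by
  rw [form, blockForm_inX_inX]
  exact hX.bounds θ.covX_isHermitian a

theorem form_inY_bounds {M : ℝ} (hY : EigenvaluesBounded θ.covY M) (b : Fin q → ℝ) :
    M⁻¹ * (b ⬝ᵥ b) ≤ θ.form (inY b) (inY b) ∧ θ.form (inY b) (inY b) ≤ M * (b ⬝ᵥ b) := by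
  rw [form, blockForm_inY_inY]
  exact hY.bounds θ.covY_isHermitian b

theorem corr₂_nonneg (h : θ.IsCCA) : 0 ≤ θ.corr₂ := by
  unfold corr₂
  split_ifs with hr
  · exact (h.corr_pos _).le
  · exact le_rfl

theorem corr_le_corr₂ (h : θ.IsCCA) (j : Fin r) (hj : (j : ℕ) ≠ 0) : θ.corr j ≤ θ.corr₂ := by
  have hr : 1 < r := lt_of_le_of_lt (Nat.one_le_iff_ne_zero.2 hj) j.2
  rw [corr₂, dif_pos hr]
  exact h.corr_anti (Fin.mk_le_of_le_val (Nat.one_le_iff_ne_zero.2 hj))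

theorem form_α_α (h : θ.IsCCA) : θ.form (inX θ.α) (inX θ.α) = 1 := by
  rw [form, blockForm_inX_inX]
  exact h.feasible_mem.1

theorem form_β_β (h : θ.IsCCA) : θ.form (inY θ.β) (inY θ.β) = 1 := by
  rw [form, blockForm_inY_inY]
  exact h.feasible_mem.2

theorem form_α_β (θ : Population r p q) : θ.form (inX θ.α) (inY θ.β) = θ.rho := by
  rw [form, blockForm_inX_inY]
  rfl

theorem form_le_rho (h : θ.IsCCA) {a : Fin p → ℝ} {b : Fin q → ℝ}
    (ha : θ.form (inX a) (inX a) = 1) (hb : θ.form (inY b) (inY b) = 1) :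
    θ.form (inX a) (inY b) ≤ θ.rho := by
  rw [form, blockForm_inX_inX] at ha
  rw [form, blockForm_inY_inY] at hb
  rw [form, blockForm_inX_inY]
  exact h.isMax (show (a, b) ∈ θ.feasible from ⟨ha, hb⟩)

theorem rho_le_one (h : θ.IsCCA) {K : ℝ≥0} (hK : θ.SubGaussian K) : θ.rho ≤ 1 := by
  have := form_sq_le h hK (inX θ.α) (inY θ.β)
  rw [form_α_α h, form_β_β h, form_α_β] at this
  nlinarith

/-! ### Lagrange conditions for the first canonical pair -/

section Lagrange

variable (h : θ.IsCCA) {K : ℝ≥0} (hK : θ.SubGaussian K)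
include h hK

/-- This is the homogeneous form of maximality: `a` and `-a`, normalised, are feasible together with
`β`. A vector of zero form cannot be normalised and is handled by Cauchy-Schwarz. -/
theorem form_inX_β_sq_le (a : Fin p → ℝ) :
    θ.form (inX a) (inY θ.β) ^ 2 ≤ θ.rho ^ 2 * θ.form (inX a) (inX a) := by
  rcases (form_self_nonneg h hK (inX a)).eq_or_lt with h0 | h0
  · have := form_sq_le h hK (inX a) (inY θ.β)
    rw [← h0] at this ⊢
    linarith
  · set s := √(θ.form (inX a) (inX a)) with hs
    have hs0 : 0 < s := Real.sqrt_pos.2 h0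
    have hsq : s ^ 2 = θ.form (inX a) (inX a) := Real.sq_sqrt h0.le
    have key : ∀ ε : ℝ, ε ^ 2 = 1 → ε * θ.form (inX a) (inY θ.β) ≤ θ.rho * s := fun ε hε => by
      have h1 := form_le_rho h (a := (ε * s⁻¹) • a) (b := θ.β) (by
        simp only [map_smul, LinearMap.smul_apply, smul_eq_mul]
        rw [← hsq]
        field_simp
        exact hε) (form_β_β h)
      simp only [map_smul, LinearMap.smul_apply, smul_eq_mul] at h1
      have h2 := mul_le_mul_of_nonneg_right h1 hs0.le
      have e : ε * s⁻¹ * θ.form (inX a) (inY θ.β) * s = ε * θ.form (inX a) (inY θ.β) := by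
        field_simp
      rwa [e] at h2
    rw [← hsq, ← mul_pow]
    refine sq_le_sq' ?_ ?_
    · linarith [key (-1) (by norm_num)]
    · linarith [key 1 (by norm_num)]

theorem form_α_inY_sq_le (b : Fin q → ℝ) :
    θ.form (inX θ.α) (inY b) ^ 2 ≤ θ.rho ^ 2 * θ.form (inY b) (inY b) := by
  rcases (form_self_nonneg h hK (inY b)).eq_or_lt with h0 | h0
  · have := form_sq_le h hK (inX θ.α) (inY b)
    rw [← h0] at this ⊢
    linarith
  · set s := √(θ.form (inY b) (inY b)) with hs
    have hs0 : 0 < s := Real.sqrt_pos.2 h0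
    have hsq : s ^ 2 = θ.form (inY b) (inY b) := Real.sq_sqrt h0.le
    have key : ∀ ε : ℝ, ε ^ 2 = 1 → ε * θ.form (inX θ.α) (inY b) ≤ θ.rho * s := fun ε hε => by
      have h1 := form_le_rho h (a := θ.α) (b := (ε * s⁻¹) • b) (form_α_α h) (by
        simp only [map_smul, LinearMap.smul_apply, smul_eq_mul]
        rw [← hsq]
        field_simp
        exact hε)
      simp only [map_smul, smul_eq_mul] at h1
      have h2 := mul_le_mul_of_nonneg_right h1 hs0.le
      have e : ε * s⁻¹ * θ.form (inX θ.α) (inY b) * s = ε * θ.form (inX θ.α) (inY b) := by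
        field_simp
      rwa [e] at h2
    rw [← hsq, ← mul_pow]
    refine sq_le_sq' ?_ ?_
    · linarith [key (-1) (by norm_num)]
    · linarith [key 1 (by norm_num)]

/-- Stationarity `Σ_xy β = ρ Σ_x α`, tested against `a`: the homogeneous inequality on the line `α +
t a` is tight at `t = 0`. -/
theorem form_inX_β (hρ : 0 < θ.rho) (a : Fin p → ℝ) :
    θ.form (inX a) (inY θ.β) = θ.rho * θ.form (inX a) (inX θ.α) := by
  refine eq_mul_of_forall_sq_le hρ.ne' (d := θ.form (inX a) (inX a)) fun t => ?_
  have := form_inX_β_sq_le h hK (θ.α + t • a)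
  simp only [map_add, map_smul, LinearMap.add_apply, LinearMap.smul_apply, smul_eq_mul,
    form_α_β, form_α_α h, form_comm h hK (inX θ.α) (inX a)] at this
  linarith

theorem form_α_inY (hρ : 0 < θ.rho) (b : Fin q → ℝ) :
    θ.form (inX θ.α) (inY b) = θ.rho * θ.form (inY θ.β) (inY b) := by
  refine eq_mul_of_forall_sq_le hρ.ne' (d := θ.form (inY b) (inY b)) fun t => ?_
  have := form_α_inY_sq_le h hK (θ.β + t • b)
  simp only [map_add, map_smul, LinearMap.add_apply, LinearMap.smul_apply, smul_eq_mul,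
    form_α_β, form_β_β h, form_comm h hK (inY b) (inY θ.β)] at this
  linarith

end Lagrange

/-- The `j`-th column of `U`, embedded. -/
def colU (θ : Population r p q) (j : Fin r) : Fin p ⊕ Fin q → ℝ := inX fun k => θ.U k j

/-- The `j`-th column of `V`, embedded. -/
def colV (θ : Population r p q) (j : Fin r) : Fin p ⊕ Fin q → ℝ := inY fun k => θ.V k j

theorem form_colU_colU (h : θ.IsCCA) (i j : Fin r) :
    θ.form (θ.colU i) (θ.colU j) = if i = j then 1 else 0 := by
  rw [colU, colU, form, blockForm_inX_inX]
  have := congrFun (congrFun h.orthU i) j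
  rw [Matrix.mul_assoc, Matrix.one_apply] at this
  rw [← this]
  simp [Matrix.mul_apply, dotProduct, mulVec]

theorem form_colV_colV (h : θ.IsCCA) (i j : Fin r) :
    θ.form (θ.colV i) (θ.colV j) = if i = j then 1 else 0 := by
  rw [colV, colV, form, blockForm_inY_inY]
  have := congrFun (congrFun h.orthV i) j
  rw [Matrix.mul_assoc, Matrix.one_apply] at this
  rw [← this]
  simp [Matrix.mul_apply, dotProduct, mulVec]

theorem form_inX_inY (h : θ.IsCCA) (a : Fin p → ℝ) (b : Fin q → ℝ) :
    θ.form (inX a) (inY b) =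
      ∑ j, θ.corr j * θ.form (inX a) (θ.colU j) * θ.form (θ.colV j) (inY b) := by
  simp only [colU, colV, form, blockForm_inX_inX, blockForm_inX_inY, blockForm_inY_inY]
  rw [h.decomp, ← mulVec_mulVec, ← mulVec_mulVec, ← mulVec_mulVec, dotProduct_mulVec,
    dotProduct]
  refine Finset.sum_congr rfl fun j _ => ?_
  have e1 : (a ᵥ* (θ.covX * θ.U)) j = a ⬝ᵥ θ.covX *ᵥ fun k => θ.U k j := by
    rw [← vecMul_vecMul, dotProduct_mulVec]
    rfl
  rw [e1, mulVec_diagonal, mul_left_comm, mul_assoc]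
  rfl

/-- Bessel's inequality. -/
theorem sum_sq_le_form {ι : Type*} [Fintype ι] [DecidableEq ι] (h : θ.IsCCA) {K : ℝ≥0}
    (hK : θ.SubGaussian K) {e : ι → Fin p ⊕ Fin q → ℝ}
    (he : ∀ i j, θ.form (e i) (e j) = if i = j then 1 else 0) (u : Fin p ⊕ Fin q → ℝ) :
    ∑ j, θ.form u (e j) ^ 2 ≤ θ.form u u := by
  have h0 := form_self_nonneg h hK (u - ∑ j, θ.form u (e j) • e j)
  have h1 : θ.form (∑ j, θ.form u (e j) • e j) (∑ j, θ.form u (e j) • e j) =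
      ∑ j, θ.form u (e j) ^ 2 := by
    simp only [map_sum, map_smul, LinearMap.sum_apply, LinearMap.smul_apply, smul_eq_mul, he]
    refine Finset.sum_congr rfl fun j _ => ?_
    simp [sq]
  have h2 : θ.form u (∑ j, θ.form u (e j) • e j) = ∑ j, θ.form u (e j) ^ 2 := by
    simp only [map_sum, map_smul, smul_eq_mul, sq]
  rw [map_sub, map_sub, LinearMap.sub_apply, LinearMap.sub_apply, h1,
    form_comm h hK (∑ j, θ.form u (e j) • e j) u, h2] at h0
  linarith

/-! ### The spectral gap and positive definiteness of the Hessian -/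

section Gap

variable (h : θ.IsCCA) {K : ℝ≥0} (hK : θ.SubGaussian K) (hρ : θ.corr₂ < θ.rho)
include h hK hρ

omit hK in
theorem rho_pos : 0 < θ.rho := (corr₂_nonneg h).trans_lt hρ

/-- Stationarity tested against a column of `U`, where orthonormality leaves one term of the
decomposition. Together with the companion for `V` it couples the coefficients of `α` and `β` along
each canonical pair. -/
theorem form_colU_β (j : Fin r) :
    θ.corr j * θ.form (θ.colV j) (inY θ.β) = θ.rho * θ.form (θ.colU j) (inX θ.α) := by
  rw [colU, ← form_inX_β h hK (rho_pos h hρ), form_inX_inY h, ← colU]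
  simp [form_colU_colU h]

theorem form_α_colV (j : Fin r) :
    θ.corr j * θ.form (θ.colU j) (inX θ.α) = θ.rho * θ.form (θ.colV j) (inY θ.β) := by
  rw [form_comm h hK (θ.colV j), colV, ← form_α_inY h hK (rho_pos h hρ), form_inX_inY h,
    ← colV, form_comm h hK (θ.colU j)]
  simp [form_colV_colV h]

/-- The coupled equations `Λ_j d = ρ c` and `Λ_j c = ρ d` give `(ρ² - Λ_j²) c = 0`, and `Λ_j ≤ Λ₂ <
ρ` for every index but the first. -/
theorem form_col_eq_zero (j : Fin r) (hj : (j : ℕ) ≠ 0) :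
    θ.form (θ.colU j) (inX θ.α) = 0 ∧ θ.form (θ.colV j) (inY θ.β) = 0 := by
  have h1 := form_colU_β h hK hρ j
  have h2 := form_α_colV h hK hρ j
  have h3 := rho_pos h hρ
  have h4 := h.corr_pos j
  have h5 : θ.corr j < θ.rho := (corr_le_corr₂ h j hj).trans_lt hρ
  set c := θ.form (θ.colU j) (inX θ.α)
  set d := θ.form (θ.colV j) (inY θ.β)
  have h6 : (θ.rho ^ 2 - θ.corr j ^ 2) * c = 0 := by linear_combination -θ.corr j * h2 - θ.rho * h1
  have h7 : θ.rho ^ 2 - θ.corr j ^ 2 ≠ 0 := by nlinarith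
  have hc : c = 0 := (mul_eq_zero.1 h6).resolve_left h7
  refine ⟨hc, ?_⟩
  rw [hc, mul_zero] at h1
  exact (mul_eq_zero.1 h1).resolve_left h4.ne'

/-- In the form, `α` is a nonzero multiple of the first column of `U`. -/
theorem exists_form_α : ∃ (j : Fin r) (c : ℝ), (j : ℕ) = 0 ∧
    (∀ a, θ.form (inX a) (inX θ.α) = c * θ.form (inX a) (θ.colU j)) ∧ c ≠ 0 := by
  have h3 := rho_pos h hρ
  have key : ∀ a, θ.rho * θ.form (inX a) (inX θ.α) =
      ∑ j, θ.corr j * θ.form (inX a) (θ.colU j) * θ.form (θ.colV j) (inY θ.β) := fun a => by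
    rw [← form_inX_β h hK h3, form_inX_inY h]
  have hr : 0 < r := by
    by_contra hr
    obtain rfl : r = 0 := by omega
    have := key θ.α
    rw [form_α_α h] at this
    simp at this
    linarith
  -- The coefficient is what remains of `ρ⟨a, α⟩ = ∑ Λ_j ⟨a, U_j⟩⟨V_j, β⟩` once all terms beyond the
  -- first vanish.
  refine ⟨⟨0, hr⟩, θ.rho⁻¹ * (θ.corr ⟨0, hr⟩ * θ.form (θ.colV ⟨0, hr⟩) (inY θ.β)), rfl, ?_⟩
  have h4 : ∀ a, θ.form (inX a) (inX θ.α) =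
      θ.rho⁻¹ * (θ.corr ⟨0, hr⟩ * θ.form (θ.colV ⟨0, hr⟩) (inY θ.β)) *
        θ.form (inX a) (θ.colU ⟨0, hr⟩) := fun a => by
    have h5 := key a
    rw [Finset.sum_eq_single (⟨0, hr⟩ : Fin r) (fun j _ hj => by
      rw [(form_col_eq_zero h hK hρ j fun h0 => hj (Fin.ext h0)).2, mul_zero]) (by simp)] at h5
    rw [eq_comm, mul_assoc, inv_mul_eq_div, div_eq_iff h3.ne']
    linarith
  refine ⟨h4, fun h0 => ?_⟩
  have := h4 θ.α
  rw [h0, zero_mul, form_α_α h] at this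
  exact one_ne_zero this

/-- Orthogonality of `a` to `α` kills the first term of the decomposition; no condition on `b` is
needed, since each term is a product. The other terms have `Λ_j ≤ Λ₂`, and the arithmetic-geometric
inequality and Bessel finish. -/
theorem two_mul_form_le {a : Fin p → ℝ} {b : Fin q → ℝ} (ha : θ.form (inX a) (inX θ.α) = 0) :
    2 * θ.form (inX a) (inY b) ≤
      θ.corr₂ * (θ.form (inX a) (inX a) + θ.form (inY b) (inY b)) := by
  obtain ⟨j₀, c, hj₀, hc, hc0⟩ := exists_form_α h hK hρ
  have h0 : θ.form (inX a) (θ.colU j₀) = 0 := by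
    have := hc a
    rw [ha, eq_comm, mul_eq_zero] at this
    exact this.resolve_left hc0
  have b1 := sum_sq_le_form h hK (form_colU_colU h) (inX a)
  have b2 := sum_sq_le_form h hK (form_colV_colV h) (inY b)
  have h2 := corr₂_nonneg h
  calc 2 * θ.form (inX a) (inY b)
      = ∑ j, 2 * (θ.corr j * θ.form (inX a) (θ.colU j) * θ.form (θ.colV j) (inY b)) := by
        rw [form_inX_inY h, Finset.mul_sum]
    _ ≤ ∑ j, θ.corr₂ * (θ.form (inX a) (θ.colU j) ^ 2 + θ.form (inY b) (θ.colV j) ^ 2) := by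
        refine Finset.sum_le_sum fun j _ => ?_
        rw [form_comm h hK (θ.colV j)]
        by_cases hj : j = j₀
        · rw [hj, h0]
          simp only [mul_zero, zero_mul]
          positivity
        · have h3 := corr_le_corr₂ h j fun h0 => hj (Fin.ext (h0.trans hj₀.symm))
          have h4 := (h.corr_pos j).le
          set x := θ.form (inX a) (θ.colU j)
          set y := θ.form (inY b) (θ.colV j)
          nlinarith [mul_nonneg h4 (sq_nonneg (x - y)),
            mul_nonneg (sub_nonneg.2 h3) (add_nonneg (sq_nonneg x) (sq_nonneg y))]
    _ = θ.corr₂ * (∑ j, θ.form (inX a) (θ.colU j) ^ 2 + ∑ j, θ.form (inY b) (θ.colV j) ^ 2) := by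
        rw [← Finset.mul_sum, Finset.sum_add_distrib]
    _ ≤ _ := by gcongr

omit h hK hρ in
theorem dotProduct_H0_mulVec (a a' : Fin p → ℝ) (b b' : Fin q → ℝ) (hρ0 : θ.rho ≠ 0) :
    (inX a' + inY b') ⬝ᵥ θ.H0 *ᵥ (inX a + inY b) =
      2 * θ.rho * θ.form (inX a') (inX a) +
        4 * θ.rho * θ.form (inX a') (inX θ.α) * θ.form (inX θ.α) (inX a) -
        2 * θ.form (inX a') (inY b) +
      (2 * θ.rho * θ.form (inY b') (inY b) +
        4 * θ.rho * θ.form (inY b') (inY θ.β) * θ.form (inY θ.β) (inY b) -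
        2 * θ.form (inY b') (inX a)) := by
  have e1 : ∀ {m : ℕ} (S : Matrix (Fin m) (Fin m) ℝ) (v x y : Fin m → ℝ),
      x ⬝ᵥ (S * vecMulVec v v * S) *ᵥ y = (x ⬝ᵥ S *ᵥ v) * (v ⬝ᵥ S *ᵥ y) := fun S v x y => by
    rw [← mulVec_mulVec, ← mulVec_mulVec, vecMulVec_mulVec, op_smul_eq_smul, mulVec_smul,
      dotProduct_smul, smul_eq_mul, mul_comm]
  have e2 : (inX a' + inY b' : Fin p ⊕ Fin q → ℝ) = Sum.elim a' b' := by
    ext (k | k) <;> simp [inX, inY]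
  have e3 : (inX a + inY b : Fin p ⊕ Fin q → ℝ) = Sum.elim a b := by
    ext (k | k) <;> simp [inX, inY]
  have e4 : ∀ (x : Fin p → ℝ) (y : Fin q → ℝ) (x' : Fin p → ℝ) (y' : Fin q → ℝ),
      Sum.elim x y ⬝ᵥ Sum.elim x' y' = x ⬝ᵥ x' + y ⬝ᵥ y' := fun x y x' y' => by
    simp [dotProduct, Fintype.sum_sum_type]
  rw [e2, e3, H0, smul_mulVec, fromBlocks_mulVec, dotProduct_smul, e4]
  simp only [Sum.elim_comp_inl, Sum.elim_comp_inr, add_mulVec, smul_mulVec, neg_mulVec,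
    dotProduct_add, dotProduct_smul, dotProduct_neg, e1, smul_eq_mul, form, blockForm_inX_inX,
    blockForm_inX_inY, blockForm_inY_inX, blockForm_inY_inY]
  field_simp
  ring

/-- The Hessian is uniformly positive definite. -/
theorem le_dotProduct_H0_mulVec (a : Fin p → ℝ) (b : Fin q → ℝ) :
    2 * (θ.rho - θ.corr₂) * (θ.form (inX a) (inX a) + θ.form (inY b) (inY b)) ≤
      (inX a + inY b) ⬝ᵥ θ.H0 *ᵥ (inX a + inY b) := by
  have hρ0 := rho_pos h hρ
  have hc := corr₂_nonneg h
  rw [dotProduct_H0_mulVec a a b b hρ0.ne']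
  set s := θ.form (inX a) (inX θ.α) with hs
  set t := θ.form (inY b) (inY θ.β) with ht
  have c1 := form_comm h hK (inX θ.α) (inX a)
  have c2 := form_comm h hK (inY θ.β) (inY b)
  have c3 := form_comm h hK (inY b) (inX a)
  rw [c1, c2, c3, ← hs, ← ht]
  -- Write `a = s α + a'` and `b = t β + b'`. The Lagrange conditions remove the mixed terms. The
  -- plane of `(α, β)` contributes `ρ (6 s² + 6 t² - 4 s t) = ρ (4 (s² + t²) + 2 (s - t)²)`, and
  -- `two_mul_form_le` bounds the contribution of `(a', b')` below by the gap.
  have o1 : θ.form (inX (a - s • θ.α)) (inX θ.α) = 0 := by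
    simp only [map_sub, map_smul, LinearMap.sub_apply, LinearMap.smul_apply, smul_eq_mul,
      form_α_α h]
    rw [← hs]; ring
  have g := two_mul_form_le h hK hρ (b := b - t • θ.β) o1
  simp only [map_sub, map_smul, LinearMap.sub_apply, LinearMap.smul_apply, smul_eq_mul,
    form_α_α h, form_β_β h, form_inX_β h hK hρ0, form_α_inY h hK hρ0, c1, c2] at g
  rw [← hs, ← ht] at g
  set A := θ.form (inX a) (inX a)
  set D := θ.form (inY b) (inY b)
  set C := θ.form (inX a) (inY b)
  nlinarith [mul_nonneg hρ0.le (sq_nonneg (s - t)), mul_nonneg hc (sq_nonneg s),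
    mul_nonneg hc (sq_nonneg t), mul_nonneg hρ0.le (sq_nonneg s), mul_nonneg hρ0.le (sq_nonneg t)]

end Gap

end Population

/-! ### Sparsity of the canonical directions and bounds for the inverse Hessian -/

theorem l1norm_sq_le_ncard_mul {m : ℕ} {v : Fin m → ℝ} {S : Set (Fin m)}
    (hv : ∀ k, v k ≠ 0 → k ∈ S) : l1norm v ^ 2 ≤ S.ncard * (v ⬝ᵥ v) := by
  classical
  have hS : S = (S.toFinite.toFinset : Set (Fin m)) := by simp
  have h1 : l1norm v = ∑ k ∈ S.toFinite.toFinset, |v k| := by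
    rw [l1norm]
    refine (Finset.sum_subset (Finset.subset_univ _) fun k _ hk => ?_).symm
    rw [Set.Finite.mem_toFinset] at hk
    have : v k = 0 := by
      by_contra h
      exact hk (hv k h)
    rw [this, abs_zero]
  have h2 : (S.ncard : ℝ) = (S.toFinite.toFinset.card : ℝ) := by
    rw [Set.ncard_eq_toFinset_card S]
  rw [h1, h2]
  refine sq_sum_le_card_mul_sum_sq.trans (mul_le_mul_of_nonneg_left ?_ (Nat.cast_nonneg _))
  rw [dotProduct]
  refine (Finset.sum_le_sum_of_subset_of_nonneg (Finset.subset_univ _)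
    fun k _ _ => sq_nonneg _).trans (le_of_eq ?_)
  exact Finset.sum_congr rfl fun k _ => by rw [sq_abs, sq]

namespace Population

variable {r p q : ℕ} {θ : Population r p q}

/-- The column of `Φ⁰` for the coordinate `i` of `x`, restricted to the first block. -/
def phiX (θ : Population r p q) (i : Fin p) : Fin p → ℝ :=
  fun k => θ.Phi0 (Sum.inl k) (Sum.inl i)

/-- The column of `Φ⁰` for the coordinate `i` of `x`, restricted to the second block. -/
def phiY (θ : Population r p q) (i : Fin p) : Fin q → ℝ :=
  fun k => θ.Phi0 (Sum.inr k) (Sum.inl i)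

section Gap

variable (h : θ.IsCCA) {K : ℝ≥0} (hK : θ.SubGaussian K) (hρ : θ.corr₂ < θ.rho)
  {M : ℝ} (hM : 0 < M) (hX : EigenvaluesBounded θ.covX M) (hY : EigenvaluesBounded θ.covY M)

include h hM hX in
theorem one_le_mul_α : 1 ≤ M * (θ.α ⬝ᵥ θ.α) ∧ θ.α ⬝ᵥ θ.α ≤ M := by
  have := form_inX_bounds hX θ.α
  rw [form_α_α h, inv_mul_le_iff₀ hM] at this
  exact ⟨this.2, by linarith [this.1]⟩

include h hM hY in
theorem one_le_mul_β : 1 ≤ M * (θ.β ⬝ᵥ θ.β) ∧ θ.β ⬝ᵥ θ.β ≤ M := by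
  have := form_inY_bounds hY θ.β
  rw [form_β_β h, inv_mul_le_iff₀ hM] at this
  exact ⟨this.2, by linarith [this.1]⟩

include hM hX in
theorem eq_zero_of_form_inX {a : Fin p → ℝ} (ha : θ.form (inX a) (inX a) = 0) : a = 0 := by
  have := (form_inX_bounds hX a).1
  rw [ha, inv_mul_le_iff₀ hM, mul_zero] at this
  exact dotProduct_self_eq_zero.1 (le_antisymm this (dotProduct_self_star_nonneg a))

include hM hY in
theorem eq_zero_of_form_inY {b : Fin q → ℝ} (hb : θ.form (inY b) (inY b) = 0) : b = 0 := by
  have := (form_inY_bounds hY b).1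
  rw [hb, inv_mul_le_iff₀ hM, mul_zero] at this
  exact dotProduct_self_eq_zero.1 (le_antisymm this (dotProduct_self_star_nonneg b))

include h hK hρ hM hX in
-- `α` and a multiple of the first column of `U` agree when paired in the form; the lower eigenvalue
-- bound makes the form definite, so they agree as vectors and `α` is supported on the nonzero rows
-- of `U`.
theorem exists_U_ne_zero (k : Fin p) (hk : θ.α k ≠ 0) : ∃ j, θ.U k j ≠ 0 := by
  obtain ⟨j, c, -, hc, -⟩ := exists_form_α h hK hρ
  have h1 : θ.α - c • (fun l => θ.U l j) = 0 := by
    refine eq_zero_of_form_inX hM hX ?_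
    have := hc (θ.α - c • fun l => θ.U l j)
    rw [colU] at this
    rw [map_sub inX θ.α (c • _), map_smul, map_sub (θ.form (inX θ.α - _)), map_smul,
      ← map_smul inX, ← map_sub inX, smul_eq_mul, this, sub_self]
  refine ⟨j, fun h0 => hk ?_⟩
  have := congrFun h1 k
  simpa [h0] using this

include h hK hρ hM hY in
theorem exists_V_ne_zero (k : Fin q) (hk : θ.β k ≠ 0) : ∃ j, θ.V k j ≠ 0 := by
  have hρ0 := rho_pos h hρ
  obtain ⟨j₀, -, hj₀, -, -⟩ := exists_form_α h hK hρ
  set c := θ.rho⁻¹ * (θ.corr j₀ * θ.form (inX θ.α) (θ.colU j₀))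
  have hc : ∀ b, θ.form (inY b) (inY θ.β) = c * θ.form (inY b) (θ.colV j₀) := fun b => by
    have h5 := form_α_inY h hK hρ0 b
    rw [form_inX_inY h, Finset.sum_eq_single j₀ (fun j _ hj => by
      rw [form_comm h hK (inX θ.α), (form_col_eq_zero h hK hρ j fun h0 =>
        hj (Fin.ext (h0.trans hj₀.symm))).1, mul_zero, zero_mul]) (by simp)] at h5
    rw [form_comm h hK (inY b), form_comm h hK (inY b), eq_comm, mul_assoc, inv_mul_eq_div,
      div_eq_iff hρ0.ne']
    linarith
  have h1 : θ.β - c • (fun l => θ.V l j₀) = 0 := by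
    refine eq_zero_of_form_inY hM hY ?_
    have := hc (θ.β - c • fun l => θ.V l j₀)
    rw [colV] at this
    rw [map_sub inY θ.β (c • _), map_smul, map_sub (θ.form (inY θ.β - _)), map_smul,
      ← map_smul inY, ← map_sub inY, smul_eq_mul, this, sub_self]
  refine ⟨j₀, fun h0 => hk ?_⟩
  have := congrFun h1 k
  simpa [h0] using this

include h hK hρ hM hX in
-- Normalisation makes `α` nonzero, hence `U` has a nonzero row. Combined with `s_U = o(p)` this
-- forces `p → ∞`, and it makes powers of `s` monotone in the exponent.
theorem one_le_sU : 1 ≤ θ.sU := by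
  have h1 := (one_le_mul_α h hM hX).1
  have h2 : ∃ k, θ.α k ≠ 0 := by
    by_contra hcon
    push Not at hcon
    have : θ.α = 0 := funext hcon
    rw [this, dotProduct_zero, mul_zero] at h1
    linarith
  obtain ⟨k, hk⟩ := h2
  exact (Set.ncard_pos).2 ⟨k, exists_U_ne_zero h hK hρ hM hX k hk⟩

include h hK hρ hM hX in
-- Cauchy-Schwarz on the support. The resulting order `√s` of the `ℓ¹` norm controls the error made
-- in estimating the scale factor `√ρ`.
theorem l1norm_α_sq_le : l1norm θ.α ^ 2 ≤ θ.s * M := by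
  refine (l1norm_sq_le_ncard_mul (S := {k | ∃ j, θ.U k j ≠ 0})
    (exists_U_ne_zero h hK hρ hM hX)).trans ?_
  have h1 : (θ.sU : ℝ) ≤ θ.s := by exact_mod_cast Nat.le_add_right _ _
  have h2 := (one_le_mul_α h hM hX).2
  exact mul_le_mul h1 h2 (dotProduct_self_star_nonneg _) (Nat.cast_nonneg _)

include h hK hρ hM hY in
theorem l1norm_β_sq_le : l1norm θ.β ^ 2 ≤ θ.s * M := by
  refine (l1norm_sq_le_ncard_mul (S := {k | ∃ j, θ.V k j ≠ 0})
    (exists_V_ne_zero h hK hρ hM hY)).trans ?_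
  have h1 : (θ.sV : ℝ) ≤ θ.s := by exact_mod_cast Nat.le_add_left _ _
  have h2 := (one_le_mul_β h hM hY).2
  exact mul_le_mul h1 h2 (dotProduct_self_star_nonneg _) (Nat.cast_nonneg _)

include h hK hρ hM hX hY

omit hM in
-- The lower bound for the Hessian in terms of the population form, converted to the Euclidean norm.
-- It yields both invertibility and the uniform bound on the columns of `Φ⁰`.
theorem coercive (u : Fin p ⊕ Fin q → ℝ) :
    2 * (θ.rho - θ.corr₂) * M⁻¹ * (u ⬝ᵥ u) ≤ u ⬝ᵥ θ.H0 *ᵥ u := by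
  have h1 := le_dotProduct_H0_mulVec h hK hρ (fun k => u (Sum.inl k)) (fun k => u (Sum.inr k))
  rw [inX_add_inY] at h1
  refine le_trans ?_ h1
  have h2 := (form_inX_bounds hX (fun k => u (Sum.inl k))).1
  have h3 := (form_inY_bounds hY (fun k => u (Sum.inr k))).1
  have h4 : u ⬝ᵥ u = ((fun k => u (Sum.inl k)) ⬝ᵥ fun k => u (Sum.inl k)) +
      ((fun k => u (Sum.inr k)) ⬝ᵥ fun k => u (Sum.inr k)) := by
    simp [dotProduct, Fintype.sum_sum_type]
  rw [h4, mul_assoc]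
  refine mul_le_mul_of_nonneg_left ?_ (by linarith)
  rw [mul_add]
  exact add_le_add h2 h3

theorem H0_mul_Phi0 : θ.H0 * θ.Phi0 = 1 := by
  refine Matrix.mul_nonsing_inv _ ((Matrix.isUnit_iff_isUnit_det _).1
    (Matrix.mulVec_injective_iff_isUnit.1 ?_))
  intro u v huv
  have h1 := coercive h hK hρ hX hY (u - v)
  have h2 : θ.H0 *ᵥ (u - v) = 0 := by rw [mulVec_sub, sub_eq_zero]; exact huv
  rw [h2, dotProduct_zero] at h1
  have h3 : 0 < 2 * (θ.rho - θ.corr₂) * M⁻¹ := by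
    have := sub_pos.2 hρ
    positivity
  have h4 : (u - v) ⬝ᵥ (u - v) ≤ 0 := by
    by_contra hcon
    exact absurd h1 (not_le.2 (mul_pos h3 (not_le.1 hcon)))
  exact sub_eq_zero.1 (dotProduct_self_eq_zero.1 (le_antisymm h4 (dotProduct_self_star_nonneg _)))

theorem H0_mulVec_phi (i : Fin p) :
    θ.H0 *ᵥ (inX (θ.phiX i) + inY (θ.phiY i)) = Pi.single (Sum.inl i) 1 := by
  have h1 : (inX (θ.phiX i) + inY (θ.phiY i) : Fin p ⊕ Fin q → ℝ) =
      fun k => θ.Phi0 k (Sum.inl i) := inX_add_inY fun k => θ.Phi0 k (Sum.inl i)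
  have h2 := H0_mul_Phi0 h hK hρ hM hX hY
  ext k
  have h3 := congrFun (congrFun h2 k) (Sum.inl i)
  rw [Matrix.mul_apply] at h3
  rw [h1]
  change ∑ l, θ.H0 k l * θ.Phi0 l (Sum.inl i) = _
  rw [h3, Matrix.one_apply, Pi.single_apply]

/-- The coordinate `i` of `x` in terms of the Hessian and `Φ⁰`. -/
theorem coord_eq (i : Fin p) (a : Fin p → ℝ) (b : Fin q → ℝ) :
    a i = 2 * θ.rho * θ.form (inX a) (inX (θ.phiX i)) +
        4 * θ.rho * θ.form (inX a) (inX θ.α) * θ.form (inX θ.α) (inX (θ.phiX i)) -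
        2 * θ.form (inX a) (inY (θ.phiY i)) +
      (2 * θ.rho * θ.form (inY b) (inY (θ.phiY i)) +
        4 * θ.rho * θ.form (inY b) (inY θ.β) * θ.form (inY θ.β) (inY (θ.phiY i)) -
        2 * θ.form (inY b) (inX (θ.phiX i))) := by
  rw [← dotProduct_H0_mulVec _ _ _ _ (rho_pos h hρ).ne', H0_mulVec_phi h hK hρ hM hX hY]
  simp [inX, inY]

/-- Test `H⁰ φ = e_i` against `φ` itself: coercivity gives `c |φ|² ≤ φ_i ≤ |φ|` with `c = 2 ε / M`,
so `|φ| ≤ 1 / c`. -/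
theorem phi_bound (i : Fin p) {ε : ℝ} (hε : 0 < ε) (hgap : ε < θ.rho - θ.corr₂) :
    θ.phiX i ⬝ᵥ θ.phiX i ≤ (M / (2 * ε)) ^ 2 ∧ θ.phiY i ⬝ᵥ θ.phiY i ≤ (M / (2 * ε)) ^ 2 := by
  have h1 := coercive h hK hρ hX hY (inX (θ.phiX i) + inY (θ.phiY i))
  have h4 : (inX (θ.phiX i) + inY (θ.phiY i) : Fin p ⊕ Fin q → ℝ) ⬝ᵥ
      (inX (θ.phiX i) + inY (θ.phiY i)) = θ.phiX i ⬝ᵥ θ.phiX i + θ.phiY i ⬝ᵥ θ.phiY i := by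
    simp [dotProduct, Fintype.sum_sum_type, inX, inY]
  rw [H0_mulVec_phi h hK hρ hM hX hY, h4, dotProduct_single, mul_one] at h1
  have h5 : (inX (θ.phiX i) + inY (θ.phiY i) : Fin p ⊕ Fin q → ℝ) (Sum.inl i) = θ.phiX i i := by
    simp [inX, inY]
  rw [h5] at h1
  have h6 : θ.phiX i i ^ 2 ≤ θ.phiX i ⬝ᵥ θ.phiX i := by
    rw [dotProduct, sq]
    exact Finset.single_le_sum (f := fun k => θ.phiX i k * θ.phiX i k)
      (fun k _ => mul_self_nonneg _) (Finset.mem_univ i)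
  have hA : 0 ≤ θ.phiX i ⬝ᵥ θ.phiX i := dotProduct_self_star_nonneg _
  have hB : 0 ≤ θ.phiY i ⬝ᵥ θ.phiY i := dotProduct_self_star_nonneg _
  set A := θ.phiX i ⬝ᵥ θ.phiX i
  set B := θ.phiY i ⬝ᵥ θ.phiY i
  set x := θ.phiX i i
  have h7 : (2 * ε / M) * (A + B) ≤ x := by
    refine le_trans ?_ h1
    rw [div_eq_mul_inv]
    gcongr
  set c := 2 * ε / M with hc
  have hc0 : 0 < c := by positivity
  have h8 : (c * (A + B)) ^ 2 ≤ A + B := by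
    have : (c * (A + B)) ^ 2 ≤ x ^ 2 := by
      gcongr
    linarith
  have h9 : A + B ≤ (M / (2 * ε)) ^ 2 := by
    have e : M / (2 * ε) = c⁻¹ := by rw [hc, inv_div]
    rw [e, inv_pow, ← one_div, le_div_iff₀ (by positivity)]
    rcases (add_nonneg hA hB).eq_or_lt with h0 | h0
    · rw [← h0]; simp
    · rw [mul_pow] at h8
      have : (A + B) * ((A + B) * c ^ 2) ≤ (A + B) * 1 := by nlinarith
      exact le_of_mul_le_mul_left this h0
  exact ⟨by linarith, by linarith⟩

end Gap

end Population

/-! ### The sample form -/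

section SampleForm

variable {n p q : ℕ} (z : Fin n → (Fin p → ℝ) × (Fin q → ℝ))

theorem sampleForm_comm (u v : Fin p ⊕ Fin q → ℝ) : sampleForm z u v = sampleForm z v u := by
  simp_rw [sampleForm_apply, mul_comm]

theorem sampleForm_self_nonneg (u : Fin p ⊕ Fin q → ℝ) : 0 ≤ sampleForm z u u := by
  rw [sampleForm_apply]
  exact mul_nonneg (by positivity) (Finset.sum_nonneg fun j _ => mul_self_nonneg _)

theorem sampleForm_sq_le (u v : Fin p ⊕ Fin q → ℝ) :
    sampleForm z u v ^ 2 ≤ sampleForm z u u * sampleForm z v v := by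
  have := LinearMap.BilinForm.apply_mul_apply_le_of_forall_zero_le (sampleForm z)
    (sampleForm_self_nonneg z) u v
  rwa [sampleForm_comm z v u, ← sq] at this

variable (a : Fin p → ℝ) (b : Fin q → ℝ)

theorem dotProduct_gradX (c x : Fin p → ℝ) (y : Fin q → ℝ) :
    c ⬝ᵥ gradX z x y = 2 * sampleForm z (inX x) (inX x) * sampleForm z (inX c) (inX x) -
      2 * sampleForm z (inX c) (inY y) := by
  simp only [gradX, sampleForm, blockForm_inX_inX, blockForm_inX_inY, dotProduct_sub,
    dotProduct_smul, smul_eq_mul]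

theorem dotProduct_gradY (c : Fin q → ℝ) (x : Fin p → ℝ) (y : Fin q → ℝ) :
    c ⬝ᵥ gradY z x y = 2 * sampleForm z (inY y) (inY y) * sampleForm z (inY c) (inY y) -
      2 * sampleForm z (inY c) (inX x) := by
  simp only [gradY, sampleForm, blockForm_inY_inY, blockForm_inY_inX, dotProduct_sub,
    dotProduct_smul, smul_eq_mul]

theorem debiasedX_eq (Φ : Matrix (Fin p ⊕ Fin q) (Fin p ⊕ Fin q) ℝ) (i : Fin p) :
    debiasedX z a b Φ i = hatX z a b i -
      ((fun k => Φ (Sum.inl k) (Sum.inl i)) ⬝ᵥ gradX z (hatX z a b) (hatY z a b) +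
        (fun k => Φ (Sum.inr k) (Sum.inl i)) ⬝ᵥ gradY z (hatX z a b) (hatY z a b)) := by
  simp only [debiasedX, debiased, Pi.sub_apply, Sum.elim_inl, mulVec, dotProduct,
    Fintype.sum_sum_type, transpose_apply, Sum.elim_inr]

theorem hatRho_eq : hatRho z a b = sampleForm z (inX a) (inY b) /
    (√(sampleForm z (inX a) (inX a)) * √(sampleForm z (inY b) (inY b))) := by
  simp only [hatRho, sampleForm, blockForm_inX_inX, blockForm_inX_inY, blockForm_inY_inY]

theorem hatX_dotProduct_hatY : hatX z a b ⬝ᵥ hatCovXY z *ᵥ hatY z a b =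
    |hatRho z a b| * sampleForm z (inX a) (inY b) := by
  have : hatX z a b ⬝ᵥ hatCovXY z *ᵥ hatY z a b =
      sampleForm z (inX (hatX z a b)) (inY (hatY z a b)) := by
    rw [sampleForm, blockForm_inX_inY]
  rw [this, hatX, hatY]
  simp only [map_smul, LinearMap.smul_apply, smul_eq_mul]
  rw [← mul_assoc, Real.mul_self_sqrt (abs_nonneg _)]

end SampleForm

/-- Expansion of one block of the estimated gradient. -/
theorem gradient_expansion {V : Type*} [AddCommGroup V] [Module ℝ V]
    {B C : LinearMap.BilinForm ℝ V} (hC : ∀ u v, C u v = C v u)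
    {ρ : ℝ} {x y d e φ f : V} (h1 : B x x = ρ) (h2 : B φ y = ρ * B φ x)
    (h3 : B f y = ρ * B f x) :
    2 * ρ * B φ d + 4 * (B φ x * B x d) - 2 * B φ e -
        (2 * C (x + d) (x + d) * C (φ + f) (x + d) - 2 * C (φ + f) (y + e)) +
        2 * (ρ * (C - B) φ x + B φ x * (C - B) x x - (C - B) φ y) =
      2 * ((C - B) φ e + (C - B) f y + C f e - ρ * ((C - B) φ d + (C - B) f x + C f d) -
        B φ x * (2 * (C - B) x d + C d d) -
        ((C - B) x x + 2 * C x d + C d d) * ((C - B) φ x + C φ d + C f x + C f d)) := by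
  -- The stationarity relations `h1`, `h2`, `h3` cancel the terms of order zero and those linear in
  -- `d`, `e`, `f`; what is linear in `C - B` has been put on the left. On the right every term has
  -- at least two factors among `C - B`, `d`, `e`, `f`.
  simp only [map_add, LinearMap.add_apply, LinearMap.sub_apply, hC d x]
  rw [h1, h2, h3]
  ring

/-! ### Order of the second-order remainder -/

section Orders

variable {l : Filter ℕ}

theorem isBigO_of_sq_le_mul {x A B f g : ℕ → ℝ} (h : ∀ n, x n ^ 2 ≤ A n * B n)
    (hA : A =O[l] fun n => f n ^ 2) (hB : B =O[l] fun n => g n ^ 2) :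
    x =O[l] fun n => f n * g n := by
  have h1 : (fun n => x n ^ 2) =O[l] fun n => (f n * g n) ^ 2 := by
    have h2 : (fun n => x n ^ 2) =O[l] fun n => A n * B n :=
      IsBigO.of_bound 1 (Eventually.of_forall fun n => by
        rw [Real.norm_of_nonneg (sq_nonneg _), one_mul]
        exact (h n).trans (le_abs_self _))
    refine (h2.trans (hA.mul hB)).congr_right fun n => by ring
  exact h1.of_pow two_ne_zero

/-- One block of the estimated gradient is linear up to the square of the rate. -/
theorem isBigO_gradient_expansion {V : ℕ → Type*} [∀ n, AddCommGroup (V n)] [∀ n, Module ℝ (V n)]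
    {B C : ∀ n, LinearMap.BilinForm ℝ (V n)} (hC : ∀ n u v, C n u v = C n v u)
    (hCs : ∀ n u v, C n u v ^ 2 ≤ C n u u * C n v v)
    {ρ : ℕ → ℝ} {x y d e φ f : ∀ n, V n} (h1 : ∀ n, B n (x n) (x n) = ρ n)
    (h2 : ∀ n, B n (φ n) (y n) = ρ n * B n (φ n) (x n))
    (h3 : ∀ n, B n (f n) (y n) = ρ n * B n (f n) (x n)) {r : ℕ → ℝ}
    (hr : r =O[l] fun _ => (1 : ℝ)) (hρ : ρ =O[l] fun _ => (1 : ℝ))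
    (a1 : (fun n => (C n - B n) (φ n) (d n)) =O[l] fun n => r n ^ 2)
    (a2 : (fun n => (C n - B n) (φ n) (e n)) =O[l] fun n => r n ^ 2)
    (a3 : (fun n => (C n - B n) (f n) (x n)) =O[l] fun n => r n ^ 2)
    (a4 : (fun n => (C n - B n) (f n) (y n)) =O[l] fun n => r n ^ 2)
    (a5 : (fun n => (C n - B n) (x n) (d n)) =O[l] fun n => r n ^ 2)
    (b1 : (fun n => C n (f n) (f n)) =O[l] fun n => r n ^ 2)
    (b2 : (fun n => C n (d n) (d n)) =O[l] fun n => r n ^ 2)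
    (b3 : (fun n => C n (e n) (e n)) =O[l] fun n => r n ^ 2)
    (c1 : (fun n => C n (x n) (x n)) =O[l] fun _ => (1 : ℝ))
    (c2 : (fun n => C n (φ n) (φ n)) =O[l] fun _ => (1 : ℝ))
    (c3 : (fun n => B n (φ n) (x n)) =O[l] fun _ => (1 : ℝ))
    (d1 : (fun n => (C n - B n) (x n) (x n)) =O[l] r)
    (d2 : (fun n => (C n - B n) (φ n) (x n)) =O[l] r) :
    (fun n => 2 * ρ n * B n (φ n) (d n) + 4 * (B n (φ n) (x n) * B n (x n) (d n)) -
        2 * B n (φ n) (e n) -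
        (2 * C n (x n + d n) (x n + d n) * C n (φ n + f n) (x n + d n) -
          2 * C n (φ n + f n) (y n + e n)) +
        2 * (ρ n * (C n - B n) (φ n) (x n) + B n (φ n) (x n) * (C n - B n) (x n) (x n) -
          (C n - B n) (φ n) (y n))) =O[l] fun n => r n ^ 2 := by
  have c1' : (fun n => C n (x n) (x n)) =O[l] fun _ => (1 : ℝ) ^ 2 := by simpa using c1
  have c2' : (fun n => C n (φ n) (φ n)) =O[l] fun _ => (1 : ℝ) ^ 2 := by simpa using c2
  have rr : (fun n => r n ^ 2) =O[l] r := by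
    simpa [sq] using hr.mul (isBigO_refl r l)
  have e1 : (fun n => C n (f n) (e n)) =O[l] fun n => r n ^ 2 := by
    simpa [sq] using isBigO_of_sq_le_mul (fun n => hCs n _ _) b1 b3
  have e2 : (fun n => C n (f n) (d n)) =O[l] fun n => r n ^ 2 := by
    simpa [sq] using isBigO_of_sq_le_mul (fun n => hCs n _ _) b1 b2
  have e3 : (fun n => C n (x n) (d n)) =O[l] r := by
    simpa using isBigO_of_sq_le_mul (fun n => hCs n _ _) c1' b2
  have e4 : (fun n => C n (φ n) (d n)) =O[l] r := by
    simpa using isBigO_of_sq_le_mul (fun n => hCs n _ _) c2' b2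
  have e5 : (fun n => C n (f n) (x n)) =O[l] r := by
    simpa using isBigO_of_sq_le_mul (fun n => hCs n _ _) b1 c1'
  have one : ∀ {u v : ℕ → ℝ}, u =O[l] (fun _ => (1 : ℝ)) → v =O[l] (fun n => r n ^ 2) →
      (fun n => u n * v n) =O[l] fun n => r n ^ 2 := fun hu hv => by
    simpa using hu.mul hv
  have m1 := (a2.add a4).add e1
  have m2 := one hρ ((a1.add a3).add e2)
  have m3 := one c3 ((a5.const_mul_left 2).add b2)
  have m4 := ((d1.add (e3.const_mul_left 2)).add (b2.trans rr)).mul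
    (((d2.add e4).add e5).add (e2.trans rr))
  have m5 := (((m1.sub m2).sub m3).sub (m4.congr_right fun n => (sq (r n)).symm)).const_mul_left 2
  refine m5.congr_left fun n => ?_
  exact (gradient_expansion (hC n) (h1 n) (h2 n) (h3 n)).symm

end Orders

/-! ### Norms and signs -/

theorem l1norm_nonneg {ι : Type*} [Fintype ι] (v : ι → ℝ) : 0 ≤ l1norm v :=
  Finset.sum_nonneg fun _ _ => abs_nonneg _

theorem l2norm_nonneg {ι : Type*} [Fintype ι] (v : ι → ℝ) : 0 ≤ l2norm v := Real.sqrt_nonneg _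

theorem l2norm_sq {ι : Type*} [Fintype ι] (v : ι → ℝ) : l2norm v ^ 2 = v ⬝ᵥ v := by
  rw [l2norm, Real.sq_sqrt (Finset.sum_nonneg fun _ _ => sq_nonneg _), dotProduct]
  simp_rw [sq]

theorem l1norm_add_le {ι : Type*} [Fintype ι] (u v : ι → ℝ) :
    l1norm (u + v) ≤ l1norm u + l1norm v := by
  rw [l1norm, l1norm, l1norm, ← Finset.sum_add_distrib]
  exact Finset.sum_le_sum fun k _ => abs_add_le _ _

theorem l1norm_smul {ι : Type*} [Fintype ι] (c : ℝ) (v : ι → ℝ) :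
    l1norm (c • v) = |c| * l1norm v := by
  simp [l1norm, abs_mul, Finset.mul_sum]

theorem l1norm_inX {p q : ℕ} (a : Fin p → ℝ) :
    l1norm (inX a : Fin p ⊕ Fin q → ℝ) = l1norm a := by
  simp [l1norm, inX]

theorem l1norm_inY {p q : ℕ} (b : Fin q → ℝ) :
    l1norm (inY b : Fin p ⊕ Fin q → ℝ) = l1norm b := by
  simp [l1norm, inY]

theorem l2norm_le_l1norm {ι : Type*} [Fintype ι] (v : ι → ℝ) : l2norm v ≤ l1norm v := by
  refine Real.sqrt_le_iff.2 ⟨l1norm_nonneg v, ?_⟩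
  have := Finset.sum_sq_le_sq_sum_of_nonneg (s := Finset.univ) (f := fun k => |v k|)
    fun _ _ => abs_nonneg _
  simpa [l1norm] using this

theorem l2norm_eq_norm {ι : Type*} [Fintype ι] (v : ι → ℝ) : l2norm v = ‖WithLp.toLp 2 v‖ := by
  simp [l2norm, EuclideanSpace.norm_eq]

theorem l2norm_add_le {ι : Type*} [Fintype ι] (u v : ι → ℝ) :
    l2norm (u + v) ≤ l2norm u + l2norm v := by
  simp only [l2norm_eq_norm, WithLp.toLp_add]
  exact norm_add_le _ _

theorem l2norm_smul {ι : Type*} [Fintype ι] (c : ℝ) (v : ι → ℝ) :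
    l2norm (c • v) = |c| * l2norm v := by
  simp only [l2norm_eq_norm, WithLp.toLp_smul, norm_smul, Real.norm_eq_abs]

/-- The two sign-invariant errors are attained at the same sign, unless both cannot be small. -/
theorem exists_sign {m : ℕ} (a α : Fin m → ℝ) : ∃ w : ℝ, w ^ 2 = 1 ∧
    l2norm (w • a - α) = signErr2 a α ∧ (l1norm (w • a - α) = signErr1 a α ∨
      2 * l2norm α ≤ signErr1 a α + signErr2 a α) := by
  -- If the `ℓ²` and `ℓ¹` errors are attained at opposite signs, their sum dominates the sum of both
  -- `ℓ²` errors, which is at least `2 ‖α‖₂`.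
  have htri : 2 * l2norm α ≤ l2norm (a - α) + l2norm (-a - α) := by
    have e : (a - α) + (-a - α) = (-2 : ℝ) • α := by ext k; simp; ring
    have h := l2norm_add_le (a - α) (-a - α)
    rwa [e, l2norm_smul, abs_neg, abs_two] at h
  have h1 := l2norm_le_l1norm (a - α)
  have h2 := l2norm_le_l1norm (-a - α)
  unfold signErr1 signErr2
  rcases le_total (l2norm (a - α)) (l2norm (-a - α)) with h3 | h3
  · refine ⟨1, by norm_num, by rw [one_smul, min_eq_left h3], ?_⟩
    rw [one_smul, min_eq_left h3]
    rcases le_total (l1norm (a - α)) (l1norm (-a - α)) with h4 | h4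
    · exact Or.inl (min_eq_left h4).symm
    · rw [min_eq_right h4]
      right; linarith
  · refine ⟨-1, by norm_num, by rw [neg_one_smul, min_eq_right h3], ?_⟩
    rw [neg_one_smul, min_eq_right h3]
    rcases le_total (l1norm (a - α)) (l1norm (-a - α)) with h4 | h4
    · rw [min_eq_left h4]
      right; linarith
    · exact Or.inl (min_eq_right h4).symm

theorem abs_bilin_le_of_basis {ι : Type*} [Fintype ι] [DecidableEq ι]
    (D : LinearMap.BilinForm ℝ (ι → ℝ)) {c : ℝ} {v : ι → ℝ}
    (hc : ∀ k, |D (Pi.single k 1) v| ≤ c) (u : ι → ℝ) : |D u v| ≤ c * l1norm u := by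
  have hu : u = ∑ k, u k • (Pi.single k 1 : ι → ℝ) := by
    ext j
    simp [Finset.sum_apply, Pi.single_apply]
  conv_lhs => rw [hu]
  rw [map_sum, LinearMap.sum_apply, l1norm, Finset.mul_sum]
  refine (Finset.abs_sum_le_sum_abs _ _).trans (Finset.sum_le_sum fun k _ => ?_)
  rw [map_smul, LinearMap.smul_apply, smul_eq_mul, abs_mul, mul_comm c]
  exact mul_le_mul_of_nonneg_left (hc k) (abs_nonneg _)

/-! ### The expansion of the de-biased estimator along a sample path -/

/-- The largest absolute value of the form `D` on pairs of members of a family. -/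
def devSup {V ι : Type*} [AddCommGroup V] [Module ℝ V] (D : LinearMap.BilinForm ℝ V)
    (v : ι → V) : ℝ := ⨆ kl : ι × ι, |D (v kl.1) (v kl.2)|

theorem le_devSup {V ι : Type*} [AddCommGroup V] [Module ℝ V] [Finite ι]
    (D : LinearMap.BilinForm ℝ V) (v : ι → V) (k l : ι) : |D (v k) (v l)| ≤ devSup D v :=
  le_ciSup (f := fun kl : ι × ι => |D (v kl.1) (v kl.2)|) (Set.finite_range _).bddAbove (k, l)

namespace Population

variable {r p q : ℕ}

/-- The vectors at which the sample form has to be close to the population form. -/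
def refVec (θ : Population r p q) (i : Fin p) : Fin 4 → Fin p ⊕ Fin q → ℝ :=
  ![inX θ.α, inY θ.β, inX (θ.phiX i), inY (θ.phiY i)]

/-- The standard basis together with `refVec`. -/
def famVec (θ : Population r p q) (i : Fin p) :
    (Fin p ⊕ Fin q) ⊕ Fin 4 → Fin p ⊕ Fin q → ℝ :=
  Sum.elim (fun k => Pi.single k 1) (θ.refVec i)

/-- The assumptions on the population at a fixed sample size. -/
structure Regular (θ : Population r p q) (K : ℝ≥0) (ε₀ M : ℝ) : Prop where
  isCCA : θ.IsCCA
  subGaussian : θ.SubGaussian K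
  gap : ε₀ < θ.rho - θ.corr₂
  eigX : EigenvaluesBounded θ.covX M
  eigY : EigenvaluesBounded θ.covY M

/-- The leading term in the expansion of `x⁰ i - x̂^db i`. -/
def leading {n : ℕ} (θ : Population r p q) (z : Fin n → (Fin p → ℝ) × (Fin q → ℝ))
    (i : Fin p) : ℝ :=
  2 * (θ.rho * (sampleForm z - θ.form) (inX (θ.phiX i)) (inX θ.x0) +
      θ.form (inX (θ.phiX i)) (inX θ.x0) * (sampleForm z - θ.form) (inX θ.x0) (inX θ.x0) -
      (sampleForm z - θ.form) (inX (θ.phiX i)) (inY θ.y0)) +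
  2 * (θ.rho * (sampleForm z - θ.form) (inY (θ.phiY i)) (inY θ.y0) +
      θ.form (inY (θ.phiY i)) (inY θ.y0) * (sampleForm z - θ.form) (inY θ.y0) (inY θ.y0) -
      (sampleForm z - θ.form) (inY (θ.phiY i)) (inX θ.x0))

end Population

/-- The stochastic bounds, along a sample path. -/
structure PathBounds {r : ℕ} {p q : ℕ → ℕ} (l : Filter ℕ) (θ : ∀ n, Population r (p n) (q n))
    (i : ∀ n, Fin (p n)) (z : ∀ n, Fin n → (Fin (p n) → ℝ) × (Fin (q n) → ℝ))
    (a : ∀ n, Fin (p n) → ℝ) (b : ∀ n, Fin (q n) → ℝ)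
    (Φ : ∀ n, Matrix (Fin (p n) ⊕ Fin (q n)) (Fin (p n) ⊕ Fin (q n)) ℝ)
    (rt g lm m : ℕ → ℝ) : Prop where
  rt_zero : Tendsto rt l (𝓝 0)
  g_zero : Tendsto g l (𝓝 0)
  sqrt_s : (fun n => √((θ n).s : ℝ) * rt n) =O[l] g
  g_lm : (fun n => lm n * g n) =O[l] fun n => rt n ^ 2
  gg_lm : (fun n => lm n * g n * g n) =O[l] fun n => rt n ^ 2
  m_rt : m =O[l] rt
  err2 : (fun n => signErr2 (a n) (θ n).α + signErr2 (b n) (θ n).β) =O[l] rt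
  err1 : (fun n => signErr1 (a n) (θ n).α + signErr1 (b n) (θ n).β) =O[l] g
  phi1 : (fun n => maxColErr1 (Φ n) (θ n).Phi0) =O[l] g
  phi2 : (fun n => maxColErr2 (Φ n) (θ n).Phi0) =O[l] rt
  devFam : (fun n => devSup (sampleForm (z n) - (θ n).form) ((θ n).famVec (i n))) =O[l] lm
  devRef : (fun n => devSup (sampleForm (z n) - (θ n).form) ((θ n).refVec (i n))) =O[l] m
  sign : ∀ᶠ n in l, 0 ≤ hatX (z n) (a n) (b n) ⬝ᵥ hatCovXY (z n) *ᵥ hatY (z n) (a n) (b n)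

theorem isBigO_of_abs_le {l : Filter ℕ} {f g h : ℕ → ℝ} (hfg : ∀ n, |f n| ≤ g n)
    (hg : g =O[l] h) : f =O[l] h :=
  (IsBigO.of_bound 1 (Eventually.of_forall fun n => by
    rw [Real.norm_eq_abs, one_mul]
    exact (hfg n).trans (le_abs_self _))).trans hg

theorem isBigO_one_of_abs_le {l : Filter ℕ} {f : ℕ → ℝ} {c : ℝ} (hf : ∀ n, |f n| ≤ c) :
    f =O[l] fun _ => (1 : ℝ) :=
  IsBigO.of_bound c (Eventually.of_forall fun n => by simpa using hf n)

/-- The estimate of `√ρ` inherits the rate of the estimates of the three second moments. -/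
theorem isBigO_sqrt_abs_sub {l : Filter ℕ} {N A C ρ u rt : ℕ → ℝ} {ε : ℝ} (hε : 0 < ε)
    (hρ : ∀ n, ε ≤ ρ n) (hρ1 : ∀ n, ρ n ≤ 1) (hrt : Tendsto rt l (𝓝 0))
    (hA : (fun n => A n - 1) =O[l] rt) (hC : (fun n => C n - 1) =O[l] rt)
    (hN : (fun n => N n - ρ n) =O[l] rt) (hu : ∀ᶠ n in l, u n ^ 2 * (A n * C n) = N n ^ 2) :
    (fun n => √|u n| - √(ρ n)) =O[l] rt := by
  have rt1 : rt =O[l] fun _ => (1 : ℝ) := hrt.isBigO_one ℝ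
  have ρ1 : ρ =O[l] fun _ => (1 : ℝ) := isBigO_one_of_abs_le (c := 1) fun n => by
    rw [abs_of_nonneg (hε.le.trans (hρ n))]; exact hρ1 n
  have A1 : A =O[l] fun _ => (1 : ℝ) := by
    simpa using (hA.trans rt1).add (isBigO_refl (fun _ => (1 : ℝ)) l)
  have N1 : N =O[l] fun _ => (1 : ℝ) := by simpa using (hN.trans rt1).add ρ1
  have hAC : (fun n => A n * C n - 1) =O[l] rt := by
    have h1 : (fun n => A n * (C n - 1)) =O[l] rt := by simpa using A1.mul hC
    exact (h1.add hA).congr_left fun n => by ring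
  have hlim : Tendsto (fun n => A n * C n) l (𝓝 1) := by
    have := (hAC.trans_tendsto hrt).add_const 1
    simpa using this
  have hinv : (fun n => (A n * C n)⁻¹) =O[l] fun _ => (1 : ℝ) :=
    (hlim.inv₀ one_ne_zero).isBigO_one ℝ
  have hne : ∀ᶠ n in l, A n * C n ≠ 0 := hlim.eventually_ne one_ne_zero
  -- The rate is carried from `N² - ρ² A C` to `u² - ρ²`, then to `|u| - ρ` and to `√|u| - √ρ`. The
  -- last two steps divide a difference of squares by a sum bounded below, by `ε` and `√ε`.
  have h2 : (fun n => N n ^ 2 - ρ n ^ 2 * (A n * C n)) =O[l] rt := by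
    have t1 : (fun n => (N n - ρ n) * (N n + ρ n)) =O[l] rt := by simpa using hN.mul (N1.add ρ1)
    have t2 : (fun n => ρ n * ρ n * (A n * C n - 1)) =O[l] rt := by
      simpa using (ρ1.mul ρ1).mul hAC
    exact (t1.sub t2).congr_left fun n => by ring
  have h3 : (fun n => u n ^ 2 - ρ n ^ 2) =O[l] rt := by
    have t : (fun n => (N n ^ 2 - ρ n ^ 2 * (A n * C n)) * (A n * C n)⁻¹) =O[l] rt := by
      simpa using h2.mul hinv
    refine t.congr' ?_ EventuallyEq.rfl
    filter_upwards [hu, hne] with n h4 h5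
    rw [← h4, ← sub_mul, mul_assoc, mul_inv_cancel₀ h5, mul_one]
  have h4 : (fun n => |u n| - ρ n) =O[l] rt := by
    refine IsBigO.trans (IsBigO.of_bound ε⁻¹ (Eventually.of_forall fun n => ?_)) h3
    rw [Real.norm_eq_abs, Real.norm_eq_abs, inv_mul_eq_div, le_div_iff₀ hε, ← sq_abs (u n),
      sq_sub_sq, abs_mul, mul_comm]
    gcongr
    have := hρ n
    rw [abs_of_nonneg (add_nonneg (abs_nonneg _) (hε.le.trans (hρ n)))]
    linarith [abs_nonneg (u n)]
  refine IsBigO.trans (IsBigO.of_bound (√ε)⁻¹ (Eventually.of_forall fun n => ?_)) h4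
  have hρ0 : 0 ≤ ρ n := hε.le.trans (hρ n)
  have e : |u n| - ρ n = (√|u n| + √(ρ n)) * (√|u n| - √(ρ n)) := by
    rw [← sq_sub_sq, Real.sq_sqrt (abs_nonneg _), Real.sq_sqrt hρ0]
  rw [Real.norm_eq_abs, Real.norm_eq_abs, inv_mul_eq_div, le_div_iff₀ (Real.sqrt_pos.2 hε),
    e, abs_mul, mul_comm]
  gcongr
  rw [abs_of_nonneg (by positivity)]
  have := Real.sqrt_le_sqrt (hρ n)
  linarith [Real.sqrt_nonneg |u n|]

/-! ### Deviations and signs along a sample path -/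

section Path

variable {r : ℕ} {p q : ℕ → ℕ} {l : Filter ℕ} {θ : ∀ n, Population r (p n) (q n)}
  {i : ∀ n, Fin (p n)} {z : ∀ n, Fin n → (Fin (p n) → ℝ) × (Fin (q n) → ℝ)}
  {a : ∀ n, Fin (p n) → ℝ} {b : ∀ n, Fin (q n) → ℝ}
  {Φ : ∀ n, Matrix (Fin (p n) ⊕ Fin (q n)) (Fin (p n) ⊕ Fin (q n)) ℝ} {rt g lm m : ℕ → ℝ}
  {K : ℝ≥0} {ε₀ M : ℝ} (hθ : ∀ n, (θ n).Regular K ε₀ M) (hε₀ : 0 < ε₀) (hM : 0 < M)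
  (hb : PathBounds l θ i z a b Φ rt g lm m)

include hθ in
theorem dev_comm (n : ℕ) (u v : Fin (p n) ⊕ Fin (q n) → ℝ) :
    (sampleForm (z n) - (θ n).form) u v = (sampleForm (z n) - (θ n).form) v u := by
  simp only [LinearMap.sub_apply]
  rw [sampleForm_comm, Population.form_comm (hθ n).isCCA (hθ n).subGaussian]

include hb in
-- Hölder's inequality, with only the small vector expanded in the standard basis. The reference
-- vector, which for a column of `Φ⁰` need not be sparse, enters through its pairings with basis
-- vectors alone.
theorem isBigO_dev_ref {u : ∀ n, Fin (p n) ⊕ Fin (q n) → ℝ} (hu : (fun n => l1norm (u n)) =O[l] g)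
    (c : Fin 4) : (fun n => (sampleForm (z n) - (θ n).form) (u n) ((θ n).refVec (i n) c)) =O[l]
      fun n => rt n ^ 2 := by
  refine (isBigO_of_abs_le (fun n => ?_) (hb.devFam.mul hu)).trans hb.g_lm
  refine abs_bilin_le_of_basis _ (fun k => ?_) _
  exact le_devSup _ ((θ n).famVec (i n)) (Sum.inl k) (Sum.inr c)

include hθ hb in
-- Hölder's inequality in each of the two arguments, hence two factors `g` against one entrywise
-- deviation.
theorem isBigO_dev_self {u : ∀ n, Fin (p n) ⊕ Fin (q n) → ℝ}
    (hu : (fun n => l1norm (u n)) =O[l] g) :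
    (fun n => (sampleForm (z n) - (θ n).form) (u n) (u n)) =O[l] fun n => rt n ^ 2 := by
  refine (isBigO_of_abs_le (fun n => ?_) ((hb.devFam.mul hu).mul hu)).trans hb.gg_lm
  refine abs_bilin_le_of_basis _ (fun k => ?_) _
  rw [dev_comm hθ]
  refine abs_bilin_le_of_basis _ (fun j => ?_) _
  exact le_devSup _ ((θ n).famVec (i n)) (Sum.inl j) (Sum.inl k)

include hb in
theorem isBigO_dev_ref_ref (c c' : Fin 4) :
    (fun n => (sampleForm (z n) - (θ n).form) ((θ n).refVec (i n) c) ((θ n).refVec (i n) c'))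
      =O[l] m :=
  isBigO_of_abs_le (fun _ => le_devSup _ _ c c') hb.devRef

include hθ hb in
-- The population part is controlled by the `ℓ²` rate and the largest eigenvalue, the deviation by
-- the `ℓ¹` rate. This is the input for every use of Cauchy-Schwarz with the sample form.
theorem isBigO_sampleForm_inX {u : ∀ n, Fin (p n) → ℝ} (hu : (fun n => l1norm (u n)) =O[l] g)
    (hu2 : (fun n => l2norm (u n)) =O[l] rt) :
    (fun n => sampleForm (z n) (inX (u n)) (inX (u n))) =O[l] fun n => rt n ^ 2 := by
  have h1 := isBigO_dev_self hθ hb (u := fun n => inX (u n)) (by simpa [l1norm_inX] using hu)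
  have h2 : (fun n => (θ n).form (inX (u n)) (inX (u n))) =O[l] fun n => rt n ^ 2 := by
    refine isBigO_of_abs_le (fun n => ?_) ((hu2.pow 2).const_mul_left M)
    rw [abs_of_nonneg (Population.form_self_nonneg (hθ n).isCCA (hθ n).subGaussian _), l2norm_sq]
    exact (Population.form_inX_bounds (hθ n).eigX _).2
  refine (h1.add h2).congr_left fun n => ?_
  simp

include hθ hb in
theorem isBigO_sampleForm_inY {u : ∀ n, Fin (q n) → ℝ} (hu : (fun n => l1norm (u n)) =O[l] g)
    (hu2 : (fun n => l2norm (u n)) =O[l] rt) :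
    (fun n => sampleForm (z n) (inY (u n)) (inY (u n))) =O[l] fun n => rt n ^ 2 := by
  have h1 := isBigO_dev_self hθ hb (u := fun n => inY (u n)) (by simpa [l1norm_inY] using hu)
  have h2 : (fun n => (θ n).form (inY (u n)) (inY (u n))) =O[l] fun n => rt n ^ 2 := by
    refine isBigO_of_abs_le (fun n => ?_) ((hu2.pow 2).const_mul_left M)
    rw [abs_of_nonneg (Population.form_self_nonneg (hθ n).isCCA (hθ n).subGaussian _), l2norm_sq]
    exact (Population.form_inY_bounds (hθ n).eigY _).2
  refine (h1.add h2).congr_left fun n => ?_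
  simp

include hθ hε₀ hM in
theorem isBigO_form_ref_self (c : Fin 4) :
    (fun n => (θ n).form ((θ n).refVec (i n) c) ((θ n).refVec (i n) c)) =O[l]
      fun _ => (1 : ℝ) := by
  have hgap : ∀ n, (θ n).corr₂ < (θ n).rho := fun n => by linarith [(hθ n).gap]
  have key : ∀ n, (θ n).form ((θ n).refVec (i n) c) ((θ n).refVec (i n) c) ≤
      max 1 (M * (M / (2 * ε₀)) ^ 2) := fun n => by
    have hφ := Population.phi_bound (hθ n).isCCA (hθ n).subGaussian (hgap n) hM (hθ n).eigX
      (hθ n).eigY (i n) hε₀ (hθ n).gap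
    fin_cases c
    · exact (Population.form_α_α (hθ n).isCCA).le.trans (le_max_left _ _)
    · exact (Population.form_β_β (hθ n).isCCA).le.trans (le_max_left _ _)
    · exact ((Population.form_inX_bounds (hθ n).eigX _).2.trans
        (mul_le_mul_of_nonneg_left hφ.1 hM.le)).trans (le_max_right _ _)
    · exact ((Population.form_inY_bounds (hθ n).eigY _).2.trans
        (mul_le_mul_of_nonneg_left hφ.2 hM.le)).trans (le_max_right _ _)
  refine isBigO_one_of_abs_le (c := max 1 (M * (M / (2 * ε₀)) ^ 2)) fun n => ?_
  rw [abs_of_nonneg (Population.form_self_nonneg (hθ n).isCCA (hθ n).subGaussian _)]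
  exact key n

include hθ hε₀ hM in
theorem isBigO_form_ref_ref (c c' : Fin 4) :
    (fun n => (θ n).form ((θ n).refVec (i n) c) ((θ n).refVec (i n) c')) =O[l]
      fun _ => (1 : ℝ) := by
  have h1 := isBigO_form_ref_self (l := l) (i := i) hθ hε₀ hM c
  have h2 := isBigO_form_ref_self (l := l) (i := i) hθ hε₀ hM c'
  have := isBigO_of_sq_le_mul (l := l) (f := fun _ => 1) (g := fun _ => 1) (fun n =>
    Population.form_sq_le (hθ n).isCCA (hθ n).subGaussian ((θ n).refVec (i n) c)
      ((θ n).refVec (i n) c')) (by simpa using h1) (by simpa using h2)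
  simpa using this

include hθ hε₀ hM hb in
theorem isBigO_sampleForm_ref (c : Fin 4) :
    (fun n => sampleForm (z n) ((θ n).refVec (i n) c) ((θ n).refVec (i n) c)) =O[l]
      fun _ => (1 : ℝ) := by
  have h1 := (isBigO_dev_ref_ref hb c c).trans (hb.m_rt.trans (hb.rt_zero.isBigO_one ℝ))
  refine (h1.add (isBigO_form_ref_self (i := i) hθ hε₀ hM c)).congr_left fun n => ?_
  simp

/-- The signs at which the preliminary estimators attain their errors. -/
structure IsSign (l : Filter ℕ) (θ : ∀ n, Population r (p n) (q n)) (a : ∀ n, Fin (p n) → ℝ)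
    (b : ∀ n, Fin (q n) → ℝ) (rt g w w' : ℕ → ℝ) : Prop where
  sq_left : ∀ n, w n ^ 2 = 1
  sq_right : ∀ n, w' n ^ 2 = 1
  l1_left : (fun n => l1norm (w n • a n - (θ n).α)) =O[l] g
  l2_left : (fun n => l2norm (w n • a n - (θ n).α)) =O[l] rt
  l1_right : (fun n => l1norm (w' n • b n - (θ n).β)) =O[l] g
  l2_right : (fun n => l2norm (w' n • b n - (θ n).β)) =O[l] rt

/-- The alternative in `exists_sign` would keep the two errors together above `2 ‖α‖₂ ≥ 2 M^(-1/2)`,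
which fails eventually because both tend to zero. A single sign then serves both norms. -/
theorem exists_sign_seq {d : ℕ → ℕ} {a α : ∀ n, Fin (d n) → ℝ} {M : ℝ} (hM : 0 < M)
    (hα : ∀ n, 1 ≤ M * (α n ⬝ᵥ α n)) {rt g : ℕ → ℝ} (hrt : Tendsto rt l (𝓝 0))
    (hg : Tendsto g l (𝓝 0)) (h1 : (fun n => signErr1 (a n) (α n)) =O[l] g)
    (h2 : (fun n => signErr2 (a n) (α n)) =O[l] rt) : ∃ w : ℕ → ℝ, (∀ n, w n ^ 2 = 1) ∧
      (fun n => l1norm (w n • a n - α n)) =O[l] g ∧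
      (fun n => l2norm (w n • a n - α n)) =O[l] rt := by
  choose w hw hw2 hw1 using fun n => exists_sign (a n) (α n)
  refine ⟨w, hw, h1.congr' ?_ EventuallyEq.rfl, h2.congr_left fun n => (hw2 n).symm⟩
  have hlim : Tendsto (fun n => signErr1 (a n) (α n) + signErr2 (a n) (α n)) l (𝓝 0) := by
    simpa using (h1.trans_tendsto hg).add (h2.trans_tendsto hrt)
  have hpos : 0 < 2 * (√M)⁻¹ := by have := Real.sqrt_pos.2 hM; positivity
  filter_upwards [(tendsto_order.1 hlim).2 _ hpos] with n hn
  refine ((hw1 n).resolve_right fun hcon => ?_).symm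
  have h3 : (√M)⁻¹ ≤ l2norm (α n) := by
    rw [← Real.sqrt_inv]
    refine Real.sqrt_le_iff.2 ⟨l2norm_nonneg _, ?_⟩
    rw [l2norm_sq, inv_le_iff_one_le_mul₀ hM, mul_comm]
    exact hα n
  linarith

include hθ hM hb in
theorem exists_isSign : ∃ w w', IsSign l θ a b rt g w w' := by
  have nn1 : ∀ {d : ℕ} (x y : Fin d → ℝ), 0 ≤ signErr1 x y := fun x y =>
    le_min (l1norm_nonneg _) (l1norm_nonneg _)
  have nn2 : ∀ {d : ℕ} (x y : Fin d → ℝ), 0 ≤ signErr2 x y := fun x y =>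
    le_min (l2norm_nonneg _) (l2norm_nonneg _)
  obtain ⟨w, h1, h2, h3⟩ := exists_sign_seq (l := l) (a := a) (α := fun n => (θ n).α) hM
    (fun n => (Population.one_le_mul_α (hθ n).isCCA hM (hθ n).eigX).1) hb.rt_zero hb.g_zero
    (isBigO_of_abs_le (fun n => by
      rw [abs_of_nonneg (nn1 _ _)]; linarith [nn1 (b n) (θ n).β]) hb.err1)
    (isBigO_of_abs_le (fun n => by
      rw [abs_of_nonneg (nn2 _ _)]; linarith [nn2 (b n) (θ n).β]) hb.err2)
  obtain ⟨w', h1', h2', h3'⟩ := exists_sign_seq (l := l) (a := b) (α := fun n => (θ n).β) hM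
    (fun n => (Population.one_le_mul_β (hθ n).isCCA hM (hθ n).eigY).1) hb.rt_zero hb.g_zero
    (isBigO_of_abs_le (fun n => by
      rw [abs_of_nonneg (nn1 _ _)]; linarith [nn1 (a n) (θ n).α]) hb.err1)
    (isBigO_of_abs_le (fun n => by
      rw [abs_of_nonneg (nn2 _ _)]; linarith [nn2 (a n) (θ n).α]) hb.err2)
  exact ⟨w, w', h1, h1', h2, h3, h2', h3'⟩

variable {w w' : ℕ → ℝ} (hw : IsSign l θ a b rt g w w')

include hθ hε₀ hM hb hw in
/-- The estimate of `√ρ`, and the agreement of the signs. -/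
theorem hatRho_path :
    (fun n => √|hatRho (z n) (a n) (b n)| - √(θ n).rho) =O[l] rt ∧ ∀ᶠ n in l, w' n = w n := by
  set da : ∀ n, Fin (p n) → ℝ := fun n => w n • a n - (θ n).α with hda
  set db : ∀ n, Fin (q n) → ℝ := fun n => w' n • b n - (θ n).β with hdb
  have ca : (fun n => sampleForm (z n) (inX (da n)) (inX (da n))) =O[l] fun n => rt n ^ 2 :=
    isBigO_sampleForm_inX hθ hb hw.l1_left hw.l2_left
  have cb : (fun n => sampleForm (z n) (inY (db n)) (inY (db n))) =O[l] fun n => rt n ^ 2 :=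
    isBigO_sampleForm_inY hθ hb hw.l1_right hw.l2_right
  have cα : (fun n => sampleForm (z n) (inX (θ n).α) (inX (θ n).α)) =O[l] fun _ => (1 : ℝ) ^ 2 := by
    simpa [Population.refVec] using isBigO_sampleForm_ref hθ hε₀ hM hb 0
  have cβ : (fun n => sampleForm (z n) (inY (θ n).β) (inY (θ n).β)) =O[l] fun _ => (1 : ℝ) ^ 2 := by
    simpa [Population.refVec] using isBigO_sampleForm_ref hθ hε₀ hM hb 1
  have x1 : (fun n => sampleForm (z n) (inX (da n)) (inX (θ n).α)) =O[l] rt := by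
    simpa using isBigO_of_sq_le_mul (fun n => sampleForm_sq_le (z n) _ _) ca cα
  have x2 : (fun n => sampleForm (z n) (inY (db n)) (inY (θ n).β)) =O[l] rt := by
    simpa using isBigO_of_sq_le_mul (fun n => sampleForm_sq_le (z n) _ _) cb cβ
  have x3 : (fun n => sampleForm (z n) (inX (da n)) (inY (θ n).β)) =O[l] rt := by
    simpa using isBigO_of_sq_le_mul (fun n => sampleForm_sq_le (z n) _ _) ca cβ
  have x4 : (fun n => sampleForm (z n) (inX (θ n).α) (inY (db n))) =O[l] rt := by
    simpa using isBigO_of_sq_le_mul (fun n => sampleForm_sq_le (z n) _ _) cα cb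
  have x5 : (fun n => sampleForm (z n) (inX (da n)) (inY (db n))) =O[l] fun n => rt n ^ 2 := by
    simpa [sq] using isBigO_of_sq_le_mul (fun n => sampleForm_sq_le (z n) _ _) ca cb
  have rr : (fun n => rt n ^ 2) =O[l] rt := by
    simpa [sq] using (hb.rt_zero.isBigO_one ℝ).mul (isBigO_refl rt l)
  have dαα := (isBigO_dev_ref_ref hb 0 0).trans hb.m_rt
  have dββ := (isBigO_dev_ref_ref hb 1 1).trans hb.m_rt
  have dαβ := (isBigO_dev_ref_ref hb 0 1).trans hb.m_rt
  have ea : ∀ n, w n • a n = (θ n).α + da n := fun n => by rw [hda]; simp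
  have eb : ∀ n, w' n • b n = (θ n).β + db n := fun n => by rw [hdb]; simp
  have hA : (fun n => sampleForm (z n) (inX (w n • a n)) (inX (w n • a n)) - 1) =O[l] rt := by
    refine ((dαα.add (x1.const_mul_left 2)).add (ca.trans rr)).congr_left fun n => ?_
    rw [ea]
    simp only [map_add, LinearMap.add_apply, LinearMap.sub_apply, Population.refVec,
      Matrix.cons_val_zero, Population.form_α_α (hθ n).isCCA,
      sampleForm_comm (z n) (inX (θ n).α) (inX (da n))]
    ring
  have hC : (fun n => sampleForm (z n) (inY (w' n • b n)) (inY (w' n • b n)) - 1) =O[l] rt := by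
    refine ((dββ.add (x2.const_mul_left 2)).add (cb.trans rr)).congr_left fun n => ?_
    rw [eb]
    simp only [map_add, LinearMap.add_apply, LinearMap.sub_apply, Population.refVec,
      Matrix.cons_val_one, Matrix.cons_val_zero, Population.form_β_β (hθ n).isCCA,
      sampleForm_comm (z n) (inY (θ n).β) (inY (db n))]
    ring
  have hN : (fun n => sampleForm (z n) (inX (w n • a n)) (inY (w' n • b n)) - (θ n).rho)
      =O[l] rt := by
    refine (((dαβ.add x3).add x4).add (x5.trans rr)).congr_left fun n => ?_
    rw [ea, eb]
    simp only [map_add, LinearMap.add_apply, LinearMap.sub_apply, Population.refVec,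
      Matrix.cons_val_one, Matrix.cons_val_zero, Population.form_α_β]
    ring
  have hρ : ∀ n, ε₀ ≤ (θ n).rho := fun n => by
    linarith [(hθ n).gap, Population.corr₂_nonneg (hθ n).isCCA]
  have hρ1 : ∀ n, (θ n).rho ≤ 1 := fun n =>
    Population.rho_le_one (hθ n).isCCA (hθ n).subGaussian
  have sA : ∀ n, sampleForm (z n) (inX (w n • a n)) (inX (w n • a n)) =
      sampleForm (z n) (inX (a n)) (inX (a n)) := fun n => by
    simp only [map_smul, LinearMap.smul_apply, smul_eq_mul]
    rw [← mul_assoc, ← sq, hw.sq_left, one_mul]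
  have sC : ∀ n, sampleForm (z n) (inY (w' n • b n)) (inY (w' n • b n)) =
      sampleForm (z n) (inY (b n)) (inY (b n)) := fun n => by
    simp only [map_smul, LinearMap.smul_apply, smul_eq_mul]
    rw [← mul_assoc, ← sq, hw.sq_right, one_mul]
  have sN : ∀ n, sampleForm (z n) (inX (w n • a n)) (inY (w' n • b n)) =
      w n * w' n * sampleForm (z n) (inX (a n)) (inY (b n)) := fun n => by
    simp only [map_smul, LinearMap.smul_apply, smul_eq_mul]
    ring
  have pos : ∀ {f : ℕ → ℝ}, (fun n => f n - 1) =O[l] rt → ∀ᶠ n in l, 0 < f n := fun hf => by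
    have := (hf.trans_tendsto hb.rt_zero).add_const 1
    simp only [sub_add_cancel, zero_add] at this
    exact (tendsto_order.1 this).1 0 one_pos
  have posA := pos hA
  have posC := pos hC
  have posN : ∀ᶠ n in l, 0 < sampleForm (z n) (inX (w n • a n)) (inY (w' n • b n)) := by
    filter_upwards [(tendsto_order.1 (hN.trans_tendsto hb.rt_zero)).1 (-ε₀) (by linarith)] with n hn
    linarith [hρ n]
  have hu : ∀ᶠ n in l, hatRho (z n) (a n) (b n) ^ 2 *
      (sampleForm (z n) (inX (w n • a n)) (inX (w n • a n)) *
        sampleForm (z n) (inY (w' n • b n)) (inY (w' n • b n))) =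
      sampleForm (z n) (inX (w n • a n)) (inY (w' n • b n)) ^ 2 := by
    filter_upwards [posA, posC] with n h1 h2
    rw [hatRho_eq, sN, mul_pow, mul_pow, hw.sq_left, hw.sq_right, one_mul, one_mul]
    rw [sA] at h1 ⊢
    rw [sC] at h2 ⊢
    rw [div_pow, mul_pow, Real.sq_sqrt h1.le, Real.sq_sqrt h2.le]
    field_simp
  refine ⟨isBigO_sqrt_abs_sub hε₀ hρ hρ1 hb.rt_zero hA hC hN hu, ?_⟩
  -- The sign-corrected cross moment `w w' C(a, b)` is positive, being close to `ρ`. The sign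
  -- convention gives `|ρ̂| C(a, b) ≥ 0` with `|ρ̂| > 0`, so `C(a, b) ≥ 0` and therefore `w w' = 1`.
  filter_upwards [posA, posC, posN, hu, hb.sign] with n h1 h2 h3 h4 h5
  rw [hatX_dotProduct_hatY] at h5
  have h6 : 0 < |hatRho (z n) (a n) (b n)| := by
    refine abs_pos.2 fun h0 => ?_
    rw [h0] at h4
    have : 0 < sampleForm (z n) (inX (w n • a n)) (inY (w' n • b n)) ^ 2 := by positivity
    rw [← h4] at this
    simp at this
  have h7 : 0 ≤ sampleForm (z n) (inX (a n)) (inY (b n)) := by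
    by_contra hcon
    exact absurd h5 (not_le.2 (mul_neg_of_pos_of_neg h6 (not_le.1 hcon)))
  rw [sN] at h3
  have h8 : 0 < w n * w' n := by
    by_contra hcon
    exact absurd h3 (not_lt.2 (mul_nonpos_of_nonpos_of_nonneg (not_lt.1 hcon) h7))
  have h9 := hw.sq_left n
  have h10 := hw.sq_right n
  rw [sq, mul_self_eq_one_iff] at h9 h10
  rcases h9 with h | h <;> rcases h10 with h' | h' <;> rw [h, h'] at h8 ⊢ <;> norm_num at h8

end Path

/-! ### Linearisation of the de-biased estimator -/

section Path

variable {r : ℕ} {p q : ℕ → ℕ} {l : Filter ℕ} {θ : ∀ n, Population r (p n) (q n)}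
  {i : ∀ n, Fin (p n)} {z : ∀ n, Fin n → (Fin (p n) → ℝ) × (Fin (q n) → ℝ)}
  {a : ∀ n, Fin (p n) → ℝ} {b : ∀ n, Fin (q n) → ℝ}
  {Φ : ∀ n, Matrix (Fin (p n) ⊕ Fin (q n)) (Fin (p n) ⊕ Fin (q n)) ℝ} {rt g lm m : ℕ → ℝ}
  {K : ℝ≥0} {ε₀ M : ℝ} (hθ : ∀ n, (θ n).Regular K ε₀ M) (hε₀ : 0 < ε₀) (hM : 0 < M)
  (hb : PathBounds l θ i z a b Φ rt g lm m)

theorem Population.Regular.gap_lt {r p q : ℕ} {θ : Population r p q} (h : θ.Regular K ε₀ M)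
    (hε₀ : 0 < ε₀) : θ.corr₂ < θ.rho := by linarith [h.gap]

theorem Population.Regular.rho_pos {r p q : ℕ} {θ : Population r p q} (h : θ.Regular K ε₀ M)
    (hε₀ : 0 < ε₀) : 0 < θ.rho :=
  Population.rho_pos h.isCCA (h.gap_lt hε₀)

include hθ in
theorem isBigO_sqrt_rho : (fun n => √(θ n).rho) =O[l] fun _ => (1 : ℝ) :=
  isBigO_one_of_abs_le (c := 1) fun n => by
    rw [abs_of_nonneg (Real.sqrt_nonneg _)]
    exact Real.sqrt_le_one.2 (Population.rho_le_one (hθ n).isCCA (hθ n).subGaussian)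

include hθ hε₀ hM hb in
/-- `isBigO_gradient_expansion` at multiples of the reference vectors. -/
theorem isBigO_gradient_block (c₁ c₂ c₃ : Fin 4) {d e f : ∀ n, Fin (p n) ⊕ Fin (q n) → ℝ}
    (hd : (fun n => l1norm (d n)) =O[l] g) (he : (fun n => l1norm (e n)) =O[l] g)
    (hf : (fun n => l1norm (f n)) =O[l] g)
    (hd' : (fun n => sampleForm (z n) (d n) (d n)) =O[l] fun n => rt n ^ 2)
    (he' : (fun n => sampleForm (z n) (e n) (e n)) =O[l] fun n => rt n ^ 2)
    (hf' : (fun n => sampleForm (z n) (f n) (f n)) =O[l] fun n => rt n ^ 2)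
    (h1 : ∀ n, (θ n).form ((θ n).refVec (i n) c₁) ((θ n).refVec (i n) c₁) = 1)
    (h2 : ∀ n, (θ n).form ((θ n).refVec (i n) c₃) ((θ n).refVec (i n) c₂) =
      (θ n).rho * (θ n).form ((θ n).refVec (i n) c₃) ((θ n).refVec (i n) c₁))
    (h3 : ∀ n, (θ n).form (f n) ((θ n).refVec (i n) c₂) =
      (θ n).rho * (θ n).form (f n) ((θ n).refVec (i n) c₁))
    {x y φ : ∀ n, Fin (p n) ⊕ Fin (q n) → ℝ}
    (hx : ∀ n, x n = √(θ n).rho • (θ n).refVec (i n) c₁)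
    (hy : ∀ n, y n = √(θ n).rho • (θ n).refVec (i n) c₂)
    (hφ : ∀ n, φ n = (θ n).refVec (i n) c₃) :
    (fun n => 2 * (θ n).rho * (θ n).form (φ n) (d n) +
        4 * ((θ n).form (φ n) (x n) * (θ n).form (x n) (d n)) - 2 * (θ n).form (φ n) (e n) -
        (2 * sampleForm (z n) (x n + d n) (x n + d n) * sampleForm (z n) (φ n + f n) (x n + d n) -
          2 * sampleForm (z n) (φ n + f n) (y n + e n)) +
        2 * ((θ n).rho * (sampleForm (z n) - (θ n).form) (φ n) (x n) +
          (θ n).form (φ n) (x n) * (sampleForm (z n) - (θ n).form) (x n) (x n) -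
          (sampleForm (z n) - (θ n).form) (φ n) (y n))) =O[l] fun n => rt n ^ 2 := by
  have hs := isBigO_sqrt_rho (l := l) hθ
  have one : ∀ {u : ℕ → ℝ} {v : ℕ → ℝ}, u =O[l] v →
      (fun n => √(θ n).rho * u n) =O[l] v := fun hu => by simpa using hs.mul hu
  have hmul : ∀ n, √(θ n).rho * √(θ n).rho = (θ n).rho := fun n =>
    Real.mul_self_sqrt ((hθ n).rho_pos hε₀).le
  refine isBigO_gradient_expansion (fun n => sampleForm_comm (z n))
    (fun n => sampleForm_sq_le (z n)) (fun n => ?_) (fun n => ?_) (fun n => ?_)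
    (hb.rt_zero.isBigO_one ℝ) ?_ ?_ ?_ ?_ ?_ ?_ hf' hd' he' ?_ ?_ ?_ ?_ ?_
  · rw [hx]
    simp only [map_smul, LinearMap.smul_apply, smul_eq_mul, h1, mul_one, hmul]
  · rw [hx, hy, hφ]
    simp only [map_smul, smul_eq_mul, h2]
    ring
  · rw [hx, hy]
    simp only [map_smul, smul_eq_mul, h3]
    ring
  · exact (one hs).congr_left hmul
  · refine (isBigO_dev_ref hb hd c₃).congr_left fun n => ?_
    rw [hφ, dev_comm hθ]
  · refine (isBigO_dev_ref hb he c₃).congr_left fun n => ?_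
    rw [hφ, dev_comm hθ]
  · refine (one (isBigO_dev_ref hb hf c₁)).congr_left fun n => ?_
    rw [hx, map_smul, smul_eq_mul]
  · refine (one (isBigO_dev_ref hb hf c₂)).congr_left fun n => ?_
    rw [hy, map_smul, smul_eq_mul]
  · refine (one (isBigO_dev_ref hb hd c₁)).congr_left fun n => ?_
    rw [dev_comm hθ, hx, map_smul, LinearMap.smul_apply, smul_eq_mul]
  · refine (one (one (isBigO_sampleForm_ref hθ hε₀ hM hb c₁))).congr_left fun n => ?_
    rw [hx]
    simp only [map_smul, LinearMap.smul_apply, smul_eq_mul]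
  · refine (isBigO_sampleForm_ref hθ hε₀ hM hb c₃).congr_left fun n => ?_
    rw [hφ]
  · refine (one (isBigO_form_ref_ref (i := i) hθ hε₀ hM c₃ c₁)).congr_left fun n => ?_
    rw [hφ, hx, map_smul, smul_eq_mul]
  · refine (one (one ((isBigO_dev_ref_ref hb c₁ c₁).trans hb.m_rt))).congr_left fun n => ?_
    rw [hx]
    simp only [map_smul, LinearMap.smul_apply, smul_eq_mul]
  · refine (one ((isBigO_dev_ref_ref hb c₃ c₁).trans hb.m_rt)).congr_left fun n => ?_
    rw [hφ, hx, map_smul, smul_eq_mul]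

include hθ hε₀ hM hb in
-- Only the four reference vectors occur in the leading term, so it has the rate `m` of finitely
-- many deviations, not the larger rate of the whole family.
theorem isBigO_leading : (fun n => (θ n).leading (z n) (i n)) =O[l] m := by
  have hs := isBigO_sqrt_rho (l := l) hθ
  have one : ∀ {u v w : ℕ → ℝ}, v =O[l] (fun _ => (1 : ℝ)) → u =O[l] w →
      (fun n => v n * u n) =O[l] w := fun hv hu => by simpa using hv.mul hu
  have hρ : (fun n => (θ n).rho) =O[l] fun _ => (1 : ℝ) :=
    (one hs hs).congr_left fun n => Real.mul_self_sqrt ((hθ n).rho_pos hε₀).le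
  have D := isBigO_dev_ref_ref hb
  have F := isBigO_form_ref_ref (l := l) (i := i) hθ hε₀ hM
  have t1 := (one hρ (one hs (D 2 0))).add (one (one hs (F 2 0)) (one hs (one hs (D 0 0))))
  have t2 := (one hρ (one hs (D 3 1))).add (one (one hs (F 3 1)) (one hs (one hs (D 1 1))))
  refine (((t1.sub (one hs (D 2 1))).const_mul_left 2).add
    ((t2.sub (one hs (D 3 0))).const_mul_left 2)).congr_left fun n => ?_
  simp only [Population.leading, Population.x0, Population.y0, map_smul, LinearMap.smul_apply,
    smul_eq_mul]
  rfl

theorem isBigO_form_add {n₀ : ℕ → ℕ} {u v : ∀ n, Fin (p n) ⊕ Fin (q n) → ℝ}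
    {z : ∀ n, Fin (n₀ n) → (Fin (p n) → ℝ) × (Fin (q n) → ℝ)}
    (hu : (fun n => sampleForm (z n) (u n) (u n)) =O[l] fun n => rt n ^ 2)
    (hv : (fun n => sampleForm (z n) (v n) (v n)) =O[l] fun n => rt n ^ 2) :
    (fun n => sampleForm (z n) (u n + v n) (u n + v n)) =O[l] fun n => rt n ^ 2 := by
  have h : (fun n => sampleForm (z n) (u n) (v n)) =O[l] fun n => rt n ^ 2 := by
    simpa [sq] using isBigO_of_sq_le_mul (fun n => sampleForm_sq_le (z n) _ _) hu hv
  refine ((hu.add hv).add (h.const_mul_left 2)).congr_left fun n => ?_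
  simp only [map_add, LinearMap.add_apply, sampleForm_comm (z n) (v n) (u n)]
  ring

include hb in
/-- Passing from the error of the direction to that of the scaled direction. -/
theorem isBigO_scaled {d α : ∀ n, Fin (p n) ⊕ Fin (q n) → ℝ} {u v : ℕ → ℝ}
    (huv : (fun n => u n - v n) =O[l] rt) (hv : v =O[l] fun _ => (1 : ℝ))
    (hα : ∀ n, l1norm (α n) ^ 2 ≤ (θ n).s * M)
    (hα' : (fun n => sampleForm (z n) (α n) (α n)) =O[l] fun _ => (1 : ℝ))
    (hd : (fun n => l1norm (d n)) =O[l] g)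
    (hd' : (fun n => sampleForm (z n) (d n) (d n)) =O[l] fun n => rt n ^ 2) :
    (fun n => l1norm (u n • d n + (u n - v n) • α n)) =O[l] g ∧
    (fun n => sampleForm (z n) (u n • d n + (u n - v n) • α n)
      (u n • d n + (u n - v n) • α n)) =O[l] fun n => rt n ^ 2 := by
  have hu : u =O[l] fun _ => (1 : ℝ) := by
    simpa using (huv.trans (hb.rt_zero.isBigO_one ℝ)).add hv
  -- The scale error `u - v` has order `rt`; multiplied by an `ℓ¹` norm of order `√s` it has order
  -- `g`, like the error of the direction itself.
  have hα1 : (fun n => l1norm (α n)) =O[l] fun n => √((θ n).s : ℝ) := by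
    refine IsBigO.of_pow (n := 2) (by norm_num) ?_
    refine isBigO_of_abs_le (g := fun n => (θ n).s * M) (fun n => ?_) ?_
    · simpa using hα n
    · refine (isBigO_refl (fun n => √((θ n).s : ℝ) ^ 2) l).const_mul_left M |>.congr_left
        fun n => ?_
      rw [Real.sq_sqrt (Nat.cast_nonneg _), mul_comm]
  constructor
  · have t1 : (fun n => |u n| * l1norm (d n)) =O[l] g := by
      simpa using hu.abs_left.mul hd
    have t2 : (fun n => |u n - v n| * l1norm (α n)) =O[l] g :=
      ((huv.abs_left.mul hα1).congr_right fun n => mul_comm _ _).trans hb.sqrt_s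
    refine isBigO_of_abs_le (fun n => ?_) (t1.add t2)
    rw [abs_of_nonneg (l1norm_nonneg _), ← l1norm_smul, ← l1norm_smul]
    exact l1norm_add_le _ _
  · refine isBigO_form_add (n₀ := id) ?_ ?_
    · have : (fun n => u n * (u n * sampleForm (z n) (d n) (d n))) =O[l] fun n => rt n ^ 2 := by
        simpa using hu.mul (hu.mul hd')
      exact this.congr_left fun n => by simp
    · have : (fun n => (u n - v n) * ((u n - v n) * sampleForm (z n) (α n) (α n))) =O[l]
          fun n => rt n ^ 2 := by
        simpa [sq] using huv.mul (huv.mul hα')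
      exact this.congr_left fun n => by simp

theorem l2norm_comp_le {ι ι' : Type*} [Fintype ι] [Fintype ι'] {e : ι' → ι}
    (he : Function.Injective e) (v : ι → ℝ) : l2norm (fun k => v (e k)) ≤ l2norm v := by
  classical
  refine Real.sqrt_le_sqrt ?_
  rw [← Finset.sum_image (f := fun k => v k ^ 2) (g := e) (s := Finset.univ)
    fun x _ y _ h => he h]
  exact Finset.sum_le_sum_of_subset_of_nonneg (Finset.subset_univ _) fun _ _ _ => sq_nonneg _

theorem l1norm_comp_le {ι ι' : Type*} [Fintype ι] [Fintype ι'] {e : ι' → ι}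
    (he : Function.Injective e) (v : ι → ℝ) : l1norm (fun k => v (e k)) ≤ l1norm v := by
  classical
  unfold l1norm
  rw [← Finset.sum_image (f := fun k => |v k|) (g := e) (s := Finset.univ)
    fun x _ y _ h => he h]
  exact Finset.sum_le_sum_of_subset_of_nonneg (Finset.subset_univ _) fun _ _ _ => abs_nonneg _

include hθ hε₀ hM hb in
/-- The de-biased estimator, up to sign, is linear in the deviations of the sample form. -/
theorem exists_sign_debiasedX : ∃ w : ℕ → ℝ, (∀ n, w n ^ 2 = 1) ∧
    (fun n => w n * debiasedX (z n) (a n) (b n) (Φ n) (i n) - (θ n).x0 (i n) +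
      (θ n).leading (z n) (i n)) =O[l] fun n => rt n ^ 2 := by
  obtain ⟨w, w', hw⟩ := exists_isSign hθ hM hb
  obtain ⟨hu, hww⟩ := hatRho_path hθ hε₀ hM hb hw
  refine ⟨w, hw.sq_left, ?_⟩
  have hs := isBigO_sqrt_rho (l := l) hθ
  set u : ℕ → ℝ := fun n => √|hatRho (z n) (a n) (b n)| with hu_def
  set v : ℕ → ℝ := fun n => √(θ n).rho with hv_def
  -- Chosen so that `x⁰ + dx = w x̂`: the error splits into that of the direction, times the
  -- estimated scale, and that of the scale, times `α`.
  set dx : ∀ n, Fin (p n) → ℝ := fun n =>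
    u n • (w n • a n - (θ n).α) + (u n - v n) • (θ n).α with hdx
  set dy : ∀ n, Fin (q n) → ℝ := fun n =>
    u n • (w' n • b n - (θ n).β) + (u n - v n) • (θ n).β with hdy
  set fx : ∀ n, Fin (p n) → ℝ := fun n k =>
    Φ n (Sum.inl k) (Sum.inl (i n)) - (θ n).Phi0 (Sum.inl k) (Sum.inl (i n)) with hfx
  set fy : ∀ n, Fin (q n) → ℝ := fun n k =>
    Φ n (Sum.inr k) (Sum.inl (i n)) - (θ n).Phi0 (Sum.inr k) (Sum.inl (i n)) with hfy
  have hα : ∀ n, l1norm (inX (θ n).α : Fin (p n) ⊕ Fin (q n) → ℝ) ^ 2 ≤ (θ n).s * M := fun n => by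
    rw [l1norm_inX]
    exact Population.l1norm_α_sq_le (hθ n).isCCA (hθ n).subGaussian ((hθ n).gap_lt hε₀) hM
      (hθ n).eigX
  have hβ : ∀ n, l1norm (inY (θ n).β : Fin (p n) ⊕ Fin (q n) → ℝ) ^ 2 ≤ (θ n).s * M := fun n => by
    rw [l1norm_inY]
    exact Population.l1norm_β_sq_le (hθ n).isCCA (hθ n).subGaussian ((hθ n).gap_lt hε₀) hM
      (hθ n).eigY
  obtain ⟨dx1, dx2⟩ := isBigO_scaled hb hu hs hα (isBigO_sampleForm_ref hθ hε₀ hM hb 0)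
    (d := fun n => inX (w n • a n - (θ n).α)) (by simpa only [l1norm_inX] using hw.l1_left)
    (isBigO_sampleForm_inX hθ hb hw.l1_left hw.l2_left)
  obtain ⟨dy1, dy2⟩ := isBigO_scaled hb hu hs hβ (isBigO_sampleForm_ref hθ hε₀ hM hb 1)
    (d := fun n => inY (w' n • b n - (θ n).β)) (by simpa only [l1norm_inY] using hw.l1_right)
    (isBigO_sampleForm_inY hθ hb hw.l1_right hw.l2_right)
  have edx : ∀ n, (u n • inX (w n • a n - (θ n).α) + (u n - v n) • inX (θ n).α :
      Fin (p n) ⊕ Fin (q n) → ℝ) = inX (dx n) := fun n => by simp only [hdx, map_add, map_smul]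
  have edy : ∀ n, (u n • inY (w' n • b n - (θ n).β) + (u n - v n) • inY (θ n).β :
      Fin (p n) ⊕ Fin (q n) → ℝ) = inY (dy n) := fun n => by simp only [hdy, map_add, map_smul]
  replace dx1 : (fun n => l1norm (inX (dx n) : Fin (p n) ⊕ Fin (q n) → ℝ)) =O[l] g :=
    dx1.congr_left fun n => by rw [← edx]
  replace dx2 : (fun n => sampleForm (z n) (inX (dx n)) (inX (dx n))) =O[l] fun n => rt n ^ 2 :=
    dx2.congr_left fun n => by rw [← edx]
  replace dy1 : (fun n => l1norm (inY (dy n) : Fin (p n) ⊕ Fin (q n) → ℝ)) =O[l] g :=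
    dy1.congr_left fun n => by rw [← edy]
  replace dy2 : (fun n => sampleForm (z n) (inY (dy n)) (inY (dy n))) =O[l] fun n => rt n ^ 2 :=
    dy2.congr_left fun n => by rw [← edy]
  have col1 : ∀ n, l1norm (fun k => Φ n k (Sum.inl (i n)) - (θ n).Phi0 k (Sum.inl (i n))) ≤
      maxColErr1 (Φ n) (θ n).Phi0 := fun n =>
    le_ciSup (f := fun j => l1norm fun k => Φ n k j - (θ n).Phi0 k j)
      (Set.finite_range _).bddAbove _
  have col2 : ∀ n, l2norm (fun k => Φ n k (Sum.inl (i n)) - (θ n).Phi0 k (Sum.inl (i n))) ≤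
      maxColErr2 (Φ n) (θ n).Phi0 := fun n =>
    le_ciSup (f := fun j => l2norm fun k => Φ n k j - (θ n).Phi0 k j)
      (Set.finite_range _).bddAbove _
  have fx1 : (fun n => l1norm (fx n)) =O[l] g := isBigO_of_abs_le (fun n => by
    rw [abs_of_nonneg (l1norm_nonneg _)]
    exact (l1norm_comp_le Sum.inl_injective _).trans (col1 n)) hb.phi1
  have fy1 : (fun n => l1norm (fy n)) =O[l] g := isBigO_of_abs_le (fun n => by
    rw [abs_of_nonneg (l1norm_nonneg _)]
    exact (l1norm_comp_le Sum.inr_injective _).trans (col1 n)) hb.phi1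
  have fx2 : (fun n => l2norm (fx n)) =O[l] rt := isBigO_of_abs_le (fun n => by
    rw [abs_of_nonneg (l2norm_nonneg _)]
    exact (l2norm_comp_le Sum.inl_injective _).trans (col2 n)) hb.phi2
  have fy2 : (fun n => l2norm (fy n)) =O[l] rt := isBigO_of_abs_le (fun n => by
    rw [abs_of_nonneg (l2norm_nonneg _)]
    exact (l2norm_comp_le Sum.inr_injective _).trans (col2 n)) hb.phi2
  have fX : ∀ n (c : Fin (p n) → ℝ), (θ n).form (inX c) (inY (θ n).β) =
      (θ n).rho * (θ n).form (inX c) (inX (θ n).α) := fun n c =>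
    Population.form_inX_β (hθ n).isCCA (hθ n).subGaussian ((hθ n).rho_pos hε₀) c
  have comm : ∀ n u v, (θ n).form u v = (θ n).form v u := fun n =>
    Population.form_comm (hθ n).isCCA (hθ n).subGaussian
  have fY : ∀ n (c : Fin (q n) → ℝ), (θ n).form (inY c) (inX (θ n).α) =
      (θ n).rho * (θ n).form (inY c) (inY (θ n).β) := fun n c => by
    rw [comm, comm n (inY c)]
    exact Population.form_α_inY (hθ n).isCCA (hθ n).subGaussian ((hθ n).rho_pos hε₀) c
  have HX := isBigO_gradient_block hθ hε₀ hM hb 0 1 2 (f := fun n => inX (fx n)) dx1 dy1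
    (by simpa only [l1norm_inX] using fx1) dx2 dy2 (isBigO_sampleForm_inX hθ hb fx1 fx2)
    (fun n => Population.form_α_α (hθ n).isCCA) (fun n => fX n _) (fun n => fX n _)
    (x := fun n => inX (θ n).x0) (y := fun n => inY (θ n).y0)
    (φ := fun n => inX ((θ n).phiX (i n))) (fun n => map_smul _ _ _) (fun n => map_smul _ _ _)
    (fun n => rfl)
  have HY := isBigO_gradient_block hθ hε₀ hM hb 1 0 3 (f := fun n => inY (fy n)) dy1 dx1
    (by simpa only [l1norm_inY] using fy1) dy2 dx2 (isBigO_sampleForm_inY hθ hb fy1 fy2)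
    (fun n => Population.form_β_β (hθ n).isCCA) (fun n => fY n _) (fun n => fY n _)
    (x := fun n => inY (θ n).y0) (y := fun n => inX (θ n).x0)
    (φ := fun n => inY ((θ n).phiY (i n))) (fun n => map_smul _ _ _) (fun n => map_smul _ _ _)
    (fun n => rfl)
  refine (HX.add HY).congr' ?_ EventuallyEq.rfl
  -- From here on the two signs coincide, so `x̂` and `ŷ` are flipped together.
  filter_upwards [hww] with n hn
  have ex : (θ n).x0 + dx n = w n • hatX (z n) (a n) (b n) := by
    simp only [hdx, Population.x0, hatX]
    ext k
    simp only [hu_def, hv_def, Pi.add_apply, Pi.smul_apply, Pi.sub_apply, smul_eq_mul]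
    ring
  have ey : (θ n).y0 + dy n = w n • hatY (z n) (a n) (b n) := by
    simp only [hdy, Population.y0, hatY, hn]
    ext k
    simp only [hu_def, hv_def, Pi.add_apply, Pi.smul_apply, Pi.sub_apply, smul_eq_mul]
    ring
  have eφx : (θ n).phiX (i n) + fx n = fun k => Φ n (Sum.inl k) (Sum.inl (i n)) := by
    ext k; simp [hfx, Population.phiX]
  have eφy : (θ n).phiY (i n) + fy n = fun k => Φ n (Sum.inr k) (Sum.inl (i n)) := by
    ext k; simp [hfy, Population.phiY]
  have edi : dx n (i n) = w n * hatX (z n) (a n) (b n) (i n) - (θ n).x0 (i n) := by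
    have := congrFun ex (i n)
    simp only [Pi.add_apply, Pi.smul_apply, smul_eq_mul] at this
    linarith
  -- The coordinate `dx i` is the Hessian paired with the error and the `i`-th column of `Φ⁰`. It
  -- supplies the linear terms in `dx`, `dy` of the two block expansions.
  have hco := Population.coord_eq (hθ n).isCCA (hθ n).subGaussian ((hθ n).gap_lt hε₀) hM
    (hθ n).eigX (hθ n).eigY (i n) (dx n) (dy n)
  have hsq : √(θ n).rho ^ 2 = (θ n).rho := Real.sq_sqrt ((hθ n).rho_pos hε₀).le
  have bx : ∀ c, (θ n).form c (inX (θ n).x0) * (θ n).form (inX (θ n).x0) (inX (dx n)) =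
      (θ n).rho * ((θ n).form c (inX (θ n).α) * (θ n).form (inX (θ n).α) (inX (dx n))) :=
      fun c => by
    simp only [Population.x0, map_smul, LinearMap.smul_apply, smul_eq_mul]
    rw [← hsq, Real.sqrt_sq (Real.sqrt_nonneg _)]; ring
  have by' : ∀ c, (θ n).form c (inY (θ n).y0) * (θ n).form (inY (θ n).y0) (inY (dy n)) =
      (θ n).rho * ((θ n).form c (inY (θ n).β) * (θ n).form (inY (θ n).β) (inY (dy n))) :=
      fun c => by
    simp only [Population.y0, map_smul, LinearMap.smul_apply, smul_eq_mul]
    rw [← hsq, Real.sqrt_sq (Real.sqrt_nonneg _)]; ring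
  simp only [bx, by', ← map_add, ex, ey, eφx, eφy]
  rw [debiasedX_eq, dotProduct_gradX, dotProduct_gradY, Population.leading]
  simp only [map_smul, LinearMap.smul_apply, smul_eq_mul]
  rw [edi, comm n (inX (dx n)), comm n (inX (dx n)), comm n (inX (dx n)), comm n (inY (dy n)),
    comm n (inY (dy n)), comm n (inY (dy n)), comm n (inX (θ n).α) (inX ((θ n).phiX (i n))),
    comm n (inY (θ n).β) (inY ((θ n).phiY (i n)))] at hco
  have hw2 := hw.sq_left n
  -- The gradient is odd, with a cubic and a linear part; the cubic part carries `w³`, which is `w`,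
  -- so the common sign factors out of the whole estimator.
  have hw3 : w n ^ 3 = w n := by rw [pow_succ, hw2, one_mul]
  set cx : Fin (p n) → ℝ := fun k => Φ n (Sum.inl k) (Sum.inl (i n))
  set cy : Fin (q n) → ℝ := fun k => Φ n (Sum.inr k) (Sum.inl (i n))
  set X := hatX (z n) (a n) (b n)
  set Y := hatY (z n) (a n) (b n)
  linear_combination -hco - 2 * (sampleForm (z n) (inX X) (inX X) *
    sampleForm (z n) (inX cx) (inX X) + sampleForm (z n) (inY Y) (inY Y) *
    sampleForm (z n) (inY cy) (inY Y)) * hw3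

end Path

/-! ### Moments of the deviations of the sample form -/

section ExpMoment

variable {E : Type*} [MeasurableSpace E] {μ : Measure E} {Q : E → ℝ} {c c' B : ℝ}

theorem ExpMoment.const_mul (h : ExpMoment μ Q c B) {a : ℝ} (ha : c' * |a| ≤ c) :
    ExpMoment μ (fun z => a * Q z) c' B := by
  have hle : ∀ z, Real.exp (c' * |a * Q z|) ≤ Real.exp (c * |Q z|) := fun z => by
    rw [abs_mul, ← mul_assoc]
    exact Real.exp_le_exp.2 (mul_le_mul_of_nonneg_right ha (abs_nonneg _))
  have m1 := h.aemeasurable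
  have hint : Integrable (fun z => Real.exp (c' * |a * Q z|)) μ := by
    refine h.integrable.mono (by fun_prop) (ae_of_all _ fun z => ?_)
    rw [Real.norm_of_nonneg (Real.exp_pos _).le, Real.norm_of_nonneg (Real.exp_pos _).le]
    exact hle z
  exact ⟨by fun_prop, hint, (integral_mono hint h.integrable hle).trans h.le⟩

theorem ExpMoment.variance_le [IsProbabilityMeasure μ] (h : ExpMoment μ Q c B) (hc : 0 < c) :
    variance Q μ ≤ 2 / c ^ 2 * B := by
  have h1 := variance_le_expectation_sq (X := Q) (μ := μ) h.aemeasurable.aestronglyMeasurable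
  have h2 := h.integral_pow_le hc 2
  simp only [sq_abs, Nat.factorial_two, Nat.cast_ofNat] at h2
  exact h1.trans h2

end ExpMoment

/-- Samples of size one give the contribution of a single observation; expressions linear in the
deviation are averages of these. -/
theorem sampleForm_one {p q : ℕ} (z : (Fin p → ℝ) × (Fin q → ℝ)) (u v : Fin p ⊕ Fin q → ℝ) :
    sampleForm (fun _ : Fin 1 => z) u v = lin u z * lin v z := by
  simp [sampleForm_apply]

/-- The deviation of the sample form is an average over the sample. -/
theorem sampleForm_sub_eq_mean {n p q : ℕ} (hn : n ≠ 0)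
    (z : Fin n → (Fin p → ℝ) × (Fin q → ℝ)) (F : LinearMap.BilinForm ℝ (Fin p ⊕ Fin q → ℝ))
    (u v : Fin p ⊕ Fin q → ℝ) :
    (sampleForm z - F) u v =
      (n : ℝ)⁻¹ * ∑ j, (sampleForm (fun _ : Fin 1 => z j) - F) u v := by
  have hn' : (n : ℝ) ≠ 0 := Nat.cast_ne_zero.2 hn
  simp only [LinearMap.sub_apply, sampleForm_one, Finset.sum_sub_distrib, Finset.sum_const,
    Finset.card_univ, Fintype.card_fin, nsmul_eq_mul, mul_sub]
  rw [sampleForm_apply, inv_mul_cancel_left₀ hn']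

namespace Population

variable {r p q : ℕ} {θ : Population r p q} {K : ℝ≥0} {ε₀ M : ℝ}

/-- A bound on the squared norms of the vectors of `famVec`. -/
def normBound (ε₀ M : ℝ) : ℝ := max 1 (max M ((M / (2 * ε₀)) ^ 2))

theorem one_le_normBound (ε₀ M : ℝ) : 1 ≤ normBound ε₀ M := le_max_left _ _

theorem Regular.hasSubgaussianMGF (h : θ.Regular K ε₀ M) (hε₀ : 0 < ε₀) (hM : 0 < M) (i : Fin p)
    (k : (Fin p ⊕ Fin q) ⊕ Fin 4) :
    HasSubgaussianMGF (lin (θ.famVec i k)) ((normBound ε₀ M).toNNReal * K) θ.law := by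
  have := h.isCCA.isProb
  have hφ := phi_bound h.isCCA h.subGaussian (h.gap_lt hε₀) hM h.eigX h.eigY i hε₀ h.gap
  have hα := (one_le_mul_α h.isCCA hM h.eigX).2
  have hβ := (one_le_mul_β h.isCCA hM h.eigY).2
  have b1 : (1 : ℝ) ≤ normBound ε₀ M := one_le_normBound _ _
  have b2 : M ≤ normBound ε₀ M := (le_max_left _ _).trans (le_max_right _ _)
  have b3 : (M / (2 * ε₀)) ^ 2 ≤ normBound ε₀ M := (le_max_right _ _).trans (le_max_right _ _)
  have co : ((normBound ε₀ M).toNNReal : ℝ) = normBound ε₀ M :=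
    Real.coe_toNNReal _ (by linarith)
  have X := fun a ha => h.subGaussian.linX a (R := (normBound ε₀ M).toNNReal) (by rw [co]; exact ha)
  have Y := fun a ha => h.subGaussian.linY a (R := (normBound ε₀ M).toNNReal) (by rw [co]; exact ha)
  rcases k with (k | k) | k
  · have e : θ.famVec i (Sum.inl (Sum.inl k)) = inX (Pi.single k 1) := by
      ext (j | j) <;> simp [famVec, inX, Pi.single_apply]
    rw [e]
    exact X _ (by simpa using b1)
  · have e : θ.famVec i (Sum.inl (Sum.inr k)) = inY (Pi.single k 1) := by
      ext (j | j) <;> simp [famVec, inY, Pi.single_apply]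
    rw [e]
    exact Y _ (by simpa using b1)
  · fin_cases k
    · exact X _ (hα.trans b2)
    · exact Y _ (hβ.trans b2)
    · exact X _ (hφ.1.trans b3)
    · exact Y _ (hφ.2.trans b3)

/-- The deviation at a pair of vectors of `famVec`, for a single observation. -/
def famDev (θ : Population r p q) (i : Fin p)
    (kl : ((Fin p ⊕ Fin q) ⊕ Fin 4) × ((Fin p ⊕ Fin q) ⊕ Fin 4))
    (z : (Fin p → ℝ) × (Fin q → ℝ)) : ℝ :=
  (sampleForm (fun _ : Fin 1 => z) - θ.form) (θ.famVec i kl.1) (θ.famVec i kl.2)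

theorem measurable_dev (θ : Population r p q) (u v : Fin p ⊕ Fin q → ℝ) :
    Measurable fun z : (Fin p → ℝ) × (Fin q → ℝ) =>
      (sampleForm (fun _ : Fin 1 => z) - θ.form) u v := by
  simp only [LinearMap.sub_apply, sampleForm_one]
  exact ((measurable_lin u).mul (measurable_lin v)).sub_const _

theorem integral_dev (h : θ.Regular K ε₀ M) (u v : Fin p ⊕ Fin q → ℝ) :
    Integrable (fun z => (sampleForm (fun _ : Fin 1 => z) - θ.form) u v) θ.law ∧
    ∫ z, (sampleForm (fun _ : Fin 1 => z) - θ.form) u v ∂θ.law = 0 := by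
  have := h.isCCA.isProb
  simp only [LinearMap.sub_apply, sampleForm_one]
  have hint : Integrable (fun z => lin u z * lin v z) θ.law :=
    (h.subGaussian.memLp_lin u).integrable_mul (h.subGaussian.memLp_lin v)
  refine ⟨hint.sub (integrable_const _), ?_⟩
  rw [integral_sub hint (integrable_const _), ← form_apply h.isCCA h.subGaussian]
  simp

theorem exists_expMoment_famDev (K : ℝ≥0) {ε₀ M : ℝ} (hε₀ : 0 < ε₀) (hM : 0 < M) :
    ∃ c B : ℝ, 0 < c ∧ ∀ {r p q : ℕ} {θ : Population r p q}, θ.Regular K ε₀ M →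
      ∀ i kl, ExpMoment θ.law (θ.famDev i kl) c B := by
  obtain ⟨c, B, hc, h⟩ := exists_expMoment_mul ((normBound ε₀ M).toNNReal * K)
  refine ⟨c, Real.exp B * B, hc, fun {r p q θ} hθ i kl => ?_⟩
  have := hθ.isCCA.isProb
  have h1 := (h θ.law _ _ (hθ.hasSubgaussianMGF hε₀ hM i kl.1)
    (hθ.hasSubgaussianMGF hε₀ hM i kl.2)).center hc
  rw [← form_apply hθ.isCCA hθ.subGaussian] at h1
  have e : θ.famDev i kl = fun z => lin (θ.famVec i kl.1) z * lin (θ.famVec i kl.2) z -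
      θ.form (θ.famVec i kl.1) (θ.famVec i kl.2) := by
    ext z
    simp only [famDev, LinearMap.sub_apply, sampleForm_one]
  rwa [e]

/-- The contribution of a single observation to the leading term. -/
def lead (θ : Population r p q) (i : Fin p) (z : (Fin p → ℝ) × (Fin q → ℝ)) : ℝ :=
  θ.leading (fun _ : Fin 1 => z) i

theorem leading_eq_mean {n : ℕ} (hn : n ≠ 0) (z : Fin n → (Fin p → ℝ) × (Fin q → ℝ)) (i : Fin p) :
    θ.leading z i = (n : ℝ)⁻¹ * ∑ j, θ.lead i (z j) := by
  simp only [lead, leading, Finset.sum_add_distrib, Finset.sum_sub_distrib, ← Finset.mul_sum]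
  simp only [sampleForm_sub_eq_mean hn z]
  ring

theorem measurable_lead (i : Fin p) : Measurable (θ.lead i) := by
  have := measurable_dev θ
  unfold lead leading
  fun_prop

theorem integral_lead (h : θ.Regular K ε₀ M) (i : Fin p) : ∫ z, θ.lead i z ∂θ.law = 0 := by
  have D := integral_dev h
  simp only [lead, leading]
  have t := fun c u v => (D u v).1.const_mul c
  rw [integral_add, integral_const_mul, integral_const_mul, integral_sub, integral_sub,
    integral_add, integral_add]
  · simp only [integral_const_mul, (D _ _).2]
    simp
  · exact t _ _ _
  · exact t _ _ _
  · exact t _ _ _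
  · exact t _ _ _
  · exact (t _ _ _).add (t _ _ _)
  · exact (D _ _).1
  · exact (t _ _ _).add (t _ _ _)
  · exact (D _ _).1
  · exact (((t _ _ _).add (t _ _ _)).sub (D _ _).1).const_mul _
  · exact (((t _ _ _).add (t _ _ _)).sub (D _ _).1).const_mul _

/-- This identifies the leading term with `𝒵(i)`. The factor `2` is that of the gradient, and it
makes the limiting variance of `√n L` equal to `4 σ_i²`. -/
theorem lead_eq (i : Fin p) : ∃ c : ℝ, ∀ z, θ.lead i z = 2 * θ.calZ i z - c := by
  refine ⟨2 * (θ.rho * θ.form (inX (θ.phiX i)) (inX θ.x0) +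
      θ.form (inX (θ.phiX i)) (inX θ.x0) * θ.form (inX θ.x0) (inX θ.x0) -
      θ.form (inX (θ.phiX i)) (inY θ.y0)) +
    2 * (θ.rho * θ.form (inY (θ.phiY i)) (inY θ.y0) +
      θ.form (inY (θ.phiY i)) (inY θ.y0) * θ.form (inY θ.y0) (inY θ.y0) -
      θ.form (inY (θ.phiY i)) (inX θ.x0)), fun z => ?_⟩
  have e1 : θ.form (inX (θ.phiX i)) (inX θ.x0) = θ.phiX i ⬝ᵥ θ.covX *ᵥ θ.x0 :=
    blockForm_inX_inX _ _
  have e2 : θ.form (inY (θ.phiY i)) (inY θ.y0) = θ.phiY i ⬝ᵥ θ.covY *ᵥ θ.y0 :=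
    blockForm_inY_inY _ _
  have e3 : θ.calZ i z = ((θ.rho • θ.phiX i + (θ.phiX i ⬝ᵥ θ.covX *ᵥ θ.x0) • θ.x0) ⬝ᵥ z.1) *
      (z.1 ⬝ᵥ θ.x0) + ((θ.rho • θ.phiY i + (θ.phiY i ⬝ᵥ θ.covY *ᵥ θ.y0) • θ.y0) ⬝ᵥ z.2) *
      (z.2 ⬝ᵥ θ.y0) - (θ.phiX i ⬝ᵥ z.1) * (z.2 ⬝ᵥ θ.y0) - (θ.x0 ⬝ᵥ z.1) * (z.2 ⬝ᵥ θ.phiY i) := rfl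
  rw [e3]
  simp only [lead, leading, LinearMap.sub_apply, sampleForm_one, lin_inX, lin_inY]
  rw [e1, e2]
  simp only [add_dotProduct, smul_dotProduct, smul_eq_mul, dotProduct_comm z.1, dotProduct_comm z.2]
  ring

theorem variance_lead (h : θ.Regular K ε₀ M) (i : Fin p) :
    variance (θ.lead i) θ.law = 4 * θ.sigmaSq i := by
  have := h.isCCA.isProb
  obtain ⟨c, hc⟩ := lead_eq (θ := θ) i
  have e : θ.lead i = fun z => 2 * θ.calZ i z - c := funext hc
  have e' : θ.calZ i = fun z => (θ.lead i z + c) / 2 := by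
    ext z; rw [hc]; ring
  have hm : Measurable (θ.calZ i) := by
    rw [e']; exact ((measurable_lead i).add_const c).div_const 2
  rw [e, variance_sub_const (hm.const_mul 2).aestronglyMeasurable, variance_const_mul, sigmaSq]
  norm_num

theorem form_ref_sq_le (h : θ.Regular K ε₀ M) (hε₀ : 0 < ε₀) (hM : 0 < M) (i : Fin p) :
    |θ.form (inX (θ.phiX i)) (inX θ.α)| ≤ max 1 (M * normBound ε₀ M) ∧
      |θ.form (inY (θ.phiY i)) (inY θ.β)| ≤ max 1 (M * normBound ε₀ M) := by
  have hφ := phi_bound h.isCCA h.subGaussian (h.gap_lt hε₀) hM h.eigX h.eigY i hε₀ h.gap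
  have b3 : (M / (2 * ε₀)) ^ 2 ≤ normBound ε₀ M := (le_max_right _ _).trans (le_max_right _ _)
  have h1 := form_sq_le h.isCCA h.subGaussian (inX (θ.phiX i)) (inX θ.α)
  have h2 := form_sq_le h.isCCA h.subGaussian (inY (θ.phiY i)) (inY θ.β)
  rw [form_α_α h.isCCA, mul_one] at h1
  rw [form_β_β h.isCCA, mul_one] at h2
  have h3 := (form_inX_bounds (q := q) h.eigX (θ.phiX i)).2.trans
    (mul_le_mul_of_nonneg_left (hφ.1.trans b3) hM.le)
  have h4 := (form_inY_bounds (p := p) h.eigY (θ.phiY i)).2.trans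
    (mul_le_mul_of_nonneg_left (hφ.2.trans b3) hM.le)
  set C := M * normBound ε₀ M
  have key : ∀ {y : ℝ}, y ^ 2 ≤ C → |y| ≤ max 1 C := fun {y} hy => by
    refine abs_le_of_sq_le_sq ?_ (zero_le_one.trans (le_max_left _ _))
    have := le_max_left 1 C
    have := le_max_right 1 C
    nlinarith
  exact ⟨key (h1.trans h3), key (h2.trans h4)⟩

theorem exists_expMoment_lead (K : ℝ≥0) {ε₀ M : ℝ} (hε₀ : 0 < ε₀) (hM : 0 < M) :
    ∃ c B : ℝ, 0 < c ∧ ∀ {r p q : ℕ} {θ : Population r p q}, θ.Regular K ε₀ M →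
      ∀ i, ExpMoment θ.law (θ.lead i) c B := by
  obtain ⟨c, B, hc, h⟩ := exists_expMoment_famDev K hε₀ hM
  set C := max 1 (M * normBound ε₀ M) with hC
  have hC1 : 1 ≤ C := le_max_left _ _
  have hC0 : 0 < C := one_pos.trans_le hC1
  -- Six deviations are added at three levels, which costs `2³ = 8` in the order, and their
  -- coefficients are at most `2 C`.
  set c' := c / (16 * C) with hc'
  have hc'0 : 0 < c' := by positivity
  refine ⟨c', B, hc'0, fun {r p q θ} hθ i => ?_⟩
  have hρ0 := hθ.rho_pos hε₀
  have hρ1 := rho_le_one hθ.isCCA hθ.subGaussian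
  have hs1 : √θ.rho ≤ 1 := Real.sqrt_le_one.2 hρ1
  have hs0 := Real.sqrt_nonneg θ.rho
  obtain ⟨hF1, hF2⟩ := form_ref_sq_le hθ hε₀ hM i
  have D := fun (k l : Fin 4) => h hθ i (Sum.inr k, Sum.inr l)
  have hsm : ∀ {y : ℝ}, |y| ≤ C → ∀ {d : ℝ}, 0 ≤ d → d ≤ 8 * c' → d * |2 * y| ≤ c := by
    intro y hy d hd0 hd
    rw [abs_mul, abs_two]
    calc d * (2 * |y|) ≤ 8 * c' * (2 * C) := by gcongr
      _ = c := by rw [hc']; field_simp; norm_num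
  have hρC : |θ.rho * √θ.rho| ≤ C := by
    rw [abs_of_nonneg (by positivity)]
    exact (mul_le_one₀ hρ1 hs0 hs1).trans hC1
  have hFC : ∀ {F : ℝ}, |F| ≤ C → |√θ.rho * F * θ.rho| ≤ C := fun {F} hF => by
    rw [abs_mul, abs_mul, abs_of_nonneg hs0, abs_of_nonneg hρ0.le]
    calc √θ.rho * |F| * θ.rho ≤ 1 * C * 1 := by gcongr
      _ = C := by ring
  have hsC : |-√θ.rho| ≤ C := by
    rw [abs_neg, abs_of_nonneg hs0]; exact hs1.trans hC1
  have T1 := ((D 2 0).const_mul (c' := 2 * (2 * (2 * c')))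
    (hsm hρC (by positivity) (by linarith))).add ((D 0 0).const_mul
      (hsm (hFC hF1) (by positivity) (by linarith))) (by positivity)
  have T2 := T1.add ((D 2 1).const_mul
    (hsm hsC (by positivity) (by linarith))) (by positivity)
  have S1 := ((D 3 1).const_mul (c' := 2 * (2 * (2 * c')))
    (hsm hρC (by positivity) (by linarith))).add ((D 1 1).const_mul
      (hsm (hFC hF2) (by positivity) (by linarith))) (by positivity)
  have S2 := S1.add ((D 3 0).const_mul
    (hsm hsC (by positivity) (by linarith))) (by positivity)
  have T := T2.add S2 hc'0.le
  refine T.of_le (measurable_lead i).aemeasurable hc'0.le fun z => le_of_eq ?_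
  congr 1
  have hsq := Real.mul_self_sqrt hρ0.le
  have d : ∀ k l, θ.famDev i (Sum.inr k, Sum.inr l) z =
    (sampleForm (fun _ : Fin 1 => z) - θ.form) (θ.refVec i k) (θ.refVec i l) := fun _ _ => rfl
  simp only [d, lead, leading, x0, y0, map_smul, LinearMap.smul_apply, smul_eq_mul]
  have r0 : θ.refVec i 0 = inX θ.α := rfl
  have r1 : θ.refVec i 1 = inY θ.β := rfl
  have r2 : θ.refVec i 2 = inX (θ.phiX i) := rfl
  have r3 : θ.refVec i 3 = inY (θ.phiY i) := rfl
  rw [r0, r1, r2, r3]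
  set s := √θ.rho
  rw [← hsq]
  ring

theorem x0_sq_le (h : θ.Regular K ε₀ M) (hε₀ : 0 < ε₀) (hM : 0 < M) (i : Fin p) :
    θ.x0 i ^ 2 ≤ M := by
  have h1 := (one_le_mul_α h.isCCA hM h.eigX).2
  have h2 : θ.α i ^ 2 ≤ θ.α ⬝ᵥ θ.α := by
    rw [dotProduct, sq]
    exact Finset.single_le_sum (f := fun k => θ.α k * θ.α k) (fun k _ => mul_self_nonneg _)
      (Finset.mem_univ i)
  have hρ1 := rho_le_one h.isCCA h.subGaussian
  rw [x0, Pi.smul_apply, smul_eq_mul, mul_pow, Real.sq_sqrt (h.rho_pos hε₀).le]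
  nlinarith [sq_nonneg (θ.α i)]

end Population

/-! ### Rates -/

theorem tendsto_atTop_of_one_le_of_isLittleO {u v : ℕ → ℝ} (hu : ∀ n, 1 ≤ u n)
    (hv : ∀ n, 0 ≤ v n) (h : u =o[atTop] v) : Tendsto v atTop atTop := by
  refine tendsto_atTop.2 fun C => ?_
  have hC : (0 : ℝ) < (|C| + 1)⁻¹ := by positivity
  filter_upwards [h.bound hC] with n hn
  rw [Real.norm_of_nonneg (hv n), Real.norm_of_nonneg (zero_le_one.trans (hu n)), inv_mul_eq_div,
    le_div_iff₀ (by positivity)] at hn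
  nlinarith [hu n, le_abs_self C, abs_nonneg C]

/-- The orders of magnitude of `rt = s^κ λ`, `g = s^(κ + 1/2) λ` and `λ`. -/
structure RateBounds (s rt g lm : ℕ → ℝ) : Prop where
  rt_nonneg : ∀ n, 0 ≤ rt n
  g_nonneg : ∀ n, 0 ≤ g n
  lm_nonneg : ∀ n, 0 ≤ lm n
  sqrt_n : Tendsto (fun n : ℕ => √(n : ℝ) * rt n ^ 2) atTop (𝓝 0)
  rt_zero : Tendsto rt atTop (𝓝 0)
  g_zero : Tendsto g atTop (𝓝 0)
  lm_zero : Tendsto lm atTop (𝓝 0)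
  sqrt_s : ∀ n, √(s n) * rt n = g n
  g_lm : (fun n => lm n * g n) =O[atTop] fun n => rt n ^ 2
  gg_lm : (fun n => lm n * g n * g n) =O[atTop] fun n => rt n ^ 2
  inv_sqrt_n : (fun n : ℕ => (√(n : ℝ))⁻¹) =O[atTop] rt
  one_le : ∀ᶠ n : ℕ in atTop, 1 ≤ n * lm n ^ 2

/-- Three facts drive all the estimates: `s^(2κ) λ² = o(n^(-1/2))`; `s ≥ 1` and `κ ≥ 1/2`, which
order the powers `s^κ ≤ s^(κ+1/2) ≤ s^(2κ)`; and `n λ² = log (p ∨ q) ≥ 1` eventually, because `p →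
∞`. -/
theorem rateBounds {p q s : ℕ → ℕ} (hs1 : ∀ n, 1 ≤ s n) {κ : ℝ} (hκ : 1 / 2 ≤ κ)
    (hp : Tendsto (fun n => (p n : ℝ)) atTop atTop)
    (hs : (fun n => (s n : ℝ) ^ (2 * κ) * lam n (p n) (q n) ^ 2)
      =o[atTop] fun n => (n : ℝ) ^ (-(1 / 2) : ℝ)) :
    RateBounds (fun n => s n) (fun n => (s n : ℝ) ^ κ * lam n (p n) (q n))
      (fun n => (s n : ℝ) ^ (κ + 1 / 2) * lam n (p n) (q n)) fun n => lam n (p n) (q n) := by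
  set lm : ℕ → ℝ := fun n => lam n (p n) (q n) with hlm
  have lm0 : ∀ n, 0 ≤ lm n := fun n => Real.sqrt_nonneg _
  have s1 : ∀ n, (1 : ℝ) ≤ s n := fun n => by exact_mod_cast hs1 n
  have s0 : ∀ n, (0 : ℝ) < s n := fun n => one_pos.trans_le (s1 n)
  have nlm : ∀ n : ℕ, n ≠ 0 → n * lm n ^ 2 = Real.log (max (p n) (q n) : ℕ) := fun n hn => by
    have : (n : ℝ) ≠ 0 := Nat.cast_ne_zero.2 hn
    rw [hlm]
    simp only [lam]
    rw [Real.sq_sqrt (div_nonneg (Real.log_natCast_nonneg _) (Nat.cast_nonneg _))]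
    field_simp
  have hL : ∀ᶠ n : ℕ in atTop, 1 ≤ n * lm n ^ 2 := by
    have h1 := (Real.tendsto_log_atTop.comp hp).eventually_ge_atTop 1
    have h2 := hp.eventually_gt_atTop 0
    filter_upwards [h1, h2, eventually_ne_atTop 0] with n h1 h2 h3
    rw [nlm n h3]
    refine h1.trans (Real.log_le_log h2 ?_)
    exact Nat.cast_le.2 (le_max_left _ _)
  have hL' : ∀ᶠ n : ℕ in atTop, 1 ≤ lm n * √(n : ℝ) := by
    filter_upwards [hL] with n hn
    rw [← Real.sqrt_le_sqrt_iff (by positivity), Real.sqrt_one, mul_comm (n : ℝ),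
      Real.sqrt_mul (sq_nonneg _), Real.sqrt_sq (lm0 n)] at hn
    exact hn
  have sq_rt : ∀ n, ((s n : ℝ) ^ κ * lm n) ^ 2 = (s n : ℝ) ^ (2 * κ) * lm n ^ 2 := fun n => by
    rw [mul_pow, mul_comm 2 κ, Real.rpow_mul (s0 n).le, Real.rpow_two]
  have key : Tendsto (fun n : ℕ => √(n : ℝ) * ((s n : ℝ) ^ κ * lm n) ^ 2) atTop (𝓝 0) := by
    have h1 : Tendsto (fun n => (s n : ℝ) ^ (2 * κ) * lm n ^ 2 / (n : ℝ) ^ (-(1 / 2) : ℝ))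
      atTop (𝓝 0) := hs.tendsto_div_nhds_zero
    refine h1.congr fun n => ?_
    rw [sq_rt, Real.rpow_neg (Nat.cast_nonneg _), div_inv_eq_mul, ← Real.sqrt_eq_rpow, mul_comm]
  have le1 : ∀ n, (1 : ℝ) ≤ (s n : ℝ) ^ κ := fun n => Real.one_le_rpow (s1 n) (by linarith)
  have le2 : ∀ n, (s n : ℝ) ^ κ ≤ (s n : ℝ) ^ (κ + 1 / 2) := fun n =>
    Real.rpow_le_rpow_of_exponent_le (s1 n) (by linarith)
  have le3 : ∀ n, (s n : ℝ) ^ (κ + 1 / 2) ≤ (s n : ℝ) ^ (2 * κ) := fun n =>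
    Real.rpow_le_rpow_of_exponent_le (s1 n) (by linarith)
  have le4 : ∀ n, (s n : ℝ) ≤ (s n : ℝ) ^ (2 * κ) := fun n => by
    conv_lhs => rw [← Real.rpow_one (s n : ℝ)]
    exact Real.rpow_le_rpow_of_exponent_le (s1 n) (by linarith)
  -- Since `1 ≤ λ √n` eventually, `s^(2κ) λ ≤ √n s^(2κ) λ²`. All single-factor rates are dominated
  -- by this one.
  have big : Tendsto (fun n => (s n : ℝ) ^ (2 * κ) * lm n) atTop (𝓝 0) := by
    refine squeeze_zero' (Eventually.of_forall fun n => ?_) ?_ key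
    · exact mul_nonneg (Real.rpow_nonneg (s0 n).le _) (lm0 n)
    · filter_upwards [hL'] with n hn
      rw [sq_rt]
      have : 0 ≤ (s n : ℝ) ^ (2 * κ) * lm n := mul_nonneg (Real.rpow_nonneg (s0 n).le _) (lm0 n)
      nlinarith
  have sq_s : ∀ n, √(s n : ℝ) * ((s n : ℝ) ^ κ * lm n) = (s n : ℝ) ^ (κ + 1 / 2) * lm n :=
      fun n => by
    rw [Real.rpow_add (s0 n), ← Real.sqrt_eq_rpow]
    ring
  have small : ∀ {f : ℕ → ℝ}, (∀ n, 0 ≤ f n) → (∀ n, f n ≤ (s n : ℝ) ^ (2 * κ)) →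
      Tendsto (fun n => f n * lm n) atTop (𝓝 0) := fun h1 h2 =>
    squeeze_zero (fun n => mul_nonneg (h1 n) (lm0 n))
      (fun n => mul_le_mul_of_nonneg_right (h2 n) (lm0 n)) big
  refine ⟨fun n => mul_nonneg (by positivity) (lm0 n), fun n => mul_nonneg (by positivity) (lm0 n),
    lm0, key, small (fun n => by positivity) fun n => (le2 n).trans (le3 n),
    small (fun n => by positivity) le3, ?_, sq_s, ?_, ?_, ?_, hL⟩
  · simpa using small (f := fun _ => 1) (fun _ => zero_le_one) fun n =>
      (le1 n).trans ((le2 n).trans (le3 n))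
  · refine isBigO_of_le _ fun n => ?_
    rw [Real.norm_of_nonneg (mul_nonneg (lm0 n) (mul_nonneg (by positivity) (lm0 n))),
      Real.norm_of_nonneg (sq_nonneg _), sq_rt]
    calc lm n * ((s n : ℝ) ^ (κ + 1 / 2) * lm n) = (s n : ℝ) ^ (κ + 1 / 2) * lm n ^ 2 := by ring
      _ ≤ _ := mul_le_mul_of_nonneg_right (le3 n) (sq_nonneg _)
  -- `λ g² = (s λ) rt²`, and `s λ ≤ s^(2κ) λ` is bounded.
  · have h1 := ((small (fun n => (s0 n).le) le4).isBigO_one ℝ).mul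
      (isBigO_refl (fun n => ((s n : ℝ) ^ κ * lm n) ^ 2) atTop)
    simp only [one_mul] at h1
    refine h1.congr_left fun n => ?_
    rw [← sq_s n]
    have := Real.mul_self_sqrt (s0 n).le
    linear_combination -(lm n * ((s n : ℝ) ^ κ * lm n) ^ 2) * this
  · refine IsBigO.of_bound 1 ?_
    filter_upwards [hL', eventually_gt_atTop 0] with n hn hn0
    have hn0' : (0 : ℝ) < √(n : ℝ) := Real.sqrt_pos.2 (Nat.cast_pos.2 hn0)
    rw [Real.norm_of_nonneg (by positivity), one_mul,
      Real.norm_of_nonneg (mul_nonneg (by positivity) (lm0 n)), inv_le_iff_one_le_mul₀ hn0']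
    refine hn.trans (mul_le_mul_of_nonneg_right ?_ hn0'.le)
    exact le_mul_of_one_le_left (lm0 n) (le1 n)

/-! ### Uniform deviations -/

section Deviations

variable {r : ℕ} {p q : ℕ → ℕ} {θ : ∀ n, Population r (p n) (q n)} {K : ℝ≥0} {ε₀ M : ℝ}
  {Ω : ℕ → Type*} [∀ n, MeasurableSpace (Ω n)] {P : ∀ n, Measure (Ω n)}
  [∀ n, IsProbabilityMeasure (P n)]
  {Z : ∀ n, Fin n → Ω n → (Fin (p n) → ℝ) × (Fin (q n) → ℝ)}

/-- The index map `e` lets one statement serve two rates: `λ` for the family with the whole standard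
basis, and `n^(-1/2)` for the four reference vectors. -/
theorem isBigOp_devSup (hθ : ∀ n, (θ n).Regular K ε₀ M) (hε₀ : 0 < ε₀) (hM : 0 < M)
    (hZ : ∀ n j, HasLaw (Z n j) (θ n).law (P n)) (hind : ∀ n, iIndepFun (Z n) (P n))
    (i : ∀ n, Fin (p n)) {ι : ℕ → Type*} [∀ n, Fintype (ι n)]
    (e : ∀ n, ι n → (Fin (p n) ⊕ Fin (q n)) ⊕ Fin 4) {τ : ℕ → ℝ} (hτ0 : ∀ n, 0 ≤ τ n)
    (hτ : Tendsto τ atTop (𝓝 0)) (hτ1 : ∀ᶠ n : ℕ in atTop, 1 ≤ n * τ n ^ 2) {a : ℝ}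
    (hcard : ∀ᶠ n : ℕ in atTop,
      (Fintype.card (ι n × ι n) : ℝ) ≤ Real.exp (a * (n * τ n ^ 2))) :
    IsBigOp P (fun n ω => devSup (sampleForm (fun j => Z n j ω) - (θ n).form)
      fun k => (θ n).famVec (i n) (e n k)) τ := by
  have hprob := fun n => (hθ n).isCCA.isProb
  obtain ⟨c, B, hc, h⟩ := Population.exists_expMoment_famDev K hε₀ hM
  have := isBigOp_iSup_mean (μ := fun n => (θ n).law) (ι := fun n => ι n × ι n)
    (Q := fun n kl => (θ n).famDev (i n) (e n kl.1, e n kl.2)) hc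
    (fun n kl => h (hθ n) (i n) _) (fun n kl => Population.measurable_dev _ _ _)
    (fun n kl => (Population.integral_dev (hθ n) _ _).2) Z hZ hind hτ0 hτ hτ1 hcard
  intro ε hε
  obtain ⟨C, hC⟩ := this ε hε
  refine ⟨C, ?_⟩
  filter_upwards [hC, eventually_ne_atTop 0] with n hn hn0
  refine le_of_eq_of_le ?_ hn
  simp only [devSup, sampleForm_sub_eq_mean hn0]
  rfl

end Deviations

/-! ### Measurability of the estimator -/

section Measurability

variable {n p q : ℕ} {Ω : Type*} [MeasurableSpace Ω] {P : Measure Ω}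
  {Z : Fin n → Ω → (Fin p → ℝ) × (Fin q → ℝ)} (hZ : ∀ j, AEMeasurable (Z j) P)

include hZ

theorem aemeasurable_sampleForm {u v : Ω → Fin p ⊕ Fin q → ℝ} (hu : ∀ k, AEMeasurable (u · k) P)
    (hv : ∀ k, AEMeasurable (v · k) P) :
    AEMeasurable (fun ω => sampleForm (fun j => Z j ω) (u ω) (v ω)) P := by
  have h1 : ∀ j k, AEMeasurable (fun ω => (Z j ω).1 k) P := fun j k =>
    (measurable_pi_apply k).comp_aemeasurable (hZ j).fst
  have h2 : ∀ j k, AEMeasurable (fun ω => (Z j ω).2 k) P := fun j k =>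
    (measurable_pi_apply k).comp_aemeasurable (hZ j).snd
  have hl : ∀ {u : Ω → Fin p ⊕ Fin q → ℝ}, (∀ k, AEMeasurable (u · k) P) → ∀ j,
      AEMeasurable (fun ω => lin (u ω) (Z j ω)) P := fun hu j => by
    simp only [lin, dotProduct, Fintype.sum_sum_type, Sum.elim_inl, Sum.elim_inr]
    exact (Finset.aemeasurable_fun_sum _ fun k _ => (hu _).mul (h1 j k)).add
      (Finset.aemeasurable_fun_sum _ fun k _ => (hu _).mul (h2 j k))
  simp only [sampleForm_apply]
  exact (Finset.aemeasurable_fun_sum _ fun j _ => (hl hu j).mul (hl hv j)).const_mul _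

theorem aemeasurable_debiasedX {a : Ω → Fin p → ℝ} {b : Ω → Fin q → ℝ} (ha : AEMeasurable a P)
    (hb : AEMeasurable b P) {Φ : Ω → Matrix (Fin p ⊕ Fin q) (Fin p ⊕ Fin q) ℝ}
    (hΦ : ∀ k l, AEMeasurable (fun ω => Φ ω k l) P) (i : Fin p) :
    AEMeasurable (fun ω => debiasedX (fun j => Z j ω) (a ω) (b ω) (Φ ω) i) P := by
  have hX : ∀ {u : Ω → Fin p → ℝ}, (∀ k, AEMeasurable (u · k) P) →
      ∀ k, AEMeasurable (fun ω => (inX (u ω) : Fin p ⊕ Fin q → ℝ) k) P := by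
    rintro u hu (k | k)
    · simpa [inX] using hu k
    · simp [inX]
  have hY : ∀ {u : Ω → Fin q → ℝ}, (∀ k, AEMeasurable (u · k) P) →
      ∀ k, AEMeasurable (fun ω => (inY (u ω) : Fin p ⊕ Fin q → ℝ) k) P := by
    rintro u hu (k | k)
    · simp [inY]
    · simpa [inY] using hu k
  have ha' := aemeasurable_pi_iff.1 ha
  have hb' := aemeasurable_pi_iff.1 hb
  have S := fun {u v} hu hv => aemeasurable_sampleForm hZ (u := u) (v := v) hu hv
  have hρ : AEMeasurable (fun ω => √|hatRho (fun j => Z j ω) (a ω) (b ω)|) P := by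
    simp only [hatRho_eq]
    have h1 := S (hX ha') (hY hb')
    have h2 := S (hX ha') (hX ha')
    have h3 := S (hY hb') (hY hb')
    exact (h1.div (h2.sqrt.mul h3.sqrt)).abs.sqrt
  have hx : ∀ k, AEMeasurable (fun ω => hatX (fun j => Z j ω) (a ω) (b ω) k) P := fun k =>
    hρ.mul (ha' k)
  have hy : ∀ k, AEMeasurable (fun ω => hatY (fun j => Z j ω) (a ω) (b ω) k) P := fun k =>
    hρ.mul (hb' k)
  simp only [debiasedX_eq, dotProduct_gradX, dotProduct_gradY]
  have c1 := hX (u := fun ω k => Φ ω (Sum.inl k) (Sum.inl i)) fun k => hΦ _ _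
  have c2 := hY (u := fun ω k => Φ ω (Sum.inr k) (Sum.inl i)) fun k => hΦ _ _
  exact (hx i).sub (((((S (hX hx) (hX hx)).const_mul 2).mul (S c1 (hX hx))).sub
    ((S c1 (hY hy)).const_mul 2)).add ((((S (hY hy) (hY hy)).const_mul 2).mul (S c2 (hY hy))).sub
    ((S c2 (hX hx)).const_mul 2)))

end Measurability

theorem gaussianReal_map_sqrt_mul {v : ℝ} (hv : 0 ≤ v) :
    ((gaussianReal 0 1).map fun x => √v * x) = gaussianReal 0 v.toNNReal := by
  rw [gaussianReal_map_const_mul, mul_zero]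
  congr 1
  ext
  simp [Real.sq_sqrt hv, Real.coe_toNNReal _ hv]

/-! ### Reduction to sample paths -/

section Limit

variable {r : ℕ} {p q : ℕ → ℕ} {θ : ∀ n, Population r (p n) (q n)} {K : ℝ≥0} {ε₀ M : ℝ}
  {Ω : ℕ → Type*} [∀ n, MeasurableSpace (Ω n)] {P : ∀ n, Measure (Ω n)}
  {Z : ∀ n, Fin n → Ω n → (Fin (p n) → ℝ) × (Fin (q n) → ℝ)} {i : ∀ n, Fin (p n)}
  {a : ∀ n, Ω n → Fin (p n) → ℝ} {b : ∀ n, Ω n → Fin (q n) → ℝ}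
  {Φ : ∀ n, Ω n → Matrix (Fin (p n) ⊕ Fin (q n)) (Fin (p n) ⊕ Fin (q n)) ℝ}
  {rt g lm : ℕ → ℝ}

/-- The stochastic assumptions, in terms of `O_p`. -/
structure StochasticBounds (P : ∀ n, Measure (Ω n)) (θ : ∀ n, Population r (p n) (q n))
    (i : ∀ n, Fin (p n)) (Z : ∀ n, Fin n → Ω n → (Fin (p n) → ℝ) × (Fin (q n) → ℝ))
    (a : ∀ n, Ω n → Fin (p n) → ℝ) (b : ∀ n, Ω n → Fin (q n) → ℝ)
    (Φ : ∀ n, Ω n → Matrix (Fin (p n) ⊕ Fin (q n)) (Fin (p n) ⊕ Fin (q n)) ℝ)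
    (rt g lm : ℕ → ℝ) : Prop where
  err2 : IsBigOp P (fun n ω => signErr2 (a n ω) (θ n).α + signErr2 (b n ω) (θ n).β) rt
  err1 : IsBigOp P (fun n ω => signErr1 (a n ω) (θ n).α + signErr1 (b n ω) (θ n).β) g
  phi1 : IsBigOp P (fun n ω => maxColErr1 (Φ n ω) (θ n).Phi0) g
  phi2 : IsBigOp P (fun n ω => maxColErr2 (Φ n ω) (θ n).Phi0) rt
  devFam : IsBigOp P (fun n ω =>
    devSup (sampleForm (fun j => Z n j ω) - (θ n).form) ((θ n).famVec (i n))) lm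
  devRef : IsBigOp P (fun n ω =>
    devSup (sampleForm (fun j => Z n j ω) - (θ n).form) ((θ n).refVec (i n)))
    fun n => (√(n : ℝ))⁻¹
  sign : Tendsto (fun n => P n {ω | hatX (fun j => Z n j ω) (a n ω) (b n ω) ⬝ᵥ
    hatCovXY (fun j => Z n j ω) *ᵥ hatY (fun j => Z n j ω) (a n ω) (b n ω) < 0}) atTop (𝓝 0)

theorem tendsto_measure_of_forall_pathBounds [∀ n, IsProbabilityMeasure (P n)]
    (hr : RateBounds (fun n => ((θ n).s : ℝ)) rt g lm) (hS : StochasticBounds P θ i Z a b Φ rt g lm)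
    {R : ∀ n, Ω n → ℝ} (hR : ∀ (l : Filter ℕ), l ≤ atTop → ∀ ω : ∀ n, Ω n,
      PathBounds l θ i (fun n j => Z n j (ω n)) (fun n => a n (ω n)) (fun n => b n (ω n))
        (fun n => Φ n (ω n)) rt g lm (fun n => (√(n : ℝ))⁻¹) →
      Tendsto (fun n => R n (ω n)) l (𝓝 0)) {δ : ℝ} (hδ : 0 < δ) :
    Tendsto (fun n => P n {ω | δ < |R n ω|}) atTop (𝓝 0) := by
  refine tendsto_measure_of_forall_path (ι := Fin 6)
    (T := ![fun n ω => signErr2 (a n ω) (θ n).α + signErr2 (b n ω) (θ n).β,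
      fun n ω => signErr1 (a n ω) (θ n).α + signErr1 (b n ω) (θ n).β,
      fun n ω => maxColErr1 (Φ n ω) (θ n).Phi0, fun n ω => maxColErr2 (Φ n ω) (θ n).Phi0,
      fun n ω => devSup (sampleForm (fun j => Z n j ω) - (θ n).form) ((θ n).famVec (i n)),
      fun n ω => devSup (sampleForm (fun j => Z n j ω) - (θ n).form) ((θ n).refVec (i n))])
    (rate := ![rt, g, g, rt, lm, fun n => (√(n : ℝ))⁻¹]) ?_ ?_ hS.sign ?_ δ hδ
  · intro k n
    fin_cases k
    exacts [hr.rt_nonneg n, hr.g_nonneg n, hr.g_nonneg n, hr.rt_nonneg n, hr.lm_nonneg n,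
      inv_nonneg.2 (Real.sqrt_nonneg _)]
  · intro k
    fin_cases k
    exacts [hS.err2, hS.err1, hS.phi1, hS.phi2, hS.devFam, hS.devRef]
  · intro l hl ω hT hA
    exact hR l hl ω
      { rt_zero := hr.rt_zero.mono_left hl
        g_zero := hr.g_zero.mono_left hl
        sqrt_s := isBigO_of_le _ fun n => by rw [hr.sqrt_s]
        g_lm := hr.g_lm.mono hl
        gg_lm := hr.gg_lm.mono hl
        m_rt := hr.inv_sqrt_n.mono hl
        err2 := hT 0
        err1 := hT 1
        phi1 := hT 2
        phi2 := hT 3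
        devFam := hT 4
        devRef := hT 5
        sign := hA.mono fun n hn => not_lt.1 hn }

/-- The expansions behind the two limit laws, along a sample path. -/
theorem tendsto_of_pathBounds {l : Filter ℕ} (hl : l ≤ atTop)
    {z : ∀ n, Fin n → (Fin (p n) → ℝ) × (Fin (q n) → ℝ)}
    {a : ∀ n, Fin (p n) → ℝ} {b : ∀ n, Fin (q n) → ℝ}
    {Φ : ∀ n, Matrix (Fin (p n) ⊕ Fin (q n)) (Fin (p n) ⊕ Fin (q n)) ℝ}
    (hθ : ∀ n, (θ n).Regular K ε₀ M) (hε₀ : 0 < ε₀) (hM : 0 < M)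
    (hr : RateBounds (fun n => ((θ n).s : ℝ)) rt g lm)
    (hb : PathBounds l θ i z a b Φ rt g lm fun n => (√(n : ℝ))⁻¹) :
    Tendsto (fun n : ℕ => √(n : ℝ) * (debiasedX (z n) (a n) (b n) (Φ n) (i n) ^ 2 -
      (θ n).x0 (i n) ^ 2) - -(2 * (θ n).x0 (i n)) * (√(n : ℝ) * (θ n).leading (z n) (i n)))
      l (𝓝 0) ∧
    ((∀ᶠ n in atTop, (θ n).x0 (i n) = 0) →
      Tendsto (fun n : ℕ => n * debiasedX (z n) (a n) (b n) (Φ n) (i n) ^ 2 -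
        (√(n : ℝ) * (θ n).leading (z n) (i n)) ^ 2) l (𝓝 0)) := by
  obtain ⟨w, hw, hR⟩ := exists_sign_debiasedX hθ hε₀ hM hb
  have hL := isBigO_leading hθ hε₀ hM hb
  set D : ℕ → ℝ := fun n => debiasedX (z n) (a n) (b n) (Φ n) (i n)
  set x : ℕ → ℝ := fun n => (θ n).x0 (i n)
  set L : ℕ → ℝ := fun n => (θ n).leading (z n) (i n)
  set R : ℕ → ℝ := fun n => w n * D n - x n + L n with hRdef
  have hRn : Tendsto (fun n : ℕ => √(n : ℝ) * R n) l (𝓝 0) :=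
    ((isBigO_refl (fun n : ℕ => √(n : ℝ)) l).mul hR).trans_tendsto (hr.sqrt_n.mono_left hl)
  have hLn : (fun n : ℕ => √(n : ℝ) * L n) =O[l] fun _ => (1 : ℝ) := by
    refine ((isBigO_refl (fun n : ℕ => √(n : ℝ)) l).mul hL).trans
      (IsBigO.of_bound 1 (Eventually.of_forall fun n => ?_))
    rw [← div_eq_mul_inv, Real.norm_of_nonneg (by positivity), norm_one, mul_one]
    exact div_self_le_one _
  have hR0 : Tendsto R l (𝓝 0) := hR.trans_tendsto (by
    simpa using (hr.rt_zero.mono_left hl).pow 2)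
  have hL0 : Tendsto L l (𝓝 0) := hL.trans_tendsto (hb.m_rt.trans_tendsto hb.rt_zero)
  have hx : x =O[l] fun _ => (1 : ℝ) := isBigO_one_of_abs_le (c := √M) fun n =>
    Real.abs_le_sqrt (Population.x0_sq_le (hθ n) hε₀ hM (i n))
  -- The unknown sign disappears here, which is why the limit laws concern squares.
  have hD : ∀ n, D n ^ 2 = (x n - L n + R n) ^ 2 := fun n => by
    have : x n - L n + R n = w n * D n := by rw [hRdef]; ring
    rw [this, mul_pow, hw, one_mul]
  constructor
  -- `D² - x² + 2 x L = 2 x R + (R - L)²`. After multiplication by `√n`, the first term is bounded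
  -- times `o(1)`, and in the second one factor `√n (R - L)` is bounded while the other tends to
  -- zero.
  · have t1 : Tendsto (fun n : ℕ => x n * (√(n : ℝ) * R n)) l (𝓝 0) := by
      have : (fun n : ℕ => x n * (√(n : ℝ) * R n)) =O[l] fun n : ℕ => √(n : ℝ) * R n := by
        simpa using hx.mul (isBigO_refl (fun n : ℕ => √(n : ℝ) * R n) l)
      exact this.trans_tendsto hRn
    have t2 : Tendsto (fun n : ℕ => (√(n : ℝ) * R n - √(n : ℝ) * L n) * (R n - L n)) l (𝓝 0) := by
      have : (fun n : ℕ => (√(n : ℝ) * R n - √(n : ℝ) * L n) * (R n - L n)) =O[l]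
          fun n => R n - L n := by
        simpa using ((hRn.isBigO_one ℝ).sub hLn).mul (isBigO_refl (fun n => R n - L n) l)
      exact this.trans_tendsto (by simpa using hR0.sub hL0)
    have := (t1.const_mul 2).add t2
    simp only [mul_zero, add_zero] at this
    refine this.congr fun n => ?_
    rw [hD]
    ring
  · intro h0
    -- With `x = 0`, `n D² - n L² = √n R (√n R - 2 √n L)`.
    have t : Tendsto (fun n : ℕ => √(n : ℝ) * R n * (√(n : ℝ) * R n - 2 * (√(n : ℝ) * L n)))
        l (𝓝 0) := by
      have : (fun n : ℕ => √(n : ℝ) * R n * (√(n : ℝ) * R n - 2 * (√(n : ℝ) * L n))) =O[l]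
          fun n : ℕ => √(n : ℝ) * R n := by
        simpa using (isBigO_refl (fun n : ℕ => √(n : ℝ) * R n) l).mul
          ((hRn.isBigO_one ℝ).sub (hLn.const_mul_left 2))
      exact this.trans_tendsto hRn
    refine t.congr' ?_
    filter_upwards [h0.filter_mono hl] with n hn
    have hn' : x n = 0 := hn
    rw [hD, hn']
    have := Real.sq_sqrt (Nat.cast_nonneg (α := ℝ) n)
    linear_combination ((R n - L n) ^ 2) * this

/-- The central limit theorem for multiples of the leading term. -/
theorem asympLaw_leading [∀ n, IsProbabilityMeasure (P n)] (hθ : ∀ n, (θ n).Regular K ε₀ M)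
    (hε₀ : 0 < ε₀) (hM : 0 < M)
    (hZ : ∀ n j, HasLaw (Z n j) (θ n).law (P n)) (hind : ∀ n, iIndepFun (Z n) (P n))
    {t : ℕ → ℝ} {C : ℝ} (ht : ∀ n, |t n| ≤ C) :
    ∃ B, (∀ n, t n ^ 2 * (4 * (θ n).sigmaSq (i n)) ≤ B) ∧
    AsympLaw P (fun n ω => t n * (√(n : ℝ) * (θ n).leading (fun j => Z n j ω) (i n)))
      fun n => (gaussianReal 0 1).map fun x => √(t n ^ 2 * (4 * (θ n).sigmaSq (i n))) * x := by
  have hprob := fun n => (hθ n).isCCA.isProb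
  obtain ⟨c, B, hc, h⟩ := Population.exists_expMoment_lead K hε₀ hM
  have hC : 0 ≤ C := (abs_nonneg _).trans (ht 0)
  have hc' : 0 < c / (C + 1) := by positivity
  -- A multiplier of absolute value at most `C` reduces the order by at most that factor; `C + 1`
  -- avoids dividing by zero.
  have hW : ∀ n, ExpMoment (θ n).law (fun z => t n * (θ n).lead (i n) z) (c / (C + 1)) B :=
    fun n => (h (hθ n) (i n)).const_mul (by
      rw [div_mul_eq_mul_div, div_le_iff₀ (by positivity)]
      nlinarith [ht n])
  have hvar : ∀ n, variance (fun z => t n * (θ n).lead (i n) z) (θ n).law =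
      t n ^ 2 * (4 * (θ n).sigmaSq (i n)) := fun n => by
    rw [variance_const_mul, Population.variance_lead (hθ n)]
  have key := asympLaw_sum hc' hW (fun n => (Population.measurable_lead (i n)).const_mul _)
    (fun n => by rw [integral_const_mul, Population.integral_lead (hθ n), mul_zero]) Z hZ hind
  simp only [hvar] at key
  refine ⟨2 / (c / (C + 1)) ^ 2 * B, fun n => hvar n ▸ (hW n).variance_le hc', ?_⟩
  convert key using 3 with n ω
  rcases eq_or_ne n 0 with rfl | hn
  · simp
  · have hn' : (0 : ℝ) < √(n : ℝ) := Real.sqrt_pos.2 (Nat.cast_pos.2 hn.bot_lt)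
    rw [Population.leading_eq_mean hn, ← Finset.mul_sum]
    have : (n : ℝ)⁻¹ = (√(n : ℝ))⁻¹ * (√(n : ℝ))⁻¹ := by
      rw [← mul_inv, Real.mul_self_sqrt (Nat.cast_nonneg _)]
    rw [this]
    field_simp

end Limit

/-! ### The two limit laws -/

section Limit

variable {r : ℕ} {p q : ℕ → ℕ} {θ : ∀ n, Population r (p n) (q n)} {K : ℝ≥0} {ε₀ M : ℝ}
  {Ω : ℕ → Type*} [∀ n, MeasurableSpace (Ω n)] {P : ∀ n, Measure (Ω n)}
  [∀ n, IsProbabilityMeasure (P n)]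
  {Z : ∀ n, Fin n → Ω n → (Fin (p n) → ℝ) × (Fin (q n) → ℝ)} {i : ∀ n, Fin (p n)}
  {a : ∀ n, Ω n → Fin (p n) → ℝ} {b : ∀ n, Ω n → Fin (q n) → ℝ}
  {Φ : ∀ n, Ω n → Matrix (Fin (p n) ⊕ Fin (q n)) (Fin (p n) ⊕ Fin (q n)) ℝ}
  {rt g lm : ℕ → ℝ}
  (hθ : ∀ n, (θ n).Regular K ε₀ M) (hε₀ : 0 < ε₀) (hM : 0 < M)
  (hZ : ∀ n j, HasLaw (Z n j) (θ n).law (P n)) (hind : ∀ n, iIndepFun (Z n) (P n))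
  (hr : RateBounds (fun n => ((θ n).s : ℝ)) rt g lm) (hS : StochasticBounds P θ i Z a b Φ rt g lm)
  (hm : ∀ n, AEMeasurable (fun ω =>
    debiasedX (fun j => Z n j ω) (a n ω) (b n ω) (Φ n ω) (i n)) (P n))

include hθ hε₀ hM hZ hind hr hS hm

/-- The delta method for the square: the multiplier `-2 x⁰ i` of `√n L` turns the variance `4 σ_i²`
into `16 σ_i² (x⁰ i)²`. The multiplier is bounded because `(x⁰ i)² ≤ M`, as Slutsky's theorem for
moving targets requires. -/
theorem asympLaw_sq_sub :
    AsympLaw P (fun n ω => √(n : ℝ) *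
      (debiasedX (fun j => Z n j ω) (a n ω) (b n ω) (Φ n ω) (i n) ^ 2 -
      (θ n).x0 (i n) ^ 2)) fun n => (gaussianReal 0 1).map fun x =>
        √(16 * (θ n).sigmaSq (i n) * (θ n).x0 (i n) ^ 2) * x := by
  have hx : ∀ n, |-(2 * (θ n).x0 (i n))| ≤ 2 * √M := fun n => by
    rw [abs_neg, abs_mul, abs_two]
    exact mul_le_mul_of_nonneg_left (Real.abs_le_sqrt (Population.x0_sq_le (hθ n) hε₀ hM (i n)))
      zero_le_two
  obtain ⟨B, hB, hU⟩ := asympLaw_leading (i := i) hθ hε₀ hM hZ hind hx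
  have e : ∀ n, (-(2 * (θ n).x0 (i n))) ^ 2 * (4 * (θ n).sigmaSq (i n)) =
      16 * (θ n).sigmaSq (i n) * (θ n).x0 (i n) ^ 2 := fun n => by ring
  simp only [e] at hB hU
  refine hU.of_tendsto_measure (R := √B) (fun n => ?_)
    (fun n => (((hm n).pow_const 2).sub_const _).const_mul _) fun δ hδ => ?_
  · rw [abs_of_nonneg (Real.sqrt_nonneg _)]
    exact Real.sqrt_le_sqrt (hB n)
  · exact tendsto_measure_of_forall_pathBounds hr hS
      (fun l hl ω hb => (tendsto_of_pathBounds hl hθ hε₀ hM hr hb).1) hδ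

/-- At a zero coordinate the first-order term vanishes and the square of `√n L` governs; the
continuous mapping theorem gives `4 σ_i²` times a squared standard normal. -/
theorem asympLaw_sq (h0 : ∀ᶠ n in atTop, (θ n).x0 (i n) = 0) :
    AsympLaw P (fun n ω => (n : ℝ) * debiasedX (fun j => Z n j ω) (a n ω) (b n ω) (Φ n ω) (i n) ^ 2)
      fun n => chiSqOne.map fun x => 4 * (θ n).sigmaSq (i n) * x := by
  obtain ⟨B, hB, hU⟩ := asympLaw_leading (i := i) (t := fun _ => 1) (C := 1) hθ hε₀ hM hZ hind
    fun n => by simp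
  simp only [one_pow, one_mul] at hB hU
  have hσ : ∀ n, 0 ≤ 4 * (θ n).sigmaSq (i n) := fun n =>
    mul_nonneg (by norm_num) (variance_nonneg _ _)
  have hU2 := hU.comp (g := fun x => x ^ 2) (by fun_prop)
  have e : ∀ n, (((gaussianReal 0 1).map fun x => √(4 * (θ n).sigmaSq (i n)) * x).map
      fun x => x ^ 2) = chiSqOne.map fun x => 4 * (θ n).sigmaSq (i n) * x := fun n => by
    rw [chiSqOne, Measure.map_map (by fun_prop) (by fun_prop),
      Measure.map_map (by fun_prop) (by fun_prop)]
    congr 1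
    ext x
    simp only [Function.comp_apply]
    rw [mul_pow, Real.sq_sqrt (hσ n)]
  simp only [e] at hU2
  refine hU2.of_tendsto_measure (R := B) (fun n => ?_)
    (fun n => ((hm n).pow_const 2).const_mul _) fun δ hδ => ?_
  · rw [abs_of_nonneg (hσ n)]
    exact hB n
  · exact tendsto_measure_of_forall_pathBounds hr hS
      (fun l hl ω hb => (tendsto_of_pathBounds hl hθ hε₀ hM hr hb).2 h0) hδ

end Limit

end SCCA

end

/-! ### Verification of the stochastic bounds and conclusion -/

theorem mainTheorem3
    -- dimensions, and the population at each sample size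
    (r : ℕ) (hr : 1 ≤ r) (p q : ℕ → ℕ) (θ : ∀ n, SCCA.Population r (p n) (q n))
    (hθ : ∀ n, (θ n).IsCCA)
    -- sub-Gaussianity, with norms bounded in `n`
    (K : ℝ≥0) (hK : ∀ n, (θ n).SubGaussian K)
    -- eigengap
    (ε₀ : ℝ) (hε₀ : ε₀ ∈ Set.Ioo (0 : ℝ) 1) (hgap : ∀ n, ε₀ < (θ n).rho - (θ n).corr₂)
    -- bounded eigenvalues
    (M : ℝ) (hM : 0 < M)
    (hcovX : ∀ n, SCCA.EigenvaluesBounded (θ n).covX M)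
    (hcovY : ∀ n, SCCA.EigenvaluesBounded (θ n).covY M)
    -- sparsity
    (κ : ℝ) (hκ : κ ∈ Set.Icc (1 / 2 : ℝ) 1)
    (hsU : (fun n => ((θ n).sU : ℝ)) =o[atTop] fun n => (p n : ℝ))
    (hsV : (fun n => ((θ n).sV : ℝ)) =o[atTop] fun n => (q n : ℝ))
    (hs : (fun n => ((θ n).s : ℝ) ^ (2 * κ) * SCCA.lam n (p n) (q n) ^ 2)
      =o[atTop] fun n => (n : ℝ) ^ (-(1 / 2) : ℝ))
    -- the i.i.d. samples
    {Ω : ℕ → Type*} [∀ n, MeasurableSpace (Ω n)] (P : ∀ n, Measure (Ω n))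
    [∀ n, IsProbabilityMeasure (P n)]
    (Z : ∀ n, Fin n → Ω n → (Fin (p n) → ℝ) × (Fin (q n) → ℝ))
    (hZlaw : ∀ n j, HasLaw (Z n j) (θ n).law (P n))
    (hZindep : ∀ n, iIndepFun (Z n) (P n))
    -- the preliminary estimators and the estimator of the inverse Hessian
    (ahat : ∀ n, Ω n → Fin (p n) → ℝ) (hahat : ∀ n, AEMeasurable (ahat n) (P n))
    (bhat : ∀ n, Ω n → Fin (q n) → ℝ) (hbhat : ∀ n, AEMeasurable (bhat n) (P n))
    (Phihat : ∀ n, Ω n → Matrix (Fin (p n) ⊕ Fin (q n)) (Fin (p n) ⊕ Fin (q n)) ℝ)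
    (hPhihat : ∀ n k l, AEMeasurable (fun ω => Phihat n ω k l) (P n))
    (hprelim2 : SCCA.IsBigOp P
      (fun n ω => SCCA.signErr2 (ahat n ω) (θ n).α + SCCA.signErr2 (bhat n ω) (θ n).β)
      (fun n => ((θ n).s : ℝ) ^ κ * SCCA.lam n (p n) (q n)))
    (hprelim1 : SCCA.IsBigOp P
      (fun n ω => SCCA.signErr1 (ahat n ω) (θ n).α + SCCA.signErr1 (bhat n ω) (θ n).β)
      (fun n => ((θ n).s : ℝ) ^ (κ + 1 / 2) * SCCA.lam n (p n) (q n)))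
    (hPhi1 : SCCA.IsBigOp P (fun n ω => SCCA.maxColErr1 (Phihat n ω) (θ n).Phi0)
      (fun n => ((θ n).s : ℝ) ^ (κ + 1 / 2) * SCCA.lam n (p n) (q n)))
    (hPhi2 : SCCA.IsBigOp P (fun n ω => SCCA.maxColErr2 (Phihat n ω) (θ n).Phi0)
      (fun n => ((θ n).s : ℝ) ^ κ * SCCA.lam n (p n) (q n)))
    -- the convention on the relative sign of the two preliminary estimators
    (hsign : Tendsto (fun n => P n {ω |
        SCCA.hatX (fun j => Z n j ω) (ahat n ω) (bhat n ω) ⬝ᵥ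
          SCCA.hatCovXY (fun j => Z n j ω) *ᵥ
            SCCA.hatY (fun j => Z n j ω) (ahat n ω) (bhat n ω) < 0}) atTop (𝓝 0))
    -- the coordinate
    (i : ∀ n, Fin (p n))
    -- the de-biased estimator of its value
    (xdb : ∀ n, Ω n → ℝ)
    (hxdb : xdb = fun n ω =>
      SCCA.debiasedX (fun j => Z n j ω) (ahat n ω) (bhat n ω) (Phihat n ω) (i n)) :
    ((∀ᶠ n in atTop, (θ n).α (i n) ≠ 0) →
      SCCA.AsympLaw P (fun n ω => √(n : ℝ) * (xdb n ω ^ 2 - (θ n).x0 (i n) ^ 2))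
        (fun n => gaussianReal 0 (16 * (θ n).sigmaSq (i n) * (θ n).x0 (i n) ^ 2).toNNReal) ∧
      ∀ v : ℝ≥0, Tendsto (fun n => 16 * (θ n).sigmaSq (i n) * (θ n).x0 (i n) ^ 2)
          atTop (𝓝 (v : ℝ)) →
        TendstoInDistribution (fun (n : ℕ) ω => √(n : ℝ) * (xdb n ω ^ 2 - (θ n).x0 (i n) ^ 2))
          atTop (id : ℝ → ℝ) P (gaussianReal 0 v)) ∧
    ((∀ᶠ n in atTop, (θ n).α (i n) = 0) →
      SCCA.AsympLaw P (fun n ω => (n : ℝ) * xdb n ω ^ 2)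
        (fun n => SCCA.chiSqOne.map fun x => 4 * (θ n).sigmaSq (i n) * x) ∧
      ∀ τ : ℝ, Tendsto (fun n => (θ n).sigmaSq (i n)) atTop (𝓝 τ) →
        TendstoInDistribution (fun (n : ℕ) ω => (n : ℝ) * xdb n ω ^ 2)
          atTop (fun x : ℝ => 4 * τ * x) P SCCA.chiSqOne) := by
  have hε : 0 < ε₀ := hε₀.1
  have hreg : ∀ n, (θ n).Regular K ε₀ M := fun n => ⟨hθ n, hK n, hgap n, hcovX n, hcovY n⟩
  have hsU1 : ∀ n, 1 ≤ (θ n).sU := fun n =>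
    SCCA.Population.one_le_sU (hθ n) (hK n) ((hreg n).gap_lt hε) hM (hcovX n)
  have hp : Tendsto (fun n => (p n : ℝ)) atTop atTop :=
    SCCA.tendsto_atTop_of_one_le_of_isLittleO (fun n => by exact_mod_cast hsU1 n)
      (fun n => Nat.cast_nonneg _) hsU
  have hr' := SCCA.rateBounds (q := q) (s := fun n => (θ n).s)
    (fun n => (hsU1 n).trans (Nat.le_add_right _ _)) hκ.1 hp hs
  have hlog : ∀ᶠ n : ℕ in atTop, n * SCCA.lam n (p n) (q n) ^ 2 =
      Real.log (max (p n) (q n) : ℕ) := by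
    filter_upwards [eventually_ne_atTop 0] with n hn
    have : (n : ℝ) ≠ 0 := Nat.cast_ne_zero.2 hn
    rw [SCCA.lam, Real.sq_sqrt (div_nonneg (Real.log_natCast_nonneg _) (Nat.cast_nonneg _))]
    field_simp
  have hFam : SCCA.IsBigOp P (fun n ω => SCCA.devSup (SCCA.sampleForm (fun j => Z n j ω) -
      (θ n).form) ((θ n).famVec (i n))) fun n => SCCA.lam n (p n) (q n) := by
    -- The family has `p + q + 4 ≤ m²` members when `m = p ∨ q ≥ 4`, hence at most `m⁴ = exp (4 n
    -- λ²)` pairs.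
    refine SCCA.isBigOp_devSup hreg hε hM hZlaw hZindep i (fun n => id) hr'.lm_nonneg hr'.lm_zero
      hr'.one_le (a := 4) ?_
    filter_upwards [hlog, hp.eventually_ge_atTop 4] with n h1 h2
    have h3 : (0 : ℝ) < (max (p n) (q n) : ℕ) :=
      (zero_lt_four.trans_le h2).trans_le (Nat.cast_le.2 (le_max_left _ _))
    rw [h1, show (4 : ℝ) * Real.log (max (p n) (q n) : ℕ) =
      (4 : ℕ) * Real.log (max (p n) (q n) : ℕ) by norm_num, ← Real.log_pow,
      Real.exp_log (by positivity)]
    have h4 : 4 ≤ p n := by exact_mod_cast h2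
    have h5 : p n ≤ max (p n) (q n) := le_max_left _ _
    have h6 : q n ≤ max (p n) (q n) := le_max_right _ _
    set m := max (p n) (q n)
    have h7 : p n + q n + 4 ≤ m ^ 2 := by nlinarith
    have : Fintype.card (((Fin (p n) ⊕ Fin (q n)) ⊕ Fin 4) × ((Fin (p n) ⊕ Fin (q n)) ⊕ Fin 4)) ≤
        m ^ 4 := by
      simp only [Fintype.card_prod, Fintype.card_sum, Fintype.card_fin]
      calc _ ≤ m ^ 2 * m ^ 2 := Nat.mul_le_mul h7 h7
        _ = m ^ 4 := by ring
    exact_mod_cast this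
  have hRef : SCCA.IsBigOp P (fun n ω => SCCA.devSup (SCCA.sampleForm (fun j => Z n j ω) -
      (θ n).form) ((θ n).refVec (i n))) fun n => (√(n : ℝ))⁻¹ := by
    have hone : ∀ᶠ n : ℕ in atTop, n * (√(n : ℝ))⁻¹ ^ 2 = 1 := by
      filter_upwards [eventually_ne_atTop 0] with n hn
      rw [inv_pow, Real.sq_sqrt (Nat.cast_nonneg _), mul_inv_cancel₀ (Nat.cast_ne_zero.2 hn)]
    -- Four reference vectors form `16` pairs, and `n τ² = 1` for `τ = n^(-1/2)`.
    refine SCCA.isBigOp_devSup hreg hε hM hZlaw hZindep i (fun n => Sum.inr)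
      (fun n => inv_nonneg.2 (Real.sqrt_nonneg _)) ?_ (hone.mono fun n hn => hn.ge)
      (a := Real.log 16) ?_
    · exact tendsto_inv_atTop_zero.comp (Real.tendsto_sqrt_atTop.comp tendsto_natCast_atTop_atTop)
    · filter_upwards [hone] with n hn
      rw [hn, mul_one, Real.exp_log (by norm_num)]
      norm_num [Fintype.card_prod]
  have hS : SCCA.StochasticBounds P θ i Z ahat bhat Phihat _ _ _ :=
    ⟨hprelim2, hprelim1, hPhi1, hPhi2, hFam, hRef, hsign⟩
  have hm : ∀ n, AEMeasurable (fun ω =>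
      SCCA.debiasedX (fun j => Z n j ω) (ahat n ω) (bhat n ω) (Phihat n ω) (i n)) (P n) := fun n =>
    SCCA.aemeasurable_debiasedX (fun j => (hZlaw n j).aemeasurable) (hahat n) (hbhat n)
      (hPhihat n) (i n)
  subst hxdb
  have hσ : ∀ n, 0 ≤ (θ n).sigmaSq (i n) := fun n => variance_nonneg _ _
  refine ⟨fun _ => ?_, fun hα => ?_⟩
  · have T := SCCA.asympLaw_sq_sub hreg hε hM hZlaw hZindep hr' hS hm
    refine ⟨?_, fun v hv => ?_⟩
    · have e : ∀ n, 0 ≤ 16 * (θ n).sigmaSq (i n) * (θ n).x0 (i n) ^ 2 := fun n =>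
        mul_nonneg (mul_nonneg (by norm_num) (hσ n)) (sq_nonneg _)
      simp only [fun n => SCCA.gaussianReal_map_sqrt_mul (e n)] at T
      exact T
    · refine T.tendstoInDistribution aemeasurable_id fun f => ?_
      have h1 := SCCA.tendsto_integral_map_mul (gaussianReal 0 1)
        ((Real.continuous_sqrt.tendsto _).comp hv) f
      have h2 : ∫ x, f (√(v : ℝ) * x) ∂gaussianReal 0 1 = ∫ x, f (id x) ∂gaussianReal 0 v := by
        have h3 := SCCA.gaussianReal_map_sqrt_mul v.coe_nonneg
        rw [Real.toNNReal_coe] at h3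
        rw [← h3, integral_map (by fun_prop) (by exact f.continuous.aestronglyMeasurable)]
        rfl
      rw [← h2]
      exact h1
  · have hx0 : ∀ᶠ n in atTop, (θ n).x0 (i n) = 0 := hα.mono fun n hn => by
      simp [SCCA.Population.x0, hn]
    have T := SCCA.asympLaw_sq hreg hε hM hZlaw hZindep hr' hS hm hx0
    refine ⟨T, fun τ hτ => ?_⟩
    refine T.tendstoInDistribution (by fun_prop) fun f => ?_
    exact SCCA.tendsto_integral_map_mul SCCA.chiSqOne (hτ.const_mul 4) f
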